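/- Let $K$ be a field. All algebras are finite-dimensional indecomposable (in particular nonzero) $K$-algebras, quivers $Q$ are finite, $ab$ denotes the path "$a$ followed by $b$" (and $ab=0$ in $KQ$ if $a,b$ are not composable), and presentations $KQ/I$ have an admissible ideal $I$. *Almost gentle algebras.* $A$ is almost gentle if $A\cong KQ/I$ where (S0) $I$ is generated by paths of length $2$, and (S1) for every arrow $a$ there is at most one arrow $b$ with $ab\notin I$ and at most one arrow $c$ with $ca\notin I$. A path $m$ (possibly trivial) is *maximal* if $m\notin I$ and $am\in I$, $ma\in I$ for all arrows $a$. Let $T(A)=A\ltimes D(A)$, $D(A)=\operatorname{Hom}_K(A,K)$, be the trivial extension, with product $(a,f)(b,g)=(ab,ag+fb)$, where $(afb)(x)=f(bxa)$. For a maximal path $m$ put $\beta_m=(0,m^\vee)\in T(A)$, where $m^\vee$ is the element belonging to $m$ of the basis of $D(A)$ dual to the basis of $A$ formed by the paths not in $I$. *Symmetric special multiserial algebras.* A simple cycle is a closed path of positive length without repeated arrows. A defining pair $(\mathcal S,\mu)$ in $Q$ is a set $\mathcal S$ of simple cycles with $\mu:\mathcal S\to\mathbb Z_{>0}$ such that: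 (D0) $\mu(C)>1$ for each loop $C\in\mathcal S$, except if that loop is the only arrow of $Q$; (D1) $\mathcal S$ is closed under cyclic permutation; (D2) $\mu$ is invariant under cyclic permutation; (D3) every arrow lies on a cycle in $\mathcal S$; (D4) two cycles in $\mathcal S$ with a common arrow are cyclic permutations of each other. The algebra defined by $(\mathcal S,\mu)$ is $KQ/I$, where $I$ is generated by: $C^{\mu(C)}-C'^{\mu(C')}$ for $C,C'\in\mathcal S$ at the same vertex; $C^{\mu(C)}a$ for $C\in\mathcal S$ with first arrow $a$; and $ab$ for arrows $a,b$ such that $ab$ does not lie on any $C^{\mu(C)}$, $C\in\mathcal S$. An admissible cut $D$ of $Q$ is a set of arrows that contains exactly one arrow of each $C\in\mathcal S$. Consider the pairs $(\Lambda,D)$ in which $\Lambda\cong KQ_\Lambda/I_\Lambda$ is a symmetric algebra satisfying (S1), $Q_\Lambda$ has at least one arrow (that is, $\Lambda\not\cong K$), $\Lambda$ is defined by a defining pair $(\mathcal S,\mu)$ with $\mu\equiv 1$, and $D$ is an admissible cut of $Q_\Lambda$. The pairs $(\Lambda,D)$ and $(\Lambda',D')$ are equivalent if there is a $K$-algebra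 isomorphism $\Lambda\to\Lambda'$ that sends (the image in $\Lambda$ of) $D$ onto (the image in $\Lambda'$ of) $D'$. The cut algebra of $(\Lambda,D)$ is $KQ_\Lambda/\langle I_\Lambda\cup D\rangle=\Lambda/\langle D\rangle$. **Corollary 5.5.** There is a bijection $\varphi:\mathcal A\to\mathcal X$ from the set $\mathcal A$ of isomorphism classes of almost gentle algebras to the set $\mathcal X$ of equivalence classes of such pairs. It is given by $\varphi(A)=(T(A),\{\beta_m\mid m\text{ a maximal path of }A\})$, which is such a pair for every presentation $A\cong KQ/I$ satisfying (S0) and (S1), and whose class does not depend on the presentation. For a pair $(\Lambda,D)$ the cut algebra is almost gentle, and $\varphi^{-1}(\Lambda,D)$ is its isomorphism class. -/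

import Mathlib

universe u

noncomputable section

namespace AlmostGentle

/-! ### Finite quivers and their paths -/

/-- A finite quiver: vertices `V`, arrows `E`, each arrow with a source and a target. -/
structure FinQuiver where
  V : Type
  E : Type
  [fintypeV : Fintype V]
  [fintypeE : Fintype E]
  src : E → V
  tgt : E → V

attribute [instance] FinQuiver.fintypeV FinQuiver.fintypeE

namespace FinQuiver

variable (Q : FinQuiver)

/-- `l = [a₁, …, aₙ]` can be walked through, in this order, starting at the vertex `v`. -/
def IsWalk : Q.V → List Q.E → Prop
  | _, [] => True
  | v, a :: l => Q.src a = v ∧ IsWalk (Q.tgt a) l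

/-- The vertex in which a walk ends. -/
def walkEnd : Q.V → List Q.E → Q.V
  | v, [] => v
  | _, a :: l => walkEnd (Q.tgt a) l

/-- A directed path `a₁ a₂ ⋯ aₙ` (first `a₁`, then `a₂`, …); the trivial path at a vertex `v` is the
one with first vertex `v` and no arrows. -/
@[ext]
structure QPath where
  first : Q.V
  arrows : List Q.E
  isWalk : Q.IsWalk first arrows

variable {Q}

theorem isWalk_append (v : Q.V) (l l' : List Q.E) :
    Q.IsWalk v (l ++ l') ↔ Q.IsWalk v l ∧ Q.IsWalk (Q.walkEnd v l) l' := by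
  induction l generalizing v with
  | nil => simp [IsWalk, walkEnd]
  | cons a l ih => simp [IsWalk, walkEnd, ih, and_assoc]

theorem walkEnd_append (v : Q.V) (l l' : List Q.E) :
    Q.walkEnd v (l ++ l') = Q.walkEnd (Q.walkEnd v l) l' := by
  induction l generalizing v with
  | nil => simp [walkEnd]
  | cons a l ih => simp [walkEnd, ih]

namespace QPath

/-- The last vertex of a path. -/
def last (p : Q.QPath) : Q.V := Q.walkEnd p.first p.arrows

/-- The length of a path. -/
def length (p : Q.QPath) : ℕ := p.arrows.length

/-- The trivial path `e_v`. -/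
def triv (v : Q.V) : Q.QPath := ⟨v, [], trivial⟩

/-- An arrow as a path of length one. -/
def single (a : Q.E) : Q.QPath := ⟨Q.src a, [a], rfl, trivial⟩

/-- Concatenation of two composable paths, `p` followed by `q`. -/
def comp (p q : Q.QPath) (h : p.last = q.first) : Q.QPath :=
  ⟨p.first, p.arrows ++ q.arrows, (isWalk_append _ _ _).2 ⟨p.isWalk, by
    have := q.isWalk
    rw [← h] at this
    exact this⟩⟩

theorem last_comp (p q : Q.QPath) (h : p.last = q.first) : (p.comp q h).last = q.last := by
  unfold last comp
  rw [walkEnd_append]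
  change Q.walkEnd p.last q.arrows = _
  rw [h]

/-- Simple cycles: closed paths of positive length without repeated arrows. -/
def IsSimpleCycle (C : Q.QPath) : Prop :=
  C.arrows ≠ [] ∧ C.last = C.first ∧ C.arrows.Nodup

end QPath

end FinQuiver

/-! ### The path algebra -/

variable (K : Type u) [Field K] (Q : FinQuiver)

/-- The path algebra `KQ`: the vector space with the paths of `Q` as a basis. The product of two
paths is their concatenation when they are composable, and zero otherwise. -/
def PathAlgebra : Type u := Q.QPath →₀ K

namespace PathAlgebra

instance : AddCommGroup (PathAlgebra K Q) := inferInstanceAs (AddCommGroup (Q.QPath →₀ K))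

instance : Module K (PathAlgebra K Q) := inferInstanceAs (Module K (Q.QPath →₀ K))

variable {Q}

/-- The basis element of a path. -/
def ofPath (p : Q.QPath) : PathAlgebra K Q := Finsupp.single p (1 : K)

/-- The basis element of an arrow. -/
def ofArrow (a : Q.E) : PathAlgebra K Q := ofPath K (FinQuiver.QPath.single a)

open Classical in
/-- The product of two paths. -/
def pathMul (p q : Q.QPath) : PathAlgebra K Q :=
  if h : p.last = q.first then ofPath K (p.comp q h) else 0

variable {K}

/-- The paths that occur in an element of the path algebra. -/
def support (x : PathAlgebra K Q) : Finset Q.QPath := Finsupp.support x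

/-- The linear map with prescribed values on the paths. -/
def lift {M : Type*} [AddCommGroup M] [Module K M] (f : Q.QPath → M) : PathAlgebra K Q →ₗ[K] M :=
  Finsupp.linearCombination K f

theorem lift_ofPath {M : Type*} [AddCommGroup M] [Module K M] (f : Q.QPath → M) (p : Q.QPath) :
    lift f (ofPath K p) = f p := by
  unfold lift ofPath
  exact (Finsupp.linearCombination_single K (1 : K) p).trans (one_smul _ _)

theorem induction {P : PathAlgebra K Q → Prop} (x : PathAlgebra K Q) (zero : P 0)
    (add : ∀ x y, P x → P y → P (x + y)) (path : ∀ (c : K) (p : Q.QPath), P (c • ofPath K p)) :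
    P x := by
  refine Finsupp.induction_linear (motive := P) x zero add fun p c => ?_
  have h : c • ofPath K p = Finsupp.single p c :=
    (Finsupp.smul_single c p (1 : K)).trans (by simp)
  exact h ▸ path c p

/-- The multiplication, as a bilinear map. -/
def mulHom : PathAlgebra K Q →ₗ[K] PathAlgebra K Q →ₗ[K] PathAlgebra K Q :=
  lift fun p => lift fun q => pathMul K p q

instance : Mul (PathAlgebra K Q) := ⟨fun x y => mulHom x y⟩

instance : One (PathAlgebra K Q) := ⟨∑ v : Q.V, ofPath K (FinQuiver.QPath.triv v)⟩

theorem mul_def (x y : PathAlgebra K Q) : x * y = mulHom x y := rfl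

theorem one_def : (1 : PathAlgebra K Q) = ∑ v : Q.V, ofPath K (FinQuiver.QPath.triv v) := rfl

theorem ofPath_mul_ofPath (p q : Q.QPath) : ofPath K p * ofPath K q = pathMul K p q := by
  rw [mul_def, mulHom, lift_ofPath, lift_ofPath]

theorem pathMul_of_eq (p q : Q.QPath) (h : p.last = q.first) :
    pathMul K p q = ofPath K (p.comp q h) := dif_pos h

theorem pathMul_of_ne (p q : Q.QPath) (h : ¬ p.last = q.first) : pathMul K p q = 0 := dif_neg h

theorem mul_assoc_path (p q r : Q.QPath) :
    mulHom (pathMul K p q) (ofPath K r) = mulHom (ofPath K p) (pathMul K q r) := by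
  by_cases h₁ : p.last = q.first
  · by_cases h₂ : q.last = r.first
    · rw [pathMul_of_eq p q h₁, pathMul_of_eq q r h₂, ← mul_def, ← mul_def, ofPath_mul_ofPath,
        ofPath_mul_ofPath, pathMul_of_eq _ _ ((FinQuiver.QPath.last_comp p q h₁).trans h₂),
        pathMul_of_eq p (q.comp r h₂) h₁]
      congr 1
      simp [FinQuiver.QPath.comp]
    · rw [pathMul_of_eq p q h₁, pathMul_of_ne q r h₂, ← mul_def, ofPath_mul_ofPath,
        pathMul_of_ne _ _ (by rwa [FinQuiver.QPath.last_comp]), map_zero]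
  · by_cases h₂ : q.last = r.first
    · rw [pathMul_of_ne p q h₁, pathMul_of_eq q r h₂, ← mul_def _ (ofPath K (q.comp r h₂)),
        ofPath_mul_ofPath, pathMul_of_ne p (q.comp r h₂) h₁, map_zero, LinearMap.zero_apply]
    · rw [pathMul_of_ne p q h₁, pathMul_of_ne q r h₂, map_zero, map_zero, LinearMap.zero_apply]

theorem mulHom_assoc (x y z : PathAlgebra K Q) :
    mulHom (mulHom x y) z = mulHom x (mulHom y z) := by
  induction x using PathAlgebra.induction with
  | zero => simp
  | add x x' hx hx' => simp [hx, hx']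
  | path c p =>
    induction y using PathAlgebra.induction with
    | zero => simp
    | add y y' hy hy' =>
      simp only [map_add, LinearMap.add_apply] at hy hy' ⊢
      rw [hy, hy']
    | path d q =>
      induction z using PathAlgebra.induction with
      | zero => simp
      | add z z' hz hz' =>
        simp only [map_add] at hz hz' ⊢
        rw [hz, hz']
      | path e r =>
        have h := mul_assoc_path (K := K) p q r
        rw [← ofPath_mul_ofPath, ← ofPath_mul_ofPath, mul_def, mul_def] at h
        simp only [map_smul, LinearMap.smul_apply, h]

theorem one_mulHom (x : PathAlgebra K Q) : mulHom 1 x = x := by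
  induction x using PathAlgebra.induction with
  | zero => simp
  | add x y hx hy => rw [map_add, hx, hy]
  | path c p =>
    rw [map_smul, one_def, map_sum, LinearMap.sum_apply, Finset.sum_eq_single p.first]
    · rw [← mul_def, ofPath_mul_ofPath, pathMul_of_eq _ _ rfl]
      rfl
    · intro v _ hv
      rw [← mul_def, ofPath_mul_ofPath, pathMul_of_ne (FinQuiver.QPath.triv v) p hv]
    · simp

theorem mulHom_one (x : PathAlgebra K Q) : mulHom x 1 = x := by
  induction x using PathAlgebra.induction with
  | zero => simp
  | add x y hx hy => rw [map_add, LinearMap.add_apply, hx, hy]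
  | path c p =>
    rw [map_smul, LinearMap.smul_apply, one_def, map_sum, Finset.sum_eq_single p.last]
    · rw [← mul_def, ofPath_mul_ofPath, pathMul_of_eq _ _ rfl]
      congr 2
      simp [FinQuiver.QPath.comp, FinQuiver.QPath.triv]
    · intro v _ hv
      rw [← mul_def, ofPath_mul_ofPath, pathMul_of_ne _ _ (Ne.symm hv)]
    · simp

instance : Ring (PathAlgebra K Q) :=
  { (inferInstance : AddCommGroup (PathAlgebra K Q)) with
    mul := (· * ·)
    one := 1
    left_distrib := fun x y z => map_add (mulHom x) y z
    right_distrib := fun x y z => by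
      rw [mul_def, mul_def, mul_def, map_add, LinearMap.add_apply]
    zero_mul := fun x => by rw [mul_def, map_zero, LinearMap.zero_apply]
    mul_zero := fun x => map_zero (mulHom x)
    mul_assoc := mulHom_assoc
    one_mul := one_mulHom
    mul_one := mulHom_one }

instance : Algebra K (PathAlgebra K Q) :=
  Algebra.ofModule
    (fun c x y => by rw [mul_def, mul_def, map_smul, LinearMap.smul_apply])
    (fun c x y => map_smul (mulHom x) c y)

end PathAlgebra

/-! ### Conditions on ideals of path algebras and on algebras -/

variable {Q}

/-- Admissible ideals: `J ^ N ⊆ I ⊆ J ^ 2` for some `N`, where `J` is the ideal generated by the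
arrows. Since `J ^ n` is spanned by the paths of length at least `n`, this says that only paths of
length at least two occur in elements of `I`, and that all sufficiently long paths are in `I`. -/
def IsAdmissible (I : TwoSidedIdeal (PathAlgebra K Q)) : Prop :=
  (∀ x ∈ I, ∀ p ∈ PathAlgebra.support x, 2 ≤ p.length) ∧
    ∃ N : ℕ, ∀ p : Q.QPath, N ≤ p.length → PathAlgebra.ofPath K p ∈ I

/-- `I` is generated by a set of paths of length two. -/
def IsGeneratedByPathsOfLengthTwo (I : TwoSidedIdeal (PathAlgebra K Q)) : Prop :=
  ∃ R : Set Q.QPath, (∀ p ∈ R, p.length = 2) ∧ I = TwoSidedIdeal.span (PathAlgebra.ofPath K '' R)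

/-- The special multiserial condition: for every arrow `a` there is at most one arrow `b` with
`ab ∉ I`, and at most one arrow `c` with `ca ∉ I`. (If `a` and `b` are not composable, then `ab` is
zero in the path algebra.) -/
def IsSpecialMultiserial (I : TwoSidedIdeal (PathAlgebra K Q)) : Prop :=
  (∀ a b b' : Q.E, PathAlgebra.ofArrow K a * PathAlgebra.ofArrow K b ∉ I →
    PathAlgebra.ofArrow K a * PathAlgebra.ofArrow K b' ∉ I → b = b') ∧
  (∀ a c c' : Q.E, PathAlgebra.ofArrow K c * PathAlgebra.ofArrow K a ∉ I →
    PathAlgebra.ofArrow K c' * PathAlgebra.ofArrow K a ∉ I → c = c')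

/-- Indecomposable algebras: nonzero, and not a product of two nonzero algebras. -/
def IsIndecomposable (A : Type u) [Ring A] : Prop :=
  Nontrivial A ∧ ∀ e ∈ Subring.center A, IsIdempotentElem e → e = 0 ∨ e = 1

/-- Symmetric algebras: there is a symmetric nondegenerate associative bilinear form, given by a
linear form `t` as `(x, y) ↦ t (x * y)`. (It is used for finite-dimensional algebras only.) -/
def IsSymmetricAlgebra (A : Type u) [Ring A] [Algebra K A] : Prop :=
  ∃ t : A →ₗ[K] K, (∀ x y, t (x * y) = t (y * x)) ∧ ∀ x, (∀ y, t (x * y) = 0) → x = 0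

/-! ### Almost gentle algebras -/

/-- A presentation `A ≅ KQ / I` of an algebra that exhibits it as almost gentle; it is given by
the surjection `π : KQ → A` with kernel `I`. -/
structure AlmostGentlePresentation (A : Type u) [Ring A] [Algebra K A] where
  quiver : FinQuiver
  π : PathAlgebra K quiver →ₐ[K] A
  surjective : Function.Surjective π
  admissible : IsAdmissible K (TwoSidedIdeal.ker π)
  quadratic : IsGeneratedByPathsOfLengthTwo K (TwoSidedIdeal.ker π)
  multiserial : IsSpecialMultiserial K (TwoSidedIdeal.ker π)

/-- The (basic, indecomposable) almost gentle algebras: those of the form `KQ / I`. -/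
def IsAlmostGentle (A : Type u) [Ring A] [Algebra K A] : Prop :=
  IsIndecomposable A ∧ Nonempty (AlmostGentlePresentation K A)

/-! ### Trivial extensions -/

/-- The dual `D(A) = Hom_K(A, K)`, regarded as an `A`-`A`-bimodule by `(a f b)(x) = f (b x a)`. -/
def DualBimodule (A : Type u) [Ring A] [Algebra K A] : Type u := A →ₗ[K] K

namespace DualBimodule

variable {A : Type u} [Ring A] [Algebra K A]

instance : AddCommGroup (DualBimodule K A) := inferInstanceAs (AddCommGroup (A →ₗ[K] K))

instance : Module K (DualBimodule K A) := inferInstanceAs (Module K (A →ₗ[K] K))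

/-- A linear form as an element of the bimodule. -/
def of (f : A →ₗ[K] K) : DualBimodule K A := f

variable {K}

/-- The linear form underlying an element of the bimodule. -/
def form (f : DualBimodule K A) : A →ₗ[K] K := f

theorem form_ext {f g : DualBimodule K A} (h : ∀ x, f.form x = g.form x) : f = g :=
  LinearMap.ext h

instance : SMul A (DualBimodule K A) :=
  ⟨fun a f => of K (f.form ∘ₗ LinearMap.mulRight K a)⟩

instance : SMul Aᵐᵒᵖ (DualBimodule K A) :=
  ⟨fun b f => of K (f.form ∘ₗ LinearMap.mulLeft K b.unop)⟩

theorem smul_form (a : A) (f : DualBimodule K A) (x : A) : (a • f).form x = f.form (x * a) := rfl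

theorem op_smul_form (b : Aᵐᵒᵖ) (f : DualBimodule K A) (x : A) :
    (b • f).form x = f.form (b.unop * x) := rfl

theorem add_form (f g : DualBimodule K A) (x : A) : (f + g).form x = f.form x + g.form x := rfl

theorem zero_form (x : A) : (0 : DualBimodule K A).form x = 0 := rfl

instance : Module A (DualBimodule K A) where
  one_smul f := form_ext fun x => by rw [smul_form, mul_one]
  mul_smul a b f := form_ext fun x => by simp only [smul_form, mul_assoc]
  smul_zero a := rfl
  smul_add a f g := rfl
  add_smul a b f := form_ext fun x => by rw [add_form, smul_form, smul_form, smul_form, mul_add,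
    map_add]
  zero_smul f := form_ext fun x => by rw [smul_form, mul_zero, map_zero, zero_form]

instance : Module Aᵐᵒᵖ (DualBimodule K A) where
  one_smul f := form_ext fun x => by rw [op_smul_form, MulOpposite.unop_one, one_mul]
  mul_smul a b f := form_ext fun x => by
    simp only [op_smul_form, MulOpposite.unop_mul, mul_assoc]
  smul_zero a := rfl
  smul_add a f g := rfl
  add_smul a b f := form_ext fun x => by rw [add_form, op_smul_form, op_smul_form, op_smul_form,
    MulOpposite.unop_add, add_mul, map_add]
  zero_smul f := form_ext fun x => by rw [op_smul_form, MulOpposite.unop_zero, zero_mul, map_zero,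
    zero_form]

instance : SMulCommClass A Aᵐᵒᵖ (DualBimodule K A) :=
  ⟨fun a b f => form_ext fun x => by simp only [smul_form, op_smul_form, mul_assoc]⟩

theorem form_smul (c : K) (f : DualBimodule K A) (x : A) : (c • f).form x = c * f.form x := rfl

instance : IsScalarTower K A (DualBimodule K A) :=
  ⟨fun c a f => form_ext fun x => by
    rw [form_smul, smul_form, smul_form, mul_smul_comm, map_smul, smul_eq_mul]⟩

instance : IsScalarTower K Aᵐᵒᵖ (DualBimodule K A) :=
  ⟨fun c a f => form_ext fun x => by
    rw [form_smul, op_smul_form, op_smul_form, MulOpposite.unop_smul, smul_mul_assoc, map_smul,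
      smul_eq_mul]⟩

end DualBimodule

/-- The trivial extension `T(A) = A ⋉ D(A)`: the vector space `A ⊕ D(A)` with the multiplication
`(a, f) (b, g) = (a b, a g + f b)`. -/
abbrev TrivialExtension (A : Type u) [Ring A] [Algebra K A] : Type u :=
  TrivSqZeroExt A (DualBimodule K A)

namespace AlmostGentlePresentation

variable {K} {A : Type u} [Ring A] [Algebra K A] (P : AlmostGentlePresentation K A)

/-- The image of a path in `A`. -/
def path (p : P.quiver.QPath) : A := P.π (PathAlgebra.ofPath K p)

/-- The image of an arrow in `A`. -/
def arrow (a : P.quiver.E) : A := P.π (PathAlgebra.ofArrow K a)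

/-- Maximal paths: `p ∉ I`, but `a p ∈ I` and `p a ∈ I` for all arrows `a`. -/
def IsMaximalPath (p : P.quiver.QPath) : Prop :=
  P.path p ≠ 0 ∧ ∀ a : P.quiver.E, P.arrow a * P.path p = 0 ∧ P.path p * P.arrow a = 0

open Classical in
/-- `f` is the element `m^∨` of the basis of `D(A)` dual to the basis of `A` that consists of the
paths that are not in `I`. -/
def IsDualOfPath (m : P.quiver.QPath) (f : A →ₗ[K] K) : Prop :=
  ∀ p : P.quiver.QPath, P.path p ≠ 0 → f (P.path p) = if p = m then 1 else 0

/-- The set `{β_m | m a maximal path}` of new arrows of the trivial extension, where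
`β_m = (0, m^∨)`. -/
def newArrows : Set (TrivialExtension K A) :=
  {x | ∃ (m : P.quiver.QPath) (f : A →ₗ[K] K), P.IsMaximalPath m ∧ P.IsDualOfPath m f ∧
    x = TrivSqZeroExt.inr (DualBimodule.of K f)}

end AlmostGentlePresentation

/-! ### Algebras defined by cycles, and admissible cuts -/

/-- Defining pairs `(S, μ)`: a set `S` of simple cycles and a positive multiplicity function `μ`.
As usual, loops in `S` have multiplicity greater than one; the only exception is the quiver whose
single arrow is that loop (the loop with multiplicity one then defines `K[x] / (x ^ 2)`). -/
structure IsDefiningPair (S : Set Q.QPath) (μ : Q.QPath → ℕ) : Prop where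
  simple : ∀ C ∈ S, C.IsSimpleCycle
  pos : ∀ C ∈ S, 0 < μ C
  loop : ∀ C ∈ S, C.length = 1 → Nontrivial Q.E → 1 < μ C
  rotate : ∀ C ∈ S, ∀ C' : Q.QPath, C'.arrows.IsRotated C.arrows → C' ∈ S
  mult_rotate : ∀ C ∈ S, ∀ C' : Q.QPath, C'.arrows.IsRotated C.arrows → μ C' = μ C
  cover : ∀ a : Q.E, ∃ C ∈ S, a ∈ C.arrows
  unique : ∀ a : Q.E, ∀ C ∈ S, ∀ C' ∈ S, a ∈ C.arrows → a ∈ C'.arrows →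
    C'.arrows.IsRotated C.arrows

/-- The relations of the algebra defined by the cycles `(S, μ)`. -/
inductive CycleRelation (S : Set Q.QPath) (μ : Q.QPath → ℕ) : PathAlgebra K Q → Prop
  /-- `C ^ μ(C) - C' ^ μ(C')` for cycles `C, C'` in `S` at the same vertex. -/
  | typeOne (C C' : Q.QPath) (hC : C ∈ S) (hC' : C' ∈ S) (h : C.first = C'.first) :
      CycleRelation S μ (PathAlgebra.ofPath K C ^ μ C - PathAlgebra.ofPath K C' ^ μ C')
  /-- `C ^ μ(C) a` for a cycle `C` in `S` with first arrow `a`. -/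
  | typeTwo (C : Q.QPath) (a : Q.E) (hC : C ∈ S) (h : C.arrows.head? = some a) :
      CycleRelation S μ (PathAlgebra.ofPath K C ^ μ C * PathAlgebra.ofArrow K a)
  /-- `a b` for arrows `a, b` such that `a b` does not lie on any cycle `C ^ μ(C)`, `C ∈ S`. -/
  | typeThree (a b : Q.E)
      (h : ∀ C ∈ S, ¬ [a, b] <:+: (List.replicate (μ C) C.arrows).flatten) :
      CycleRelation S μ (PathAlgebra.ofArrow K a * PathAlgebra.ofArrow K b)

/-- Admissible cuts: sets of arrows that contain exactly one arrow of each special cycle. -/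
def IsAdmissibleCut (S : Set Q.QPath) (D : Set Q.E) : Prop :=
  ∀ C ∈ S, ∃! a : Q.E, a ∈ D ∧ a ∈ C.arrows

/-- `(Λ, D)` is a pair consisting of an (indecomposable) symmetric special multiserial algebra
`Λ ≅ KQ / I` with at least one arrow in its quiver, defined by a defining pair `(S, μ)` with `μ`
identically one, and of (the set of images in `Λ` of the arrows of) an admissible cut of `Q`. -/
def IsCutPair (Λ : Type u) [Ring Λ] [Algebra K Λ] (D : Set Λ) : Prop :=
  IsIndecomposable Λ ∧ IsSymmetricAlgebra K Λ ∧
    ∃ (Q : FinQuiver) (π : PathAlgebra K Q →ₐ[K] Λ) (S : Set Q.QPath) (μ : Q.QPath → ℕ)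
      (cut : Set Q.E),
      Nonempty Q.E ∧ Function.Surjective π ∧
      IsAdmissible K (TwoSidedIdeal.ker π) ∧ IsSpecialMultiserial K (TwoSidedIdeal.ker π) ∧
      IsDefiningPair S μ ∧ (∀ C ∈ S, μ C = 1) ∧
      TwoSidedIdeal.ker π = TwoSidedIdeal.span {x | CycleRelation K S μ x} ∧
      IsAdmissibleCut S cut ∧ D = (fun a => π (PathAlgebra.ofArrow K a)) '' cut

/-- The cut algebra. If `Λ = KQ / I` and `D` is the set of images of a cut of `Q`, then `Λ / ⟨D⟩` is
the quotient of `KQ` by the ideal generated by `I` and the cut. -/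
abbrev CutAlgebra (Λ : Type u) [Ring Λ] (D : Set Λ) : Type u :=
  (TwoSidedIdeal.span D).ringCon.Quotient

/-! ### Isomorphism classes -/

/-- Almost gentle `K`-algebras. -/
structure AlmostGentleAlgebra where
  carrier : Type u
  [ring : Ring carrier]
  [algebra : Algebra K carrier]
  isAlmostGentle : IsAlmostGentle K carrier

attribute [instance] AlmostGentleAlgebra.ring AlmostGentleAlgebra.algebra

/-- Pairs consisting of a symmetric special multiserial algebra and an admissible cut. -/
structure CutPair where
  carrier : Type u
  [ring : Ring carrier]
  [algebra : Algebra K carrier]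
  cut : Set carrier
  isCutPair : IsCutPair K carrier cut

attribute [instance] CutPair.ring CutPair.algebra

/-- Isomorphism of almost gentle algebras: isomorphism of `K`-algebras. -/
instance AlmostGentleAlgebra.setoid : Setoid (AlmostGentleAlgebra K) where
  r A B := Nonempty (A.carrier ≃ₐ[K] B.carrier)
  iseqv :=
    ⟨fun _ => ⟨AlgEquiv.refl⟩, fun ⟨e⟩ => ⟨e.symm⟩, fun ⟨e⟩ ⟨f⟩ => ⟨e.trans f⟩⟩

/-- Equivalence of pairs: an isomorphism of `K`-algebras that sends one cut to the other. -/
instance CutPair.setoid : Setoid (CutPair K) where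
  r X Y := ∃ e : X.carrier ≃ₐ[K] Y.carrier, e '' X.cut = Y.cut
  iseqv :=
    ⟨fun _ => ⟨AlgEquiv.refl, by simp⟩,
      fun {X Y} ⟨e, he⟩ => ⟨e.symm, by rw [← he, Set.image_image]; simp⟩,
      fun {X Y Z} ⟨e, he⟩ ⟨f, hf⟩ => ⟨e.trans f, by rw [← hf, ← he, Set.image_image]; rfl⟩⟩

/-- The set of isomorphism classes of almost gentle algebras. -/
abbrev AlmostGentleClass : Type (u + 1) := Quotient (AlmostGentleAlgebra.setoid K)

/-- The set of equivalence classes of pairs. -/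
abbrev CutPairClass : Type (u + 1) := Quotient (CutPair.setoid K)

variable {K}

/-- The isomorphism class of an almost gentle algebra. -/
def almostGentleClass (A : Type u) [Ring A] [Algebra K A] (h : IsAlmostGentle K A) :
    AlmostGentleClass K := Quotient.mk _ ⟨A, h⟩

/-- The equivalence class of a pair. -/
def cutPairClass (Λ : Type u) [Ring Λ] [Algebra K Λ] (D : Set Λ) (h : IsCutPair K Λ D) :
    CutPairClass K := Quotient.mk _ ⟨Λ, D, h⟩

end AlmostGentle

end

noncomputable section

namespace AlmostGentle

/-! ### Homomorphisms out of quotients -/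

section Quotients

variable {K : Type*} [Field K] {R A B : Type*} [Ring R] [Algebra K R] [Ring A] [Algebra K A]
  [Ring B] [Algebra K B]

/-! By (S1) a nonzero path has at most one continuation on either side. Hence maximal paths have no
repeated arrow, and every arrow lies on exactly one of them, in one position
(`IsMaximalPath.split_unique`). Adding to the quiver of `A` an arrow `β_m` from the end to the start
of each maximal path `m`, the rotations of the words `m β_m` form a defining pair with `μ = 1`, for
which the `β_m` are an admissible cut.

The relations are handled through a trace form instead of by rewriting. For a defining pair with `μ
= 1` and a cycle at every vertex, the ideal of relations is the radical of the form on `KQ` given by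
the functional that is one on the cycles and zero on all other paths
(`IsDefiningPair.mem_span_iff`). The symmetrizing form `(a, f) ↦ f 1` of `T(A)` pulls back to
exactly this functional (`trace_extHom`). As it is nondegenerate, the kernel of the surjection onto
`T(A)` is the ideal of relations (`ker_extHom`).

In `T(A)` the dual basis element of a path `p` is `w β_m u` when `m = u p w` is maximal. So the
`β_m` generate `D(A)` as an ideal, and dividing them out gives back `A`. Conversely, from a pair
`(Λ, D)` remove the cut arrows and keep as nonzero products those of arrows consecutive in a cycle.
The result is almost gentle, because a walk along a cycle cannot pass the missing arrow. Its maximal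
paths are the cycles without their cut arrow, so its extended quiver is the original quiver with the
original cycles (`IsCutPresentation.exists_hom`), and equality of trace forms identifies its trivial
extension with `Λ` (`exists_algEquiv_extHom`).

For independence of the presentation, an isomorphism of algebras need not send paths to multiples of
paths. Its matrix of arrow coefficients is invertible, however, and a nonzero term of the
determinant yields an isomorphism of quivers with relations (`exists_quiverIso`). The algebra
isomorphism induced by this one permutes paths, hence preserves the new arrows
(`exists_equiv_image_newArrows`). -/

theorem exists_algHom_of_ker_le (π : R →ₐ[K] A) (hπ : Function.Surjective π) (h : R →ₐ[K] B)
    (hk : ∀ x, π x = 0 → h x = 0) : ∃ g : A →ₐ[K] B, ∀ x, g (π x) = h x := by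
  have key : ∀ x y, π x = π y → h x = h y := fun x y e => by
    have := hk (x - y) (by rw [map_sub, e, sub_self])
    rwa [map_sub, sub_eq_zero] at this
  have hs : ∀ a, π (Function.surjInv hπ a) = a := Function.surjInv_eq hπ
  let g : A → B := fun a => h (Function.surjInv hπ a)
  have hg : ∀ x, g (π x) = h x := fun x => key _ _ (hs _)
  refine ⟨{ toFun := g, map_one' := ?_, map_mul' := ?_, map_zero' := ?_, map_add' := ?_,
            commutes' := ?_ }, hg⟩
  · rw [← map_one π, hg, map_one]
  · intro x y
    obtain ⟨x, rfl⟩ := hπ x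
    obtain ⟨y, rfl⟩ := hπ y
    rw [← map_mul, hg, hg, hg, map_mul]
  · have h0 := hg 0
    rwa [map_zero, map_zero] at h0
  · intro x y
    obtain ⟨x, rfl⟩ := hπ x
    obtain ⟨y, rfl⟩ := hπ y
    simp only [← map_add, hg]
  · intro r
    simp only [← AlgHomClass.commutes π, hg, AlgHomClass.commutes h]

theorem exists_algEquiv_of_ker_iff (π : R →ₐ[K] A) (hπ : Function.Surjective π) (π' : R →ₐ[K] B)
    (hπ' : Function.Surjective π') (hk : ∀ x, π x = 0 ↔ π' x = 0) :
    ∃ e : A ≃ₐ[K] B, ∀ x, e (π x) = π' x := by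
  obtain ⟨g, hg⟩ := exists_algHom_of_ker_le π hπ π' fun x => (hk x).1
  obtain ⟨g', hg'⟩ := exists_algHom_of_ker_le π' hπ' π fun x => (hk x).2
  refine ⟨AlgEquiv.ofAlgHom g g' ?_ ?_, hg⟩
  · ext b
    obtain ⟨x, rfl⟩ := hπ' b
    simp [hg, hg']
  · ext a
    obtain ⟨x, rfl⟩ := hπ a
    simp [hg, hg']

theorem exists_linearMap_of_ker_le {M N P : Type*} [AddCommGroup M] [Module K M] [AddCommGroup N]
    [Module K N] [AddCommGroup P] [Module K P] (π : M →ₗ[K] N) (hπ : Function.Surjective π)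
    (h : M →ₗ[K] P) (hk : ∀ x, π x = 0 → h x = 0) : ∃ g : N →ₗ[K] P, ∀ x, g (π x) = h x := by
  obtain ⟨s, hs⟩ := π.exists_rightInverse_of_surjective (LinearMap.range_eq_top.2 hπ)
  refine ⟨h ∘ₗ s, fun x => ?_⟩
  have := hk (s (π x) - x) (by
    rw [map_sub, sub_eq_zero]
    exact LinearMap.congr_fun hs (π x))
  rwa [map_sub, sub_eq_zero] at this

theorem ker_mkₐ (I : TwoSidedIdeal R) (x : R) :
    RingCon.mkₐ (α := K) I.ringCon x = 0 ↔ x ∈ I := by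
  change ((x : I.ringCon.Quotient) = ((0 : R) : I.ringCon.Quotient)) ↔ _
  rw [RingCon.eq, ← TwoSidedIdeal.mem_iff]

theorem isIndecomposable_of_algEquiv {A B : Type u} [Ring A] [Algebra K A] [Ring B] [Algebra K B]
    (e : A ≃ₐ[K] B) (h : IsIndecomposable A) : IsIndecomposable B := by
  obtain ⟨h1, h2⟩ := h
  refine ⟨e.symm.toEquiv.nontrivial, fun x hx hi => ?_⟩
  rw [Subring.mem_center_iff] at hx
  have hc : e.symm x ∈ Subring.center A := by
    rw [Subring.mem_center_iff]
    intro y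
    apply e.injective
    simpa using hx (e y)
  have hid : IsIdempotentElem (e.symm x) := by
    unfold IsIdempotentElem
    rw [← map_mul, hi.eq]
  rcases h2 _ hc hid with h | h
  · left
    simpa using h
  · right
    simpa using congrArg e h

end Quotients

/-! ### Paths -/

namespace FinQuiver

variable {Q : FinQuiver}

namespace QPath

theorem first_eq_src {p : Q.QPath} {a : Q.E} {l : List Q.E} (h : p.arrows = a :: l) :
    p.first = Q.src a := by
  have := p.isWalk
  rw [h] at this
  exact this.1.symm

theorem eq_of_arrows_eq {p q : Q.QPath} (h : p.arrows = q.arrows) (hne : p.arrows ≠ []) :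
    p = q := by
  refine QPath.ext ?_ h
  match hp : p.arrows with
  | [] => exact absurd hp hne
  | a :: l => rw [first_eq_src hp, first_eq_src (h ▸ hp)]

theorem last_eq_tgt {p : Q.QPath} {a : Q.E} {l : List Q.E} (h : p.arrows = l ++ [a]) :
    p.last = Q.tgt a := by
  rw [last, h, walkEnd_append]
  rfl

theorem last_of_nil {p : Q.QPath} (h : p.arrows = []) : p.last = p.first := by
  rw [last, h]
  rfl

theorem eq_triv {p : Q.QPath} (h : p.arrows = []) : p = triv p.first := QPath.ext rfl h

theorem eq_single {p : Q.QPath} {a : Q.E} (h : p.arrows = [a]) : p = single a :=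
  eq_of_arrows_eq h (by simp [h])

/-- A path can be cut in two wherever its list of arrows is. -/
theorem exists_comp_of_arrows_eq (p : Q.QPath) {l l' : List Q.E} (h : p.arrows = l ++ l') :
    ∃ (q r : Q.QPath) (hqr : q.last = r.first), q.arrows = l ∧ r.arrows = l' ∧
      p = q.comp r hqr := by
  have hw := p.isWalk
  rw [h, isWalk_append] at hw
  exact ⟨⟨p.first, l, hw.1⟩, ⟨Q.walkEnd p.first l, l', hw.2⟩, rfl, rfl, rfl, QPath.ext rfl h⟩

theorem arrows_comp (p q : Q.QPath) (h : p.last = q.first) :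
    (p.comp q h).arrows = p.arrows ++ q.arrows := rfl

theorem comp_triv (p : Q.QPath) (h : p.last = (triv p.last).first) : p.comp (triv p.last) h = p :=
  QPath.ext rfl (by simp [comp, triv])

theorem exists_cons {p : Q.QPath} {a : Q.E} {l : List Q.E} (h : p.arrows = a :: l) :
    ∃ (q : Q.QPath) (hq : (single a).last = q.first), q.arrows = l ∧ p = (single a).comp q hq := by
  obtain ⟨s, q, hs, h1, h2, h3⟩ := exists_comp_of_arrows_eq p (l := [a]) (l' := l) h
  obtain rfl := eq_single h1
  exact ⟨q, hs, h2, h3⟩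

theorem exists_concat {p : Q.QPath} {a : Q.E} {l : List Q.E} (h : p.arrows = l ++ [a]) :
    ∃ (q : Q.QPath) (hq : q.last = (single a).first), q.arrows = l ∧ p = q.comp (single a) hq := by
  obtain ⟨q, s, hs, h1, h2, h3⟩ := exists_comp_of_arrows_eq p h
  obtain rfl := eq_single h2
  exact ⟨q, hs, h1, h3⟩

end QPath

theorem finite_paths_of_length_lt (N : ℕ) : {p : Q.QPath | p.length < N}.Finite := by
  have h : (Set.univ ×ˢ {l : List Q.E | l.length < N} : Set (Q.V × List Q.E)).Finite :=
    Set.finite_univ.prod (List.finite_length_lt Q.E N)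
  refine Set.Finite.of_finite_image (f := fun p : Q.QPath => (p.first, p.arrows))
    (h.subset ?_) ?_
  · rintro _ ⟨p, hp, rfl⟩
    exact ⟨trivial, hp⟩
  · intro p _ q _ hpq
    exact QPath.ext (congrArg Prod.fst hpq) (congrArg Prod.snd hpq)

/-- Morphisms of quivers. -/
structure Hom (Q Q' : FinQuiver) where
  onV : Q.V → Q'.V
  onE : Q.E → Q'.E
  src_onE : ∀ a, Q'.src (onE a) = onV (Q.src a)
  tgt_onE : ∀ a, Q'.tgt (onE a) = onV (Q.tgt a)

namespace Hom

variable {Q' : FinQuiver} (f : Hom Q Q')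

theorem isWalk_map (v : Q.V) (l : List Q.E) (h : Q.IsWalk v l) :
    Q'.IsWalk (f.onV v) (l.map f.onE) := by
  induction l generalizing v with
  | nil => trivial
  | cons a l ih => exact ⟨by rw [f.src_onE, h.1], by rw [f.tgt_onE]; exact ih _ h.2⟩

theorem walkEnd_map (v : Q.V) (l : List Q.E) :
    Q'.walkEnd (f.onV v) (l.map f.onE) = f.onV (Q.walkEnd v l) := by
  induction l generalizing v with
  | nil => rfl
  | cons a l ih =>
    rw [List.map_cons, walkEnd, walkEnd, f.tgt_onE]
    exact ih _

/-- The image of a path. -/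
def mapPath (p : Q.QPath) : Q'.QPath :=
  ⟨f.onV p.first, p.arrows.map f.onE, f.isWalk_map _ _ p.isWalk⟩

theorem last_mapPath (p : Q.QPath) : (f.mapPath p).last = f.onV p.last := f.walkEnd_map _ _

theorem mapPath_injective (hV : Function.Injective f.onV) (hE : Function.Injective f.onE) :
    Function.Injective f.mapPath := by
  intro p q h
  have h1 : f.onV p.first = f.onV q.first := congrArg QPath.first h
  have h2 : p.arrows.map f.onE = q.arrows.map f.onE := congrArg QPath.arrows h
  exact QPath.ext (hV h1) (List.map_injective_iff.2 hE h2)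

/-- Injectivity on vertices turns equal images of endpoints into equal endpoints, so composability
can be lifted. -/
theorem exists_mapPath_eq (hV : Function.Bijective f.onV) (p : Q'.QPath) (l : List Q.E)
    (h : p.arrows = l.map f.onE) : ∃ q : Q.QPath, q.arrows = l ∧ f.mapPath q = p := by
  have key : ∀ (l : List Q.E) (v : Q.V), Q'.IsWalk (f.onV v) (l.map f.onE) → Q.IsWalk v l := by
    intro l
    induction l with
    | nil => intros; trivial
    | cons a l ih =>
      intro v hv
      refine ⟨hV.1 (by rw [← f.src_onE]; exact hv.1), ih _ ?_⟩
      rw [← f.tgt_onE]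
      exact hv.2
  obtain ⟨v, hv⟩ := hV.2 p.first
  exact ⟨⟨v, l, key l v (by rw [hv, ← h]; exact p.isWalk)⟩, rfl, QPath.ext hv h.symm⟩

theorem mapPath_surjective (hV : Function.Bijective f.onV) (hE : Function.Surjective f.onE) :
    Function.Surjective f.mapPath := by
  intro p
  obtain ⟨l, hl⟩ := List.map_surjective_iff.2 hE p.arrows
  obtain ⟨q, -, hq⟩ := f.exists_mapPath_eq hV p l hl.symm
  exact ⟨q, hq⟩

end Hom

end FinQuiver

open FinQuiver

/-! ### Path algebras -/

namespace PathAlgebra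

variable {K : Type u} [Field K] {Q : FinQuiver}

theorem ofPath_comp (p q : Q.QPath) (h : p.last = q.first) :
    ofPath K (p.comp q h) = ofPath K p * ofPath K q := by
  rw [ofPath_mul_ofPath, pathMul_of_eq]

theorem ofPath_mul_ofPath_of_ne (p q : Q.QPath) (h : p.last ≠ q.first) :
    ofPath K p * ofPath K q = 0 := by
  rw [ofPath_mul_ofPath, pathMul_of_ne _ _ h]

theorem linearMap_ext {M : Type*} [AddCommGroup M] [Module K M] {f g : PathAlgebra K Q →ₗ[K] M}
    (h : ∀ p, f (ofPath K p) = g (ofPath K p)) : f = g := by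
  ext x
  induction x using PathAlgebra.induction with
  | zero => simp
  | add x y hx hy => simp [hx, hy]
  | path c p => simp [h]

theorem algHom_ext {B : Type*} [Ring B] [Algebra K B] {f g : PathAlgebra K Q →ₐ[K] B}
    (h : ∀ p, f (ofPath K p) = g (ofPath K p)) : f = g := by
  have := linearMap_ext (f := f.toLinearMap) (g := g.toLinearMap) h
  ext x
  exact LinearMap.congr_fun this x

open Classical in
/-- The coefficient of a path. -/
def coeff (p : Q.QPath) : PathAlgebra K Q →ₗ[K] K := lift fun q => if q = p then 1 else 0

open Classical in
theorem coeff_ofPath (p q : Q.QPath) : coeff p (ofPath K q) = if q = p then 1 else 0 :=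
  lift_ofPath _ _

theorem coeff_ofPath_self (p : Q.QPath) : coeff p (ofPath K p) = 1 := by simp [coeff_ofPath]

theorem coeff_eq_apply (p : Q.QPath) (x : PathAlgebra K Q) :
    coeff p x = (show Q.QPath →₀ K from x) p := by
  classical
  have : coeff p = (show PathAlgebra K Q →ₗ[K] K from Finsupp.lapply p) := by
    apply linearMap_ext
    intro q
    rw [coeff_ofPath]
    exact (Finsupp.single_apply (M := K)).symm
  rw [this]
  rfl

theorem mem_support_iff (p : Q.QPath) (x : PathAlgebra K Q) : p ∈ support x ↔ coeff p x ≠ 0 := by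
  rw [coeff_eq_apply]
  exact Finsupp.mem_support_iff

theorem eq_sum_support (x : PathAlgebra K Q) :
    x = ∑ p ∈ support x, coeff p x • ofPath K p := by
  have h : (show Q.QPath →₀ K from x).sum Finsupp.single = x := Finsupp.sum_single _
  rw [Finsupp.sum] at h
  conv_lhs => rw [← h]
  refine Finset.sum_congr rfl fun p _ => ?_
  rw [coeff_eq_apply]
  have h : ∀ c : K, c • ofPath K p = Finsupp.single p c := fun c =>
    (Finsupp.smul_single c p (1 : K)).trans (by simp)
  exact (h _).symm

theorem map_eq_sum {M : Type*} [AddCommGroup M] [Module K M] (f : PathAlgebra K Q →ₗ[K] M)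
    (x : PathAlgebra K Q) : f x = ∑ p ∈ support x, coeff p x • f (ofPath K p) := by
  conv_lhs => rw [eq_sum_support x]
  simp

theorem ofPath_single (a : Q.E) : ofPath K (QPath.single a) = ofArrow K a := rfl

section Universal

variable {B : Type*} [Ring B] [Algebra K B]

/-- The product of idempotents and arrow elements along a walk. -/
def evalWalk (ε : Q.V → B) (x : Q.E → B) : Q.V → List Q.E → B
  | v, [] => ε v
  | _, a :: l => x a * evalWalk ε x (Q.tgt a) l

/-- The universal property of the path algebra. -/
theorem exists_algHom (ε : Q.V → B) (x : Q.E → B) (hid : ∀ v, ε v * ε v = ε v)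
    (horth : ∀ v w, v ≠ w → ε v * ε w = 0) (hone : ∑ v, ε v = 1)
    (hsrc : ∀ a, ε (Q.src a) * x a = x a) (htgt : ∀ a, x a * ε (Q.tgt a) = x a) :
    ∃ F : PathAlgebra K Q →ₐ[K] B, (∀ v, F (ofPath K (QPath.triv v)) = ε v) ∧
      ∀ a, F (ofArrow K a) = x a := by
  -- By `h1` and `h3` the value of a walk absorbs the idempotents at its two ends. Orthogonality
  -- then kills the product of the values of paths that do not compose.
  have h1 : ∀ (l : List Q.E) (v : Q.V), Q.IsWalk v l → ε v * evalWalk ε x v l = evalWalk ε x v l := by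
    intro l v h
    cases l with
    | nil => exact hid v
    | cons a l =>
      rw [evalWalk, ← mul_assoc]
      congr 1
      rw [← h.1, hsrc]
  have h2 : ∀ (l l' : List Q.E) (v : Q.V), Q.IsWalk v l → Q.IsWalk (Q.walkEnd v l) l' →
      evalWalk ε x v (l ++ l') = evalWalk ε x v l * evalWalk ε x (Q.walkEnd v l) l' := by
    intro l
    induction l with
    | nil => exact fun l' v _ h => (h1 l' v h).symm
    | cons a l ih =>
      intro l' v h h'
      rw [List.cons_append, evalWalk, evalWalk, mul_assoc, ih _ _ h.2 h']
      rfl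
  have h3 : ∀ (l : List Q.E) (v : Q.V), evalWalk ε x v l * ε (Q.walkEnd v l) = evalWalk ε x v l := by
    intro l
    induction l with
    | nil => exact fun v => hid v
    | cons a l ih =>
      intro v
      rw [evalWalk, mul_assoc]
      congr 1
      exact ih _
  let F : PathAlgebra K Q →ₗ[K] B := lift fun p => evalWalk ε x p.first p.arrows
  have hF : ∀ p, F (ofPath K p) = evalWalk ε x p.first p.arrows := fun p => lift_ofPath _ _
  have hmul : ∀ x y, F (x * y) = F x * F y := by
    intro y z
    induction y using PathAlgebra.induction with
    | zero => simp
    | add y y' hy hy' => simp only [add_mul, map_add, hy, hy']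
    | path c p =>
      induction z using PathAlgebra.induction with
      | zero => simp
      | add z z' hz hz' => simp only [mul_add, map_add, hz, hz']
      | path d q =>
        simp only [smul_mul_assoc, mul_smul_comm, map_smul]
        congr 2
        by_cases h : p.last = q.first
        · rw [← ofPath_comp p q h, hF, hF, hF]
          have := q.isWalk
          rw [← h] at this
          rw [← h]
          exact h2 _ _ _ p.isWalk this
        · rw [ofPath_mul_ofPath_of_ne p q h, map_zero, hF, hF, ← h3, ← h1 _ _ q.isWalk,
            mul_assoc, ← mul_assoc (ε _) (ε _), horth (Q.walkEnd p.first p.arrows) _ h, zero_mul,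
            mul_zero]
  refine ⟨AlgHom.ofLinearMap F ?_ hmul, fun v => hF _, fun a => (hF _).trans (htgt a)⟩
  rw [one_def, map_sum, ← hone]
  exact Finset.sum_congr rfl fun v _ => hF _

end Universal

theorem triv_mul_triv (v : Q.V) :
    ofPath K (QPath.triv v : Q.QPath) * ofPath K (QPath.triv v) = ofPath K (QPath.triv v) := by
  rw [← ofPath_comp _ _ rfl]
  rfl

theorem triv_mul_triv_of_ne {v w : Q.V} (h : v ≠ w) :
    ofPath K (QPath.triv v : Q.QPath) * ofPath K (QPath.triv w) = 0 :=
  ofPath_mul_ofPath_of_ne _ _ h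

theorem triv_mul_ofPath (p : Q.QPath) :
    ofPath K (QPath.triv p.first) * ofPath K p = ofPath K p := by
  rw [← ofPath_comp _ _ rfl]
  rfl

theorem ofPath_mul_triv (p : Q.QPath) :
    ofPath K p * ofPath K (QPath.triv p.last) = ofPath K p := by
  have h : p.last = (QPath.triv p.last).first := rfl
  rw [← ofPath_comp _ _ h, QPath.comp_triv]

/-- The homomorphism of path algebras induced by a morphism of quivers. -/
theorem exists_map {Q' : FinQuiver} (f : Hom Q Q') (hf : Function.Bijective f.onV) :
    ∃ F : PathAlgebra K Q →ₐ[K] PathAlgebra K Q', ∀ p, F (ofPath K p) = ofPath K (f.mapPath p) := by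
  obtain ⟨F, h1, h2⟩ := exists_algHom (K := K) (Q := Q) (fun v => ofPath K (QPath.triv (f.onV v)))
    (fun a => ofArrow K (f.onE a)) (fun v => triv_mul_triv _)
    (fun v w h => triv_mul_triv_of_ne (hf.1.ne h))
    (by
      rw [one_def]
      exact Function.Bijective.sum_comp hf (fun v => ofPath K (QPath.triv v : Q'.QPath)))
    (fun a => by
      rw [← f.src_onE]
      exact triv_mul_ofPath (QPath.single (f.onE a)))
    (fun a => by
      rw [← f.tgt_onE]
      exact ofPath_mul_triv (QPath.single (f.onE a)))
  refine ⟨F, fun p => ?_⟩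
  obtain ⟨v, l, hl⟩ := p
  induction l generalizing v with
  | nil => exact h1 v
  | cons a l ih =>
    obtain ⟨q, hq, rfl, h⟩ := QPath.exists_cons (p := ⟨v, a :: l, hl⟩) rfl
    rw [h, ofPath_comp, map_mul, ih _ q.isWalk, ofPath_single, h2, ← ofPath_single, ← ofPath_comp]
    · congr 1
      exact QPath.ext (f.src_onE a) rfl
    · exact (f.tgt_onE a).trans (congrArg f.onV hq)

end PathAlgebra

end AlmostGentle

namespace AlmostGentle

open FinQuiver

/-! ### Lists that follow a deterministic relation -/

section Lists

variable {α : Type*} {r : α → α → Prop}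

/-- Determinism makes the chains agree as long as both continue, and neither can stop first because
the other one would prolong it. -/
theorem eq_of_isChain_of_forall_not_isChain_concat (hr : ∀ a b c, r a b → r a c → b = c) {a : α}
    {l l' : List α} (h : (a :: l).IsChain r) (h' : (a :: l').IsChain r)
    (hl : ∀ b, ¬ (a :: l ++ [b]).IsChain r) (hl' : ∀ b, ¬ (a :: l' ++ [b]).IsChain r) :
    l = l' := by
  induction l generalizing a l' with
  | nil =>
    cases l' with
    | nil => rfl
    | cons b l' =>
      rw [List.isChain_cons_cons] at h'
      exact absurd (by simpa using h'.1) (hl b)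
  | cons c l ih =>
    cases l' with
    | nil =>
      rw [List.isChain_cons_cons] at h
      exact absurd (by simpa using h.1) (hl' c)
    | cons c' l' =>
      rw [List.isChain_cons_cons] at h h'
      obtain rfl := hr _ _ _ h.1 h'.1
      congr 1
      refine ih h.2 h'.2 (fun b hb => hl b ?_) fun b hb => hl' b ?_
      · exact List.isChain_cons_cons.2 ⟨h.1, hb⟩
      · exact List.isChain_cons_cons.2 ⟨h'.1, hb⟩

theorem nodup_of_forall_eq_append {l : List α} (h : ∀ u a w, l = u ++ a :: w → a ∉ w) :
    l.Nodup := by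
  induction l with
  | nil => exact List.nodup_nil
  | cons b l ih =>
    exact List.nodup_cons.2 ⟨h [] b l rfl, ih fun u a w e => h (b :: u) a w (by rw [e]; rfl)⟩

theorem isChain_left_of_append {l l' : List α} (h : (l ++ l').IsChain r) : l.IsChain r :=
  (List.isChain_append.1 h).1

/-- Maximal chains for a relation that is deterministic in both directions are determined by any
of their members, and its position in the chain is unique. -/
theorem maximal_isChain_unique (hr : ∀ a b c, r a b → r a c → b = c)
    (hr' : ∀ a b c, r b a → r c a → b = c) {u w u' w' : List α} {a : α}
    (h : (u ++ a :: w).IsChain r) (h' : (u' ++ a :: w').IsChain r)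
    (hR : ∀ b, ¬ (u ++ a :: w ++ [b]).IsChain r) (hR' : ∀ b, ¬ (u' ++ a :: w' ++ [b]).IsChain r)
    (hL : ∀ b, ¬ (b :: (u ++ a :: w)).IsChain r) (hL' : ∀ b, ¬ (b :: (u' ++ a :: w')).IsChain r) :
    u = u' ∧ w = w' := by
  have hs := List.isChain_split.1 h
  have hs' := List.isChain_split.1 h'
  constructor
  -- The entries before `a` are compared by reading the chains backwards, where determinism on the
  -- left plays the role of determinism on the right.
  · apply List.reverse_injective
    refine eq_of_isChain_of_forall_not_isChain_concat (r := fun x y => r y x) (a := a)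
      (fun a b c => hr' a b c) ?_ ?_ (fun b hb => hL b ?_) (fun b hb => hL' b ?_)
    · rw [← List.isChain_reverse]
      simpa using hs.1
    · rw [← List.isChain_reverse]
      simpa using hs'.1
    · rw [← List.isChain_reverse] at hb
      have hb' : ((b :: u) ++ [a]).IsChain r := by simpa using hb
      exact List.isChain_split.2 ⟨hb', hs.2⟩
    · rw [← List.isChain_reverse] at hb
      have hb' : ((b :: u') ++ [a]).IsChain r := by simpa using hb
      exact List.isChain_split.2 ⟨hb', hs'.2⟩
  · refine eq_of_isChain_of_forall_not_isChain_concat hr hs.2 hs'.2 (fun b hb => hR b ?_)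
      (fun b hb => hR' b ?_)
    · rw [List.append_assoc]
      exact List.isChain_split.2 ⟨hs.1, hb⟩
    · rw [List.append_assoc]
      exact List.isChain_split.2 ⟨hs'.1, hb⟩

end Lists

variable {K : Type u} [Field K]

/-! ### Ideals generated by paths of length two -/

namespace PathAlgebra

variable {Q : FinQuiver}

theorem coeff_mul_ofPath_mul_eq_zero {r p : Q.QPath} (h : ¬ r.arrows <:+: p.arrows)
    (x y : PathAlgebra K Q) : coeff p (x * ofPath K r * y) = 0 := by
  classical
  induction x using PathAlgebra.induction with
  | zero => simp
  | add x x' hx hx' => rw [add_mul, add_mul, map_add, hx, hx', add_zero]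
  | path c q =>
    induction y using PathAlgebra.induction with
    | zero => simp
    | add y y' hy hy' => rw [mul_add, map_add, hy, hy', add_zero]
    | path d s =>
      rw [smul_mul_assoc, smul_mul_assoc, mul_smul_comm, map_smul, map_smul]
      by_cases h1 : q.last = r.first
      · rw [← ofPath_comp q r h1]
        by_cases h2 : (q.comp r h1).last = s.first
        · rw [← ofPath_comp _ s h2, coeff_ofPath, if_neg, smul_zero, smul_zero]
          rintro rfl
          exact h ⟨q.arrows, s.arrows, rfl⟩
        · rw [ofPath_mul_ofPath_of_ne _ _ h2, map_zero, smul_zero, smul_zero]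
      · rw [ofPath_mul_ofPath_of_ne _ _ h1, zero_mul, map_zero, smul_zero, smul_zero]

/-- An ideal generated by paths is monomial: a product `x r y` only involves paths that contain `r`.
-/
theorem exists_infix_of_mem_span {R : Set Q.QPath} {x : PathAlgebra K Q}
    (hx : x ∈ TwoSidedIdeal.span (ofPath K '' R)) {p : Q.QPath} (hp : coeff p x ≠ 0) :
    ∃ r ∈ R, r.arrows <:+: p.arrows := by
  by_contra! hcon
  apply hp
  rw [TwoSidedIdeal.mem_span_iff_mem_addSubgroup_closure] at hx
  induction hx using AddSubgroup.closure_induction with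
  | mem z hz =>
    obtain ⟨_, ⟨y, -, _, ⟨r, hr, rfl⟩, rfl⟩, y', -, rfl⟩ := hz
    exact coeff_mul_ofPath_mul_eq_zero (hcon r hr) y y'
  | zero => exact map_zero _
  | add y z _ _ hy hz => by_contra h; exact h (by simp_all)
  | neg y _ hy => by_contra h; exact h (by simp_all)

theorem exists_mul_mul_of_infix {r p : Q.QPath} (h : r.arrows <:+: p.arrows)
    (hne : r.arrows ≠ []) : ∃ x y, ofPath K p = x * ofPath K r * y := by
  obtain ⟨l, l', h⟩ := h
  obtain ⟨p1, p2, h1, h2, h3, rfl⟩ := QPath.exists_comp_of_arrows_eq p h.symm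
  obtain ⟨p3, p4, h4, h5, h6, rfl⟩ := QPath.exists_comp_of_arrows_eq p1 h2
  obtain rfl := QPath.eq_of_arrows_eq h6 (by rwa [h6])
  exact ⟨_, _, by rw [ofPath_comp, ofPath_comp]⟩

theorem ofArrow_mul_ofArrow {a b : Q.E} (h : Q.tgt a = Q.src b) :
    ofArrow K a * ofArrow K b = ofPath K ((QPath.single a).comp (QPath.single b) h) :=
  (ofPath_comp _ _ _).symm

theorem ofArrow_mul_ofArrow_of_ne {a b : Q.E} (h : Q.tgt a ≠ Q.src b) :
    ofArrow K a * ofArrow K b = 0 := ofPath_mul_ofPath_of_ne _ _ h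

theorem ofPath_eq_of_arrows_pair {p : Q.QPath} {a b : Q.E} (h : p.arrows = [a, b]) :
    ofPath K p = ofArrow K a * ofArrow K b := by
  obtain ⟨q, hq, h1, rfl⟩ := QPath.exists_cons h
  obtain rfl := QPath.eq_single h1
  exact ofPath_comp _ _ _

end PathAlgebra

open PathAlgebra

/-! ### Nonzero paths of an almost gentle presentation and their coefficients -/

namespace AlmostGentlePresentation

variable {A : Type u} [Ring A] [Algebra K A] (P : AlmostGentlePresentation K A)

/-- The arrows `a`, `b` have a nonzero product. -/
def Next (a b : P.quiver.E) : Prop := P.arrow a * P.arrow b ≠ 0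

theorem path_comp (p q : P.quiver.QPath) (h : p.last = q.first) :
    P.path (p.comp q h) = P.path p * P.path q := by
  rw [path, ofPath_comp, map_mul]
  rfl

theorem path_mul_path_of_ne {p q : P.quiver.QPath} (h : p.last ≠ q.first) :
    P.path p * P.path q = 0 := by
  rw [path, path, ← map_mul, ofPath_mul_ofPath_of_ne _ _ h, map_zero]

theorem path_single (a : P.quiver.E) : P.path (QPath.single a) = P.arrow a := rfl

theorem next_iff (a b : P.quiver.E) :
    P.Next a b ↔ ofArrow K a * ofArrow K b ∉ TwoSidedIdeal.ker P.π := by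
  rw [TwoSidedIdeal.mem_ker, map_mul]
  rfl

theorem next_right_unique (a b c : P.quiver.E) (h : P.Next a b) (h' : P.Next a c) : b = c :=
  P.multiserial.1 a b c ((P.next_iff _ _).1 h) ((P.next_iff _ _).1 h')

theorem next_left_unique (a b c : P.quiver.E) (h : P.Next b a) (h' : P.Next c a) : b = c :=
  P.multiserial.2 a b c ((P.next_iff _ _).1 h) ((P.next_iff _ _).1 h')

theorem tgt_eq_src_of_next {a b : P.quiver.E} (h : P.Next a b) :
    P.quiver.tgt a = P.quiver.src b := by
  by_contra hne
  exact h (P.path_mul_path_of_ne (p := QPath.single a) (q := QPath.single b) hne)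

theorem path_eq_zero_of_coeff_ne_zero {x : PathAlgebra K P.quiver} (hx : P.π x = 0)
    {p : P.quiver.QPath} (hp : coeff p x ≠ 0) :
    ∃ a b, P.arrow a * P.arrow b = 0 ∧ [a, b] <:+: p.arrows := by
  obtain ⟨R, hR, hI⟩ := P.quadratic
  have hx' : x ∈ TwoSidedIdeal.ker P.π := (TwoSidedIdeal.mem_ker _).2 hx
  rw [hI] at hx'
  obtain ⟨r, hr, hrp⟩ := exists_infix_of_mem_span hx' hp
  obtain ⟨a, b, hab⟩ := List.length_eq_two.1 (hR r hr)
  have : ofPath K r ∈ TwoSidedIdeal.ker P.π := by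
    rw [hI]
    exact TwoSidedIdeal.subset_span ⟨r, hr, rfl⟩
  rw [TwoSidedIdeal.mem_ker, ofPath_eq_of_arrows_pair hab, map_mul] at this
  exact ⟨a, b, this, hab ▸ hrp⟩

theorem path_eq_zero_of_infix {p : P.quiver.QPath} {a b : P.quiver.E}
    (h : P.arrow a * P.arrow b = 0) (hp : [a, b] <:+: p.arrows) : P.path p = 0 := by
  obtain ⟨l, l', e⟩ := hp
  obtain ⟨p1, p2, h1, h2, h3, rfl⟩ := QPath.exists_comp_of_arrows_eq p e.symm
  obtain ⟨p3, p4, h4, h5, h6, rfl⟩ := QPath.exists_comp_of_arrows_eq p1 h2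
  have : P.path p4 = 0 := by
    rw [path, ofPath_eq_of_arrows_pair h6, map_mul]
    exact h
  rw [path_comp, path_comp, this, mul_zero, zero_mul]

/-- The relations are paths of length two, so vanishing is a local condition on neighbouring arrows.
This turns questions about paths into questions about chains of a relation that is deterministic in
both directions. -/
theorem path_ne_zero_iff (p : P.quiver.QPath) : P.path p ≠ 0 ↔ p.arrows.IsChain P.Next := by
  constructor
  · intro h
    rw [List.isChain_iff_forall_rel_of_append_cons_cons]
    intro a b l l' e h0
    exact h (P.path_eq_zero_of_infix h0 ⟨l, l', by simp [e]⟩)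
  · intro h h0
    obtain ⟨a, b, hab, l, l', e⟩ := P.path_eq_zero_of_coeff_ne_zero (p := p) h0
      (by rw [coeff_ofPath_self]; exact one_ne_zero)
    rw [List.isChain_iff_forall_rel_of_append_cons_cons] at h
    exact h (l₁ := l) (l₂ := l') (by simpa using e.symm) hab

/-- The kernel is spanned by the paths in it; this is why the nonzero paths are a basis and why
coefficients make sense on `A`. -/
theorem path_eq_zero_of_coeff {x : PathAlgebra K P.quiver} (hx : P.π x = 0)
    {p : P.quiver.QPath} (hp : coeff p x ≠ 0) : P.path p = 0 := by
  obtain ⟨a, b, h, h'⟩ := P.path_eq_zero_of_coeff_ne_zero hx hp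
  exact P.path_eq_zero_of_infix h h'

open Classical in
theorem exists_coef {p : P.quiver.QPath} (hp : P.path p ≠ 0) :
    ∃ f : A →ₗ[K] K, ∀ q, f (P.path q) = if q = p then 1 else 0 := by
  obtain ⟨g, hg⟩ := exists_linearMap_of_ker_le P.π.toLinearMap P.surjective (coeff p)
    fun x hx => by
      by_contra h
      exact hp (P.path_eq_zero_of_coeff hx h)
  exact ⟨g, fun q => (hg (ofPath K q)).trans (coeff_ofPath p q)⟩

open Classical in
/-- The coefficient of a nonzero path, as a linear form on the algebra. -/
def coef (p : P.quiver.QPath) : A →ₗ[K] K :=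
  if hp : P.path p ≠ 0 then (P.exists_coef hp).choose else 0

open Classical in
theorem coef_path {p : P.quiver.QPath} (hp : P.path p ≠ 0) (q : P.quiver.QPath) :
    P.coef p (P.path q) = if q = p then 1 else 0 := by
  rw [coef, dif_pos hp]
  exact (P.exists_coef hp).choose_spec q

theorem linearMap_ext {M : Type*} [AddCommGroup M] [Module K M] {f g : A →ₗ[K] M}
    (h : ∀ p, P.path p ≠ 0 → f (P.path p) = g (P.path p)) : f = g := by
  have : f ∘ₗ P.π.toLinearMap = g ∘ₗ P.π.toLinearMap := by
    apply PathAlgebra.linearMap_ext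
    intro p
    change f (P.path p) = g (P.path p)
    by_cases hp : P.path p = 0
    · rw [hp, map_zero, map_zero]
    · exact h p hp
  ext x
  obtain ⟨x, rfl⟩ := P.surjective x
  exact LinearMap.congr_fun this x

theorem isDualOfPath_coef {p : P.quiver.QPath} (hp : P.path p ≠ 0) :
    P.IsDualOfPath p (P.coef p) := fun q _ => P.coef_path hp q

theorem eq_coef {p : P.quiver.QPath} (hp : P.path p ≠ 0) {f : A →ₗ[K] K}
    (hf : P.IsDualOfPath p f) : f = P.coef p :=
  P.linearMap_ext fun q hq => (hf q hq).trans (P.coef_path hp q).symm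

theorem mem_newArrows_iff (x : TrivialExtension K A) :
    x ∈ P.newArrows ↔
      ∃ m, P.IsMaximalPath m ∧ x = TrivSqZeroExt.inr (DualBimodule.of K (P.coef m)) := by
  constructor
  · rintro ⟨m, f, hm, hf, rfl⟩
    exact ⟨m, hm, by rw [P.eq_coef hm.1 hf]⟩
  · rintro ⟨m, hm, rfl⟩
    exact ⟨m, _, hm, P.isDualOfPath_coef hm.1, rfl⟩

theorem exists_length_lt : ∃ N, ∀ p, P.path p ≠ 0 → p.length < N := by
  obtain ⟨N, hN⟩ := P.admissible.2
  refine ⟨N, fun p hp => ?_⟩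
  by_contra! h
  exact hp ((TwoSidedIdeal.mem_ker _).1 (hN p h))

theorem finite_nonzero_paths : {p | P.path p ≠ 0}.Finite := by
  obtain ⟨N, hN⟩ := P.exists_length_lt
  exact (finite_paths_of_length_lt N).subset hN

theorem path_triv_ne_zero (v : P.quiver.V) : P.path (QPath.triv v) ≠ 0 :=
  (P.path_ne_zero_iff _).2 List.isChain_nil

theorem arrow_ne_zero (a : P.quiver.E) : P.arrow a ≠ 0 :=
  (P.path_ne_zero_iff (QPath.single a)).2 (List.isChain_singleton a)

/-! ### Maximal paths -/

theorem isMaximalPath_iff (p : P.quiver.QPath) :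
    P.IsMaximalPath p ↔ p.arrows.IsChain P.Next ∧
      (∀ a, P.quiver.tgt a = p.first → ¬ (a :: p.arrows).IsChain P.Next) ∧
      ∀ a, p.last = P.quiver.src a → ¬ (p.arrows ++ [a]).IsChain P.Next := by
  have hl : ∀ a, P.arrow a * P.path p = 0 ↔
      (P.quiver.tgt a = p.first → ¬ (a :: p.arrows).IsChain P.Next) := by
    intro a
    by_cases h : P.quiver.tgt a = p.first
    · have := P.path_comp (QPath.single a) p h
      rw [← path_single, ← this, ← not_iff_not]
      exact (P.path_ne_zero_iff _).trans ⟨fun h1 h2 => h2 h h1, fun h1 => by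
        by_contra h2
        exact h1 fun _ => h2⟩
    · exact ⟨fun _ h' => absurd h' h, fun _ =>
        P.path_mul_path_of_ne (p := QPath.single a) (q := p) h⟩
  have hr : ∀ a, P.path p * P.arrow a = 0 ↔
      (p.last = P.quiver.src a → ¬ (p.arrows ++ [a]).IsChain P.Next) := by
    intro a
    by_cases h : p.last = P.quiver.src a
    · have := P.path_comp p (QPath.single a) h
      rw [← path_single, ← this, ← not_iff_not]
      exact (P.path_ne_zero_iff _).trans ⟨fun h1 h2 => h2 h h1, fun h1 => by
        by_contra h2
        exact h1 fun _ => h2⟩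
    · exact ⟨fun _ h' => absurd h' h, fun _ =>
        P.path_mul_path_of_ne (p := p) (q := QPath.single a) h⟩
  rw [IsMaximalPath, path_ne_zero_iff, forall_and]
  simp only [hl, hr]

theorem tgt_eq_first_of_isChain {p : P.quiver.QPath} {a : P.quiver.E} (hp : p.arrows ≠ [])
    (h : (a :: p.arrows).IsChain P.Next) : P.quiver.tgt a = p.first := by
  match e : p.arrows with
  | [] => exact absurd e hp
  | b :: l =>
    rw [e, List.isChain_cons_cons] at h
    rw [QPath.first_eq_src e]
    exact P.tgt_eq_src_of_next h.1

theorem last_eq_src_of_isChain {p : P.quiver.QPath} {a : P.quiver.E} (hp : p.arrows ≠ [])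
    (h : (p.arrows ++ [a]).IsChain P.Next) : p.last = P.quiver.src a := by
  obtain ⟨l, b, e⟩ := List.eq_nil_or_concat' p.arrows |>.resolve_left hp
  rw [e, List.append_assoc, List.singleton_append, List.isChain_append_cons_cons] at h
  rw [QPath.last_eq_tgt e]
  exact P.tgt_eq_src_of_next h.2.1

variable {P}

theorem IsMaximalPath.isChain {m : P.quiver.QPath} (h : P.IsMaximalPath m) :
    m.arrows.IsChain P.Next := (P.path_ne_zero_iff m).1 h.1

theorem IsMaximalPath.not_isChain_cons {m : P.quiver.QPath} (h : P.IsMaximalPath m)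
    (hm : m.arrows ≠ []) (a : P.quiver.E) : ¬ (a :: m.arrows).IsChain P.Next := fun hc =>
  ((P.isMaximalPath_iff m).1 h).2.1 a (P.tgt_eq_first_of_isChain hm hc) hc

theorem IsMaximalPath.not_isChain_concat {m : P.quiver.QPath} (h : P.IsMaximalPath m)
    (hm : m.arrows ≠ []) (a : P.quiver.E) : ¬ (m.arrows ++ [a]).IsChain P.Next := fun hc =>
  ((P.isMaximalPath_iff m).1 h).2.2 a (P.last_eq_src_of_isChain hm hc) hc

/-- This is where (S1) enters the combinatorics: a maximal path is recovered from any of its arrows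
by following the unique continuations in both directions. -/
theorem IsMaximalPath.split_unique {m m' : P.quiver.QPath} (h : P.IsMaximalPath m)
    (h' : P.IsMaximalPath m') {u w u' w' : List P.quiver.E} {a : P.quiver.E}
    (e : m.arrows = u ++ a :: w) (e' : m'.arrows = u' ++ a :: w') : u = u' ∧ w = w' := by
  have hm : m.arrows ≠ [] := by simp [e]
  have hm' : m'.arrows ≠ [] := by simp [e']
  have h1 := h.not_isChain_cons hm
  have h2 := h.not_isChain_concat hm
  have h3 := h'.not_isChain_cons hm'
  have h4 := h'.not_isChain_concat hm'
  have h5 := h.isChain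
  have h6 := h'.isChain
  rw [e] at h1 h2 h5
  rw [e'] at h3 h4 h6
  exact maximal_isChain_unique P.next_right_unique P.next_left_unique h5 h6 h2 h4 h1 h3

theorem IsMaximalPath.eq_of_mem {m m' : P.quiver.QPath} (h : P.IsMaximalPath m)
    (h' : P.IsMaximalPath m') {a : P.quiver.E} (ha : a ∈ m.arrows) (ha' : a ∈ m'.arrows) :
    m = m' := by
  obtain ⟨u, w, e⟩ := List.append_of_mem ha
  obtain ⟨u', w', e'⟩ := List.append_of_mem ha'
  obtain ⟨rfl, rfl⟩ := h.split_unique h' e e'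
  exact QPath.eq_of_arrows_eq (e.trans e'.symm) (by simp [e])

/-- A repeated arrow would give two splittings at that arrow with remainders of different lengths.
-/
theorem IsMaximalPath.nodup {m : P.quiver.QPath} (h : P.IsMaximalPath m) : m.arrows.Nodup := by
  apply nodup_of_forall_eq_append
  intro u a w e ha
  obtain ⟨s, t, rfl⟩ := List.append_of_mem ha
  have := (h.split_unique h e (u' := u ++ a :: s) (w' := t) (by simp [e])).2
  have := congrArg List.length this
  simp only [List.length_append, List.length_cons] at this
  omega

variable (P)

/-- Every nonzero path is part of a maximal path. -/
theorem exists_isMaximalPath {p : P.quiver.QPath} (hp : P.path p ≠ 0) :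
    ∃ (u w : P.quiver.QPath) (h' : p.last = w.first)
    (h : u.last = (p.comp w h').first),
      P.IsMaximalPath (u.comp (p.comp w h') h) := by
  obtain ⟨N, hN⟩ := P.exists_length_lt
  -- The lengths of the nonzero paths `u p w` are bounded by admissibility. A path attaining the
  -- supremum is maximal, since a nonzero prolongation at either end would be longer.
  let s : Set ℕ := {n | ∃ (u w : P.quiver.QPath) (h' : p.last = w.first)
    (h : u.last = (p.comp w h').first),
    P.path (u.comp (p.comp w h') h) ≠ 0 ∧ (u.comp (p.comp w h') h).length = n}
  have hs : s.Nonempty := by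
    refine ⟨_, QPath.triv p.first, QPath.triv p.last, rfl, rfl, ?_, rfl⟩
    rw [path_ne_zero_iff] at hp ⊢
    simpa [QPath.comp, QPath.triv] using hp
  have hb : BddAbove s := ⟨N, by
    rintro _ ⟨u, w, h', h, h1, rfl⟩
    exact (hN _ h1).le⟩
  obtain ⟨u, w, h', h, h1, h2⟩ := Nat.sSup_mem hs hb
  refine ⟨u, w, h', h, h1, fun a => ⟨?_, ?_⟩⟩
  · by_contra h3
    have hc : (QPath.single a).last = (u.comp (p.comp w h') h).first := by
      by_contra hne
      exact h3 (P.path_mul_path_of_ne (p := QPath.single a) (q := u.comp (p.comp w h') h) hne)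
    have hu : (QPath.single a).last = u.first := hc
    have h4 : ((QPath.single a).comp u hu).last = (p.comp w h').first := by rw [QPath.last_comp, h]
    have h5 : ((QPath.single a).comp u hu).comp (p.comp w h') h4 =
        (QPath.single a).comp (u.comp (p.comp w h') h) hc := by
      apply QPath.ext <;> simp [QPath.comp]
    have h6 := le_csSup hb (a := (((QPath.single a).comp u hu).comp (p.comp w h') h4).length)
      ⟨_, w, h', h4, by rw [h5, path_comp]; exact h3, rfl⟩
    rw [← h2, h5] at h6
    simp [QPath.comp, QPath.length, QPath.single] at h6
  · by_contra h3
    have hc : w.last = (QPath.single a).first := by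
      by_contra hne
      exact h3 (P.path_mul_path_of_ne (p := u.comp (p.comp w h') h) (q := QPath.single a)
        (by rwa [QPath.last_comp, QPath.last_comp]))
    have hc' : (u.comp (p.comp w h') h).last = (QPath.single a).first := by
      rwa [QPath.last_comp, QPath.last_comp]
    have h6 : p.last = (w.comp (QPath.single a) hc).first := h'
    have h7 : u.last = (p.comp (w.comp (QPath.single a) hc) h6).first := h
    have h5 : u.comp (p.comp (w.comp (QPath.single a) hc) h6) h7 =
        (u.comp (p.comp w h') h).comp (QPath.single a) hc' := by
      apply QPath.ext <;> simp [QPath.comp]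
    have h6 := le_csSup hb (a := (u.comp (p.comp (w.comp (QPath.single a) hc) h6) h7).length)
      ⟨u, _, h6, h7, by rw [h5, path_comp]; exact h3, rfl⟩
    rw [← h2, h5] at h6
    simp [QPath.comp, QPath.length, QPath.single] at h6

theorem finite_isMaximalPath : {m | P.IsMaximalPath m}.Finite :=
  P.finite_nonzero_paths.subset fun _ h => h.1

end AlmostGentlePresentation

end AlmostGentle

namespace AlmostGentle

open FinQuiver PathAlgebra

variable {K : Type u} [Field K]

/-- A proper rotation with the same head would put `a` at the start of both pieces of the list, so
twice in it. -/
theorem tail_eq_of_isRotated {α : Type*} {a : α} {l l' : List α} (hn : (a :: l).Nodup)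
    (h : (a :: l).IsRotated (a :: l')) : l = l' := by
  obtain ⟨n, hn', e'⟩ := List.isRotated_iff_mod.1 h
  clear h
  rw [List.rotate_eq_drop_append_take hn'] at e'
  have e := List.take_append_drop n (a :: l)
  generalize List.take n (a :: l) = u at e' e
  generalize List.drop n (a :: l) = v at e' e
  rcases u with _ | ⟨b, u⟩
  · simp_all
  · rcases v with _ | ⟨c, v⟩
    · simp_all
    · rw [← e, (List.cons.inj e').1, (List.cons.inj e).1] at hn
      simp at hn

/-! ### Words of the cycles of a defining pair -/

section CycleWords

variable {Q : FinQuiver}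

/-- The arrow lists of the cycles in `S`. -/
def cycleWords (S : Set Q.QPath) : Set (List Q.E) := QPath.arrows '' S

/-- The path `q` completes the path `p` to a cycle in `S`. -/
def Completes (S : Set Q.QPath) (p q : Q.QPath) : Prop :=
  p.last = q.first ∧ p.arrows ++ q.arrows ∈ cycleWords S

open Classical in
/-- The linear form with value one on the cycles in `S`, and zero on all other paths. -/
def cycleTrace (K : Type u) [Field K] (S : Set Q.QPath) : PathAlgebra K Q →ₗ[K] K :=
  lift fun p => if p ∈ S then 1 else 0

open Classical in
theorem cycleTrace_ofPath (S : Set Q.QPath) (p : Q.QPath) :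
    cycleTrace K S (ofPath K p) = if p ∈ S then 1 else 0 := lift_ofPath _ _

variable {S : Set Q.QPath} {μ : Q.QPath → ℕ}

namespace IsDefiningPair

variable (hS : IsDefiningPair S μ)
include hS

theorem nodup {l : List Q.E} (hl : l ∈ cycleWords S) : l.Nodup := by
  obtain ⟨C, hC, rfl⟩ := hl
  exact (hS.simple C hC).2.2

theorem mem_of_arrows_mem {p : Q.QPath} (h : p.arrows ∈ cycleWords S) : p ∈ S := by
  obtain ⟨C, hC, e⟩ := h
  rwa [QPath.eq_of_arrows_eq e (hS.simple C hC).1] at hC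

theorem append_comm_mem {l l' : List Q.E} (h : l ++ l' ∈ cycleWords S) :
    l' ++ l ∈ cycleWords S := by
  obtain ⟨C, hC, e⟩ := h
  obtain ⟨p, q, hpq, rfl, rfl, rfl⟩ := QPath.exists_comp_of_arrows_eq C e
  have h1 : q.last = p.first := by
    have := (hS.simple _ hC).2.1
    rwa [QPath.last_comp] at this
  exact ⟨q.comp p h1, hS.rotate _ hC _ List.isRotated_append, rfl⟩

theorem isRotated {l l' : List Q.E} (h : l ∈ cycleWords S) (h' : l' ∈ cycleWords S) {a : Q.E}
    (ha : a ∈ l) (ha' : a ∈ l') : l'.IsRotated l := by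
  obtain ⟨C, hC, rfl⟩ := h
  obtain ⟨C', hC', rfl⟩ := h'
  exact hS.unique a C hC C' hC' ha ha'

/-- By (D4) two such words are rotations of each other, and without repeated entries a rotation that
fixes the head is trivial. So each arrow has exactly one successor on its cycle. -/
theorem tail_unique {a : Q.E} {l l' : List Q.E} (h : a :: l ∈ cycleWords S)
    (h' : a :: l' ∈ cycleWords S) : l = l' :=
  tail_eq_of_isRotated (hS.nodup h)
    (hS.isRotated h' h (a := a) (List.mem_cons_self) (List.mem_cons_self))

theorem exists_cons_mem (a : Q.E) : ∃ l, a :: l ∈ cycleWords S := by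
  obtain ⟨C, hC, ha⟩ := hS.cover a
  obtain ⟨s, t, e⟩ := List.append_of_mem ha
  have : s ++ a :: t ∈ cycleWords S := ⟨C, hC, e⟩
  exact ⟨t ++ s, by simpa using hS.append_comm_mem this⟩

theorem exists_cons_cons_mem {a b : Q.E} {l : List Q.E} (h : l ∈ cycleWords S)
    (hab : [a, b] <:+: l) : ∃ t, a :: b :: t ∈ cycleWords S := by
  obtain ⟨s, t, rfl⟩ := hab
  rw [List.append_assoc] at h
  exact ⟨t ++ s, by simpa using hS.append_comm_mem h⟩

omit hS in
theorem completes_of_ne_nil {p q : Q.QPath} (hp : p.arrows ≠ []) (hq : q.arrows ≠ [])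
    (h : p.arrows ++ q.arrows ∈ cycleWords S) : Completes S p q := by
  refine ⟨?_, h⟩
  obtain ⟨C, -, e⟩ := h
  obtain ⟨p', q', h', hp', hq', -⟩ := QPath.exists_comp_of_arrows_eq C e
  rw [← QPath.eq_of_arrows_eq hp' (hp' ▸ hp), ← QPath.eq_of_arrows_eq hq' (hq' ▸ hq), h']

omit hS in
theorem exists_completes {p : Q.QPath} (hp : p.arrows ≠ []) {l : List Q.E}
    (h : p.arrows ++ l ∈ cycleWords S) : ∃ q, q.arrows = l ∧ Completes S p q := by
  have h0 := h
  obtain ⟨C, -, e⟩ := h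
  obtain ⟨p', q', h', hp', rfl, -⟩ := QPath.exists_comp_of_arrows_eq C e
  obtain rfl := QPath.eq_of_arrows_eq hp' (hp' ▸ hp)
  exact ⟨q', rfl, h', h0⟩

theorem mem_of_comp {p q : Q.QPath} (h : p.last = q.first) :
    p.comp q h ∈ S ↔ p.arrows ++ q.arrows ∈ cycleWords S :=
  ⟨fun h' => ⟨_, h', rfl⟩, fun h' => hS.mem_of_arrows_mem (p := p.comp q h) h'⟩

open Classical in
theorem cycleTrace_mul (p q : Q.QPath) :
    cycleTrace K S (ofPath K p * ofPath K q) = if Completes S p q then 1 else 0 := by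
  by_cases h : p.last = q.first
  · rw [← ofPath_comp p q h, cycleTrace_ofPath]
    simp only [hS.mem_of_comp h, Completes, h, true_and]
  · rw [ofPath_mul_ofPath_of_ne _ _ h, map_zero, if_neg fun h' => h h'.1]

theorem completes_symm {p q : Q.QPath} (h : Completes S p q) : Completes S q p := by
  refine ⟨?_, hS.append_comm_mem h.2⟩
  have := (hS.simple _ ((hS.mem_of_comp h.1).2 h.2)).2.1
  rwa [QPath.last_comp] at this

theorem cycleTrace_mul_comm (x y : PathAlgebra K Q) :
    cycleTrace K S (x * y) = cycleTrace K S (y * x) := by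
  induction x using PathAlgebra.induction with
  | zero => simp
  | add x x' hx hx' => simp only [add_mul, mul_add, map_add, hx, hx']
  | path c p =>
    induction y using PathAlgebra.induction with
    | zero => simp
    | add y y' hy hy' => simp only [add_mul, mul_add, map_add, hy, hy']
    | path d q =>
      simp only [smul_mul_assoc, mul_smul_comm, map_smul, hS.cycleTrace_mul]
      rw [smul_comm]
      congr 3
      exact propext ⟨hS.completes_symm, hS.completes_symm⟩

/-- After rotation both cycles start with the first arrow of `q`, so they have the same tail, which
determines the arrows of `p`. The vertex is compared separately when `p` is trivial. -/
theorem completes_unique {p p' q : Q.QPath} (hq : q.arrows ≠ []) (h : Completes S p q)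
    (h' : Completes S p' q) : p = p' := by
  have h1 := (hS.completes_symm h).2
  have h2 := (hS.completes_symm h').2
  have h3 : p.arrows = p'.arrows := by
    match e : q.arrows with
    | [] => exact absurd e hq
    | b :: t =>
      rw [e] at h1 h2
      have := hS.tail_unique (a := b) (l := t ++ p.arrows) (l' := t ++ p'.arrows) h1 h2
      exact List.append_cancel_left this
  by_cases hp : p.arrows = []
  · refine QPath.ext ?_ h3
    rw [← QPath.last_of_nil hp, ← QPath.last_of_nil (h3 ▸ hp), h.1, h'.1]
  · exact QPath.eq_of_arrows_eq h3 hp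

theorem completes_nil_iff {p q : Q.QPath} (hq : q.arrows = []) :
    Completes S p q ↔ p ∈ S ∧ p.first = q.first := by
  constructor
  · rintro ⟨h1, h2⟩
    rw [hq, List.append_nil] at h2
    have := hS.mem_of_arrows_mem h2
    exact ⟨this, (hS.simple p this).2.1.symm.trans h1⟩
  · rintro ⟨h1, h2⟩
    exact ⟨(hS.simple p h1).2.1.trans h2, by rw [hq, List.append_nil]; exact ⟨p, h1, rfl⟩⟩

theorem arrows_eq_nil_of_completes {p q : Q.QPath} (hp : p ∈ S) (h : Completes S p q) :
    q.arrows = [] := by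
  have hne := (hS.simple p hp).1
  obtain ⟨a, ha⟩ := List.exists_mem_of_ne_nil _ hne
  have h1 := hS.isRotated ⟨p, hp, rfl⟩ h.2 ha (List.mem_append_left _ ha)
  have h2 := h1.perm.length_eq
  rw [List.length_append] at h2
  exact List.eq_nil_of_length_eq_zero (by omega)

/-- The sets of completions are equal or disjoint. Only a trivial `q` leaves room for `p ≠ p'`: both
are then cycles at one vertex, and a cycle has only trivial completions. -/
theorem completes_iff_of_completes {p p' q : Q.QPath} (h : Completes S p q)
    (h' : Completes S p' q) (r : Q.QPath) : Completes S p r ↔ Completes S p' r := by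
  by_cases hq : q.arrows = []
  · rw [hS.completes_nil_iff hq] at h h'
    constructor
    · intro hr
      have h0 := hS.arrows_eq_nil_of_completes h.1 hr
      rw [hS.completes_nil_iff h0] at hr ⊢
      exact ⟨h'.1, h'.2.trans (h.2.symm.trans hr.2)⟩
    · intro hr
      have h0 := hS.arrows_eq_nil_of_completes h'.1 hr
      rw [hS.completes_nil_iff h0] at hr ⊢
      exact ⟨h.1, h.2.trans (h'.2.symm.trans hr.2)⟩
  · rw [hS.completes_unique hq h h']

/-! ### The ideal of relations as the radical of the trace form -/

variable (hμ : ∀ C ∈ S, μ C = 1)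
include hμ

theorem typeThree_mem {a b : Q.E} (h : ¬ ∃ t, a :: b :: t ∈ cycleWords S) :
    ofArrow K a * ofArrow K b ∈ TwoSidedIdeal.span {x | CycleRelation K S μ x} := by
  refine TwoSidedIdeal.subset_span (CycleRelation.typeThree a b fun C hC hab => h ?_)
  rw [hμ C hC, List.replicate_one, List.flatten_singleton] at hab
  exact hS.exists_cons_cons_mem ⟨C, hC, rfl⟩ hab

variable (hv : ∀ v, ∃ C ∈ S, C.first = v)
include hv

/-- Induct on the last arrow `b`, removing it to get `p'`. If `p'` has a completion `q` and last
arrow `a`, there are two cases. If `a b` is not on a cycle, a relation of type three applies. If it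
is, determinism makes `b` the next arrow: either `q` is trivial and a type two relation applies, or
`b` is the first arrow of `q` and `p` itself could be completed. -/
theorem mem_span_of_forall_not_completes (p : Q.QPath) (h : ∀ q, ¬ Completes S p q) :
    ofPath K p ∈ TwoSidedIdeal.span {x | CycleRelation K S μ x} := by
  obtain ⟨l, hl⟩ : ∃ l, p.arrows = l := ⟨_, rfl⟩
  induction l using List.reverseRecOn generalizing p with
  | nil =>
    obtain ⟨C, hC, hCp⟩ := hv p.first
    exact absurd ⟨(QPath.last_of_nil hl).trans hCp.symm, by rw [hl]; exact ⟨C, hC, rfl⟩⟩ (h C)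
  | append_singleton l b ih =>
    obtain ⟨p', hp', rfl, rfl⟩ := QPath.exists_concat hl
    by_cases hc : ∀ q, ¬ Completes S p' q
    · rw [ofPath_comp]
      exact TwoSidedIdeal.mul_mem_right _ _ _ (ih p' hc rfl)
    push Not at hc
    obtain ⟨q, hq⟩ := hc
    rcases List.eq_nil_or_concat' p'.arrows with hnil | ⟨s, a, hsa⟩
    · obtain ⟨t, ht⟩ := hS.exists_cons_mem b
      obtain ⟨r, -, hr⟩ := exists_completes (p := p'.comp (QPath.single b) hp') (l := t)
        (by rw [hl]; simp) (by rw [hl, hnil]; exact ht)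
      exact absurd hr (h r)
    by_cases hab : ∃ t, a :: b :: t ∈ cycleWords S
    · obtain ⟨t, ht⟩ := hab
      have h1 : a :: (q.arrows ++ s) ∈ cycleWords S := by
        have := hq.2
        rw [hsa, List.append_assoc] at this
        simpa using hS.append_comm_mem this
      have h2 := hS.tail_unique h1 ht
      rcases hqa : q.arrows with _ | ⟨c, q'⟩
      · have hp'S : p' ∈ S := ((hS.completes_nil_iff hqa).1 hq).1
        rw [hqa, List.nil_append] at h2
        have h3 : p'.arrows.head? = some b := by rw [hsa, h2]; rfl
        have := TwoSidedIdeal.subset_span (CycleRelation.typeTwo (K := K) (μ := μ) p' b hp'S h3)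
        rw [hμ p' hp'S, pow_one] at this
        rw [ofPath_comp]
        exact this
      · rw [hqa, List.cons_append, List.cons.injEq] at h2
        obtain ⟨rfl, -⟩ := h2
        obtain ⟨r, -, hr⟩ := exists_completes (p := p'.comp (QPath.single c) hp') (l := q')
          (by rw [hl]; simp) (by
            have := hq.2
            rw [hqa] at this
            rw [hl]
            simpa using this)
        exact absurd hr (h r)
    · have h1 := hS.typeThree_mem (K := K) hμ hab
      obtain ⟨p'', h2, -, rfl⟩ := QPath.exists_concat hsa
      rw [ofPath_comp, ofPath_comp, mul_assoc]
      exact TwoSidedIdeal.mul_mem_left _ _ _ h1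

omit hv in
theorem sub_mem_span_of_completes {p p' q : Q.QPath} (h : Completes S p q)
    (h' : Completes S p' q) :
    ofPath K p - ofPath K p' ∈ TwoSidedIdeal.span {x | CycleRelation K S μ x} := by
  by_cases hq : q.arrows = []
  · rw [hS.completes_nil_iff hq] at h h'
    have := TwoSidedIdeal.subset_span
      (CycleRelation.typeOne (K := K) (μ := μ) p p' h.1 h'.1 (h.2.trans h'.2.symm))
    rwa [hμ _ h.1, hμ _ h'.1, pow_one, pow_one] at this
  · rw [hS.completes_unique hq h h', sub_self]
    exact TwoSidedIdeal.zero_mem _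

-- Symmetry of the trace lets a left factor be moved to the right, so only the relations themselves
-- have to be tested. Those of type one have equal completions; a path in a relation of type two
-- repeats an arrow, and one of type three has arrows that are not consecutive in any cycle.
omit hv in
theorem cycleTrace_mul_eq_zero_of_mem_span {x : PathAlgebra K Q}
    (hx : x ∈ TwoSidedIdeal.span {x | CycleRelation K S μ x}) (y : PathAlgebra K Q) :
    cycleTrace K S (x * y) = 0 := by
  classical
  induction hx using TwoSidedIdeal.span_induction generalizing y with
  | zero => simp
  | add x x' _ _ hx hx' => rw [add_mul, map_add, hx, hx', add_zero]
  | neg x _ hx => rw [neg_mul, map_neg, hx, neg_zero]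
  | left_absorb a x _ hx => rw [mul_assoc, hS.cycleTrace_mul_comm, mul_assoc, hx]
  | right_absorb b x _ hx => rw [mul_assoc, hx]
  | mem x hx =>
    induction y using PathAlgebra.induction with
    | zero => simp
    | add y y' hy hy' => rw [mul_add, map_add, hy, hy', add_zero]
    | path c q =>
      rw [mul_smul_comm, map_smul, smul_eq_zero]
      right
      cases hx with
      | typeOne C C' hC hC' h =>
        have h1 := (hS.completes_nil_iff (p := C) (q := QPath.triv C.first) rfl).2 ⟨hC, rfl⟩
        have h2 := (hS.completes_nil_iff (p := C') (q := QPath.triv C.first) rfl).2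
          ⟨hC', h.symm⟩
        simp only [hμ C hC, hμ C' hC', pow_one, sub_mul, map_sub, hS.cycleTrace_mul,
          hS.completes_iff_of_completes h1 h2 q, sub_self]
      | typeTwo C a hC h =>
        rw [hμ C hC, pow_one]
        obtain ⟨t, ht⟩ : ∃ t, C.arrows = a :: t := by
          match e : C.arrows with
          | [] => simp [e] at h
          | b :: t =>
            rw [e, List.head?_cons, Option.some.injEq] at h
            exact ⟨t, by rw [h]⟩
        have h1 : C.last = (QPath.single a).first := by
          rw [(hS.simple C hC).2.1]
          exact QPath.first_eq_src ht
        rw [← ofPath_single, ← ofPath_comp _ _ h1, hS.cycleTrace_mul, if_neg]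
        intro h2
        have := hS.nodup h2.2
        simp [QPath.comp, QPath.single, ht] at this
      | typeThree a b h =>
        by_cases hab : Q.tgt a = Q.src b
        · rw [ofArrow_mul_ofArrow hab, hS.cycleTrace_mul, if_neg]
          intro h2
          obtain ⟨C, hC, e⟩ := h2.2
          apply h C hC
          rw [hμ C hC, List.replicate_one, List.flatten_singleton, e]
          exact ⟨[], q.arrows, rfl⟩
        · rw [ofArrow_mul_ofArrow_of_ne hab, zero_mul, map_zero]

/-- The ideal of relations is the radical of the trace form. -/
theorem mem_span_iff (x : PathAlgebra K Q) :
    x ∈ TwoSidedIdeal.span {x | CycleRelation K S μ x} ↔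
      ∀ q, cycleTrace K S (x * ofPath K q) = 0 := by
  classical
  refine ⟨fun hx q => hS.cycleTrace_mul_eq_zero_of_mem_span hμ hx _, fun hx => ?_⟩
  set I := TwoSidedIdeal.span {x | CycleRelation K S μ x} with hI
  let f := RingCon.mkₐ (α := K) I.ringCon
  have hf : ∀ x, f x = 0 ↔ x ∈ I := ker_mkₐ I
  rw [← hf]
  have h1 := map_eq_sum f.toLinearMap x
  simp only [AlgHom.toLinearMap_apply] at h1
  rw [h1]
  -- Sort the paths in `x` by their sets of completions. Modulo `I`, the class with no completions
  -- vanishes and every other class collapses to a single element.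
  let N : Q.QPath → Set Q.QPath := fun p => {q | Completes S p q}
  rw [← Finset.sum_fiberwise_of_maps_to (g := N) (t := (support x).image N)
    (fun p hp => Finset.mem_image_of_mem _ hp)]
  refine Finset.sum_eq_zero fun n hn => ?_
  obtain ⟨p₀, hp₀, rfl⟩ := Finset.mem_image.1 hn
  rcases (N p₀).eq_empty_or_nonempty with he | ⟨q, hq⟩
  · refine Finset.sum_eq_zero fun p hp => ?_
    rw [(Finset.mem_filter.1 hp).2.trans he |> fun h => (hf _).2
      (hS.mem_span_of_forall_not_completes hμ hv p fun q hq => by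
        have : q ∈ N p := hq
        rw [h] at this
        exact this), smul_zero]
  · have hmem : ∀ p, N p = N p₀ ↔ Completes S p q := fun p =>
      ⟨fun h => by
        have : q ∈ N p := h ▸ hq
        exact this,
      fun h => Set.ext fun r => hS.completes_iff_of_completes h hq r⟩
    have h2 : ∀ p ∈ (support x).filter (fun p => N p = N p₀),
        coeff p x • f (ofPath K p) = coeff p x • f (ofPath K p₀) := by
      intro p hp
      have h3 := (hmem p).1 (Finset.mem_filter.1 hp).2
      have h4 := (hf _).2 (hS.sub_mem_span_of_completes (K := K) hμ h3 hq)
      rw [map_sub, sub_eq_zero] at h4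
      rw [h4]
    rw [Finset.sum_congr rfl h2, ← Finset.sum_smul]
    -- For `q` completing `p₀`, the trace of `x q` is the sum of the coefficients of `x` over the
    -- class of `p₀`.
    have h3 := map_eq_sum ((cycleTrace K S) ∘ₗ LinearMap.mulRight K (ofPath K q)) x
    simp only [LinearMap.comp_apply, LinearMap.mulRight_apply, hS.cycleTrace_mul, hx, smul_eq_mul,
      mul_ite, mul_one, mul_zero] at h3
    rw [← Finset.sum_filter] at h3
    simp only [hmem]
    rw [← h3, zero_smul]

-- When `q` completes no path but `p`, the trace of `x q` reads off the coefficient of `p`. Applied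
-- to vertices and arrows, this shows that the relations lie in the square of the arrow ideal.
omit hv in
theorem coeff_eq_zero_of_mem_span {x : PathAlgebra K Q}
    (hx : x ∈ TwoSidedIdeal.span {x | CycleRelation K S μ x}) {p q : Q.QPath}
    (h : Completes S p q) (hu : ∀ p', Completes S p' q → p' = p) : coeff p x = 0 := by
  classical
  have h3 := map_eq_sum ((cycleTrace K S) ∘ₗ LinearMap.mulRight K (ofPath K q)) x
  simp only [LinearMap.comp_apply, LinearMap.mulRight_apply, hS.cycleTrace_mul, smul_eq_mul,
    mul_ite, mul_one, mul_zero, hS.cycleTrace_mul_eq_zero_of_mem_span hμ hx] at h3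
  by_contra hne
  rw [Finset.sum_eq_single p, if_pos h] at h3
  · exact hne h3.symm
  · intro p' _ hp'
    rw [if_neg fun h' => hp' (hu p' h')]
  · intro h'
    rw [mem_support_iff, not_not] at h'
    rw [h', ite_self]

omit hv in
theorem mem_span_of_length {p : Q.QPath} (hp : Fintype.card Q.E < p.length)
    (hv : ∀ v, ∃ C ∈ S, C.first = v) :
    ofPath K p ∈ TwoSidedIdeal.span {x | CycleRelation K S μ x} := by
  refine hS.mem_span_of_forall_not_completes hμ hv p fun q hq => ?_
  have := (hS.nodup hq.2).length_le_card
  rw [List.length_append] at this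
  have : p.arrows.length ≤ Fintype.card Q.E := by omega
  exact absurd hp (not_lt.2 this)

theorem isAdmissible : IsAdmissible K (TwoSidedIdeal.span {x | CycleRelation K S μ x}) := by
  -- Cycles have no repeated arrow, so a path longer than the number of arrows has no completion.
  refine ⟨fun x hx p hp => ?_, Fintype.card Q.E + 1, fun p hp => hS.mem_span_of_length hμ hp hv⟩
  rw [mem_support_iff] at hp
  by_contra! hlt
  apply hp
  rcases hpa : p.arrows with _ | ⟨a, l⟩
  · obtain ⟨C, hC, hCp⟩ := hv p.first
    have h1 : Completes S p C :=
      ⟨(QPath.last_of_nil hpa).trans hCp.symm, by rw [hpa]; exact ⟨C, hC, rfl⟩⟩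
    exact hS.coeff_eq_zero_of_mem_span hμ hx h1 fun p' h' =>
      hS.completes_unique (hS.simple C hC).1 h' h1
  · have hl : l = [] := by
      rw [QPath.length, hpa, List.length_cons] at hlt
      exact List.eq_nil_of_length_eq_zero (by omega)
    subst hl
    obtain ⟨t, ht⟩ := hS.exists_cons_mem a
    obtain ⟨q, rfl, hq⟩ := exists_completes (p := p) (l := t) (by simp [hpa])
      (by rw [hpa]; exact ht)
    refine hS.coeff_eq_zero_of_mem_span hμ hx hq fun p' h' => ?_
    by_cases hqn : q.arrows = []
    -- The arrow is itself a cycle of multiplicity one, so by (D0) it is the only arrow; as cycles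
    -- do not repeat arrows, no other cycle exists.
    · have h1 := ((hS.completes_nil_iff hqn).1 h').1
      have h2 := ((hS.completes_nil_iff hqn).1 hq).1
      have hE : ¬ Nontrivial Q.E := fun hE => by
        have := hS.loop p h2 (by simp [QPath.length, hpa]) hE
        rw [hμ p h2] at this
        exact absurd this (lt_irrefl 1)
      rw [not_nontrivial_iff_subsingleton] at hE
      have h3 := (hS.simple p' h1).2.2
      have h4 := h3.length_le_card
      have h5 := Fintype.card_le_one_iff_subsingleton.2 hE
      refine QPath.eq_of_arrows_eq ?_ (hS.simple p' h1).1
      match e : p'.arrows with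
      | [] => exact absurd e (hS.simple p' h1).1
      | [b] => rw [hpa, Subsingleton.elim a b]
      | b :: c :: l =>
        rw [e] at h4
        simp only [List.length_cons] at h4
        omega
    · exact hS.completes_unique hqn h' hq

omit hv in
theorem exists_cons_cons_mem_of_mul_notMem {a b : Q.E}
    (h : ofArrow K a * ofArrow K b ∉ TwoSidedIdeal.span {x | CycleRelation K S μ x}) :
    ∃ t, a :: b :: t ∈ cycleWords S := by
  by_contra h'
  exact h (hS.typeThree_mem hμ h')

omit hv in
theorem isSpecialMultiserial :
    IsSpecialMultiserial K (TwoSidedIdeal.span {x | CycleRelation K S μ x}) := by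
  constructor
  · intro a b b' h h'
    obtain ⟨t, ht⟩ := hS.exists_cons_cons_mem_of_mul_notMem hμ h
    obtain ⟨t', ht'⟩ := hS.exists_cons_cons_mem_of_mul_notMem hμ h'
    exact (List.cons.inj (hS.tail_unique ht ht')).1
  · intro a c c' h h'
    obtain ⟨t, ht⟩ := hS.exists_cons_cons_mem_of_mul_notMem hμ h
    obtain ⟨t', ht'⟩ := hS.exists_cons_cons_mem_of_mul_notMem hμ h'
    have h1 := hS.append_comm_mem (l := [c]) (l' := a :: t) ht
    have h2 := hS.append_comm_mem (l := [c']) (l' := a :: t') ht'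
    have := hS.tail_unique (a := a) (l := t ++ [c]) (l' := t' ++ [c']) h1 h2
    exact List.singleton_inj.1 (List.append_inj' this rfl).2

end IsDefiningPair

end CycleWords

end AlmostGentle

namespace AlmostGentle

open FinQuiver PathAlgebra

variable {K : Type u} [Field K]

/-! ### Trivial extensions -/

namespace TrivialExtension

variable {A : Type u} [Ring A] [Algebra K A]

theorem form_inj {f g : DualBimodule K A} (h : ∀ x, f.form x = g.form x) : f = g :=
  DualBimodule.form_ext h

theorem form_of (f : A →ₗ[K] K) (x : A) : (DualBimodule.of K f).form x = f x := rfl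

/-- The symmetrizing form of the trivial extension. -/
def trace (K : Type u) [Field K] (A : Type u) [Ring A] [Algebra K A] :
    TrivialExtension K A →ₗ[K] K where
  toFun x := x.snd.form 1
  map_add' _ _ := DualBimodule.add_form _ _ _
  map_smul' _ _ := DualBimodule.form_smul _ _ _

theorem trace_apply (x : TrivialExtension K A) : trace K A x = x.snd.form 1 := rfl

theorem snd_mul_form (x y : TrivialExtension K A) (z : A) :
    (x * y).snd.form z = y.snd.form (z * x.fst) + x.snd.form (y.fst * z) := by
  rw [TrivSqZeroExt.snd_mul, DualBimodule.add_form, DualBimodule.smul_form,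
    DualBimodule.op_smul_form]
  rfl

theorem trace_mul (x y : TrivialExtension K A) :
    trace K A (x * y) = y.snd.form x.fst + x.snd.form y.fst := by
  rw [trace_apply, snd_mul_form, one_mul, mul_one]

theorem trace_mul_comm (x y : TrivialExtension K A) :
    trace K A (x * y) = trace K A (y * x) := by
  rw [trace_mul, trace_mul, add_comm]

/-- The form pairs `A` with `D(A)`: elements of `D(A)` detect the first component and elements of
`A` the second. -/
theorem eq_zero_of_trace_mul (x : TrivialExtension K A) (h : ∀ y, trace K A (x * y) = 0) :
    x = 0 := by
  have h1 : x.fst = 0 := by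
    rw [← Module.forall_dual_apply_eq_zero_iff K]
    intro f
    have := h (TrivSqZeroExt.inr (DualBimodule.of K f))
    rw [trace_mul, TrivSqZeroExt.snd_inr, TrivSqZeroExt.fst_inr, map_zero, add_zero] at this
    exact this
  have h2 : x.snd = 0 := by
    apply form_inj
    intro a
    have := h (TrivSqZeroExt.inl a)
    rw [trace_mul, TrivSqZeroExt.snd_inl, TrivSqZeroExt.fst_inl, DualBimodule.zero_form,
      zero_add] at this
    exact this
  exact TrivSqZeroExt.ext h1 h2

theorem isSymmetricAlgebra : IsSymmetricAlgebra K (TrivialExtension K A) :=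
  ⟨trace K A, trace_mul_comm, eq_zero_of_trace_mul⟩

/-- The square of `D(A)` is zero, so an idempotent is zero as soon as its component in `A` is. Apply
this to `e` or to `1 - e`. -/
theorem isIndecomposable (h : IsIndecomposable A) : IsIndecomposable (TrivialExtension K A) := by
  obtain ⟨h1, h2⟩ := h
  refine ⟨⟨0, 1, fun h => zero_ne_one (congrArg TrivSqZeroExt.fst h)⟩, fun e he hi => ?_⟩
  have key : ∀ e : TrivialExtension K A, IsIdempotentElem e → e.fst = 0 → e = 0 := by
    intro e hi h0
    rw [← hi.eq]
    refine TrivSqZeroExt.ext (by simp [h0]) (form_inj fun x => ?_)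
    rw [snd_mul_form, h0, mul_zero, zero_mul, map_zero, add_zero]
    rfl
  have hf : IsIdempotentElem e.fst := congrArg TrivSqZeroExt.fst hi.eq
  have hc : e.fst ∈ Subring.center A := by
    rw [Subring.mem_center_iff] at he ⊢
    exact fun a => congrArg TrivSqZeroExt.fst (he (TrivSqZeroExt.inl a))
  rcases h2 _ hc hf with h0 | h0
  · exact Or.inl (key e hi h0)
  · right
    have := key (1 - e) hi.one_sub (by rw [TrivSqZeroExt.fst_sub, TrivSqZeroExt.fst_one, h0, sub_self])
    exact (sub_eq_zero.1 this).symm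

/-- A central element of `A` acts in the same way on both sides of `D(A)`, hence stays central in
`T(A)`. -/
theorem isIndecomposable_of (h : IsIndecomposable (TrivialExtension K A)) :
    IsIndecomposable A := by
  obtain ⟨h1, h2⟩ := h
  have hA : Nontrivial A := by
    by_contra hA
    rw [not_nontrivial_iff_subsingleton] at hA
    obtain ⟨x, y, hxy⟩ := h1
    refine hxy (TrivSqZeroExt.ext (Subsingleton.elim _ _) (form_inj fun a => ?_))
    rw [Subsingleton.elim a 0, map_zero, map_zero]
  refine ⟨hA, fun e he hi => ?_⟩
  rw [Subring.mem_center_iff] at he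
  have hc : (TrivSqZeroExt.inl e : TrivialExtension K A) ∈ Subring.center _ := by
    rw [Subring.mem_center_iff]
    intro x
    refine TrivSqZeroExt.ext (he x.fst) (form_inj fun a => ?_)
    simp only [snd_mul_form, TrivSqZeroExt.fst_inl, TrivSqZeroExt.snd_inl, DualBimodule.zero_form,
      zero_add, add_zero, he a]
  have hid : IsIdempotentElem (TrivSqZeroExt.inl e : TrivialExtension K A) := by
    unfold IsIdempotentElem
    rw [← TrivSqZeroExt.inl_mul, hi.eq]
  rcases h2 _ hc hid with h | h
  · exact Or.inl (congrArg TrivSqZeroExt.fst h)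
  · exact Or.inr (congrArg TrivSqZeroExt.fst h)

variable {B : Type u} [Ring B] [Algebra K B]

/-- Isomorphic algebras have isomorphic trivial extensions. -/
theorem exists_algEquiv (e : A ≃ₐ[K] B) :
    ∃ E : TrivialExtension K A ≃ₐ[K] TrivialExtension K B,
      ∀ a (f : A →ₗ[K] K), E (TrivSqZeroExt.inl a + TrivSqZeroExt.inr (DualBimodule.of K f)) =
        TrivSqZeroExt.inl (e a) +
          TrivSqZeroExt.inr (DualBimodule.of K (f ∘ₗ e.symm.toLinearMap)) := by
  let E : TrivialExtension K A ≃ₗ[K] TrivialExtension K B :=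
    { toFun := fun x => (e x.fst, DualBimodule.of K (x.snd.form ∘ₗ e.symm.toLinearMap))
      invFun := fun x => (e.symm x.fst, DualBimodule.of K (x.snd.form ∘ₗ e.toLinearMap))
      map_add' := fun x y => TrivSqZeroExt.ext (map_add e _ _) rfl
      map_smul' := fun c x => TrivSqZeroExt.ext (map_smul e _ _) rfl
      left_inv := fun x => TrivSqZeroExt.ext (e.symm_apply_apply _)
        (form_inj fun a => congrArg x.snd.form (e.symm_apply_apply a))
      right_inv := fun x => TrivSqZeroExt.ext (e.apply_symm_apply _)
        (form_inj fun a => congrArg x.snd.form (e.apply_symm_apply a)) }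
  have hfst : ∀ x, (E x).fst = e x.fst := fun x => rfl
  have hsnd : ∀ x b, (E x).snd.form b = x.snd.form (e.symm b) := fun x b => rfl
  refine ⟨AlgEquiv.ofLinearEquiv E ?_ ?_, fun a f => ?_⟩
  · refine TrivSqZeroExt.ext (map_one e) (form_inj fun b => ?_)
    rw [hsnd]
    rfl
  · intro x y
    refine TrivSqZeroExt.ext (map_mul e _ _) (form_inj fun b => ?_)
    simp only [hfst, hsnd, snd_mul_form, map_mul, AlgEquiv.symm_apply_apply]
  · refine TrivSqZeroExt.ext ?_ (form_inj fun b => ?_)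
    · change (E _).fst = _
      simp [hfst]
    · change (E _).snd.form b = _
      rw [hsnd]
      simp only [TrivSqZeroExt.snd_add, TrivSqZeroExt.snd_inl, TrivSqZeroExt.snd_inr, zero_add]
      rfl

end TrivialExtension

/-- A vertex without arrows is the only vertex of the quiver of an indecomposable algebra. -/
theorem eq_of_isolated {B : Type u} [Ring B] [Algebra K B] (hB : IsIndecomposable B)
    {Q : FinQuiver} (π : PathAlgebra K Q →ₐ[K] B) (hπ : Function.Surjective π)
    (hI : IsAdmissible K (TwoSidedIdeal.ker π)) {v : Q.V} (hsrc : ∀ a, Q.src a ≠ v)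
    (htgt : ∀ a, Q.tgt a ≠ v) (w : Q.V) : w = v := by
  -- No path of positive length starts or ends at `v`, so `e_v` is central. By admissibility it is
  -- nonzero, so it is `1`, which leaves no other vertex.
  have hc : ∀ x, ofPath K (QPath.triv v) * x = x * ofPath K (QPath.triv v) := by
    intro x
    induction x using PathAlgebra.induction with
    | zero => simp
    | add x y hx hy => rw [mul_add, add_mul, hx, hy]
    | path c p =>
      rw [mul_smul_comm, smul_mul_assoc]
      congr 1
      rcases hp : p.arrows with _ | ⟨a, l⟩
      · rw [QPath.eq_triv hp]
        by_cases h : p.first = v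
        · rw [h]
        · rw [triv_mul_triv_of_ne h, triv_mul_triv_of_ne (Ne.symm h)]
      · rw [ofPath_mul_ofPath_of_ne, ofPath_mul_ofPath_of_ne]
        · obtain ⟨l', b, e⟩ := List.eq_nil_or_concat' p.arrows |>.resolve_left (by simp [hp])
          rw [QPath.last_eq_tgt e]
          exact htgt b
        · rw [QPath.first_eq_src hp]
          exact (hsrc a).symm
  have hne : ∀ u, π (ofPath K (QPath.triv u)) ≠ 0 := by
    intro u h
    have := hI.1 _ ((TwoSidedIdeal.mem_ker _).2 h) (QPath.triv u)
      ((mem_support_iff _ _).2 (by rw [coeff_ofPath_self]; exact one_ne_zero))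
    exact absurd this (by simp [QPath.length, QPath.triv])
  rcases hB.2 (π (ofPath K (QPath.triv v))) (by
      rw [Subring.mem_center_iff]
      intro b
      obtain ⟨x, rfl⟩ := hπ b
      rw [← map_mul, ← map_mul, hc]) (by
      unfold IsIdempotentElem
      rw [← map_mul, triv_mul_triv]) with h | h
  · exact absurd h (hne v)
  · by_contra hw
    apply hne w
    rw [← mul_one (π _), ← h, ← map_mul, triv_mul_triv_of_ne hw, map_zero]

end AlmostGentle

namespace AlmostGentle

open FinQuiver PathAlgebra

variable {K : Type u} [Field K]

namespace AlmostGentlePresentation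

variable {A : Type u} [Ring A] [Algebra K A] (P : AlmostGentlePresentation K A)

/-! ### The quiver of the trivial extension -/

/-- The maximal paths of a presentation. -/
abbrev MaxPath : Type := {m : P.quiver.QPath // P.IsMaximalPath m}

/-- The quiver of the trivial extension: one new arrow for each maximal path, in the opposite
direction. -/
abbrev extQuiver : FinQuiver where
  V := P.quiver.V
  E := P.quiver.E ⊕ P.MaxPath
  fintypeE := @instFintypeSum _ _ _ P.finite_isMaximalPath.fintype
  src := Sum.elim P.quiver.src fun m => m.1.last
  tgt := Sum.elim P.quiver.tgt fun m => m.1.first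

/-- The inclusion of the quiver of the algebra. -/
def inc : Hom P.quiver P.extQuiver where
  onV := id
  onE := Sum.inl
  src_onE _ := rfl
  tgt_onE _ := rfl

/-- The arrow that belongs to a maximal path. -/
def newArrow (m : P.MaxPath) : P.extQuiver.E := Sum.inr m

/-- The element `β_m` of the trivial extension. -/
def beta (m : P.MaxPath) : TrivialExtension K A :=
  TrivSqZeroExt.inr (DualBimodule.of K (P.coef m.1))

/-- Together with `coef_triv_mul` this gives `β_m` its direction, from the end of `m` to its start.
-/
theorem coef_mul_triv {m : P.quiver.QPath} (hm : P.path m ≠ 0) (x : A) :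
    P.coef m (x * P.path (QPath.triv m.last)) = P.coef m x := by
  classical
  have : P.coef m ∘ₗ LinearMap.mulRight K (P.path (QPath.triv m.last)) = P.coef m := by
    apply P.linearMap_ext
    intro p hp
    change P.coef m (P.path p * _) = _
    by_cases h : p.last = m.last
    · rw [← h, path, path, ← map_mul, ofPath_mul_triv]
    · rw [P.path_mul_path_of_ne (q := QPath.triv m.last) h, map_zero, P.coef_path hm,
        if_neg fun e => h (by rw [e])]
  exact LinearMap.congr_fun this x

theorem coef_triv_mul {m : P.quiver.QPath} (hm : P.path m ≠ 0) (x : A) :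
    P.coef m (P.path (QPath.triv m.first) * x) = P.coef m x := by
  classical
  have : P.coef m ∘ₗ LinearMap.mulLeft K (P.path (QPath.triv m.first)) = P.coef m := by
    apply P.linearMap_ext
    intro p hp
    change P.coef m (_ * P.path p) = _
    by_cases h : m.first = p.first
    · rw [h, path, path, ← map_mul, triv_mul_ofPath]
    · rw [P.path_mul_path_of_ne (p := QPath.triv m.first) h, map_zero, P.coef_path hm,
        if_neg fun e => h (by rw [e])]
  exact LinearMap.congr_fun this x

theorem inl_mul_beta_mul_inl (m : P.MaxPath) (a b : A) :
    (TrivSqZeroExt.inl a * P.beta m * TrivSqZeroExt.inl b : TrivialExtension K A) =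
      TrivSqZeroExt.inr (DualBimodule.of K
        (P.coef m.1 ∘ₗ LinearMap.mulLeft K b ∘ₗ LinearMap.mulRight K a)) := by
  refine TrivSqZeroExt.ext (by simp [beta]) (TrivialExtension.form_inj fun x => ?_)
  simp only [TrivialExtension.snd_mul_form, beta, TrivSqZeroExt.fst_inl, TrivSqZeroExt.snd_inl,
    TrivSqZeroExt.snd_inr, TrivSqZeroExt.fst_inr, DualBimodule.zero_form, zero_add, add_zero,
    TrivialExtension.form_of, LinearMap.comp_apply, LinearMap.mulLeft_apply,
    LinearMap.mulRight_apply, mul_assoc]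

/-- The universal property of the path algebra applies once `β_m` is known to absorb the idempotents
at its source and target. -/
theorem exists_extHom : ∃ F : PathAlgebra K P.extQuiver →ₐ[K] TrivialExtension K A,
    (∀ p, F (ofPath K (P.inc.mapPath p)) = TrivSqZeroExt.inl (P.path p)) ∧
      ∀ m, F (ofArrow K (P.newArrow m)) = P.beta m := by
  let T := TrivialExtension K A
  let ε : P.extQuiver.V → T := fun v => TrivSqZeroExt.inl (P.path (QPath.triv (Q := P.quiver) v))
  let x : P.extQuiver.E → T := Sum.elim (fun a => TrivSqZeroExt.inl (P.arrow a)) P.beta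
  have hl : ∀ y z : PathAlgebra K P.quiver,
      (TrivSqZeroExt.inl (P.π y) * TrivSqZeroExt.inl (P.π z) : T) =
      TrivSqZeroExt.inl (P.π (y * z)) := fun y z => by rw [← TrivSqZeroExt.inl_mul, map_mul]
  obtain ⟨F, h1, h2⟩ := exists_algHom (K := K) (Q := P.extQuiver) ε x
    (fun (v : P.quiver.V) => by
      change (TrivSqZeroExt.inl (P.π _) * TrivSqZeroExt.inl (P.π _) : T) = _
      rw [hl, triv_mul_triv]
      rfl)
    (fun (v w : P.quiver.V) h => by
      change (TrivSqZeroExt.inl (P.π _) * TrivSqZeroExt.inl (P.π _) : T) = _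
      rw [hl, triv_mul_triv_of_ne h, map_zero, TrivSqZeroExt.inl_zero])
    (by
      change ∑ v : P.quiver.V, (TrivSqZeroExt.inl (P.path (QPath.triv v)) : T) = 1
      rw [← TrivSqZeroExt.inl_one, ← map_one P.π, one_def, map_sum]
      exact (map_sum (TrivSqZeroExt.inlHom A (DualBimodule K A)) _ _).symm)
    (by
      rintro (a | m)
      · change (TrivSqZeroExt.inl (P.π _) * TrivSqZeroExt.inl (P.π _) : T) = _
        rw [hl]
        exact congrArg _ (congrArg _ (triv_mul_ofPath (QPath.single a)))
      · change (TrivSqZeroExt.inl (P.path (QPath.triv m.1.last)) * P.beta m : T) = P.beta m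
        rw [← mul_one (_ * P.beta m), ← TrivSqZeroExt.inl_one, inl_mul_beta_mul_inl]
        refine congrArg TrivSqZeroExt.inr (TrivialExtension.form_inj fun x => ?_)
        change P.coef m.1 (1 * (x * _)) = P.coef m.1 x
        rw [one_mul, P.coef_mul_triv m.2.1])
    (by
      rintro (a | m)
      · change (TrivSqZeroExt.inl (P.π _) * TrivSqZeroExt.inl (P.π _) : T) = _
        rw [hl]
        exact congrArg _ (congrArg _ (ofPath_mul_triv (QPath.single a)))
      · change (P.beta m * TrivSqZeroExt.inl (P.path (QPath.triv m.1.first)) : T) = P.beta m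
        rw [← one_mul (P.beta m), ← TrivSqZeroExt.inl_one, inl_mul_beta_mul_inl,
          TrivSqZeroExt.inl_one, one_mul]
        refine congrArg TrivSqZeroExt.inr (TrivialExtension.form_inj fun x => ?_)
        change P.coef m.1 (_ * (x * 1)) = P.coef m.1 x
        rw [mul_one, P.coef_triv_mul m.2.1])
  refine ⟨F, fun p => ?_, fun m => h2 _⟩
  obtain ⟨v, l, hl'⟩ := p
  induction l generalizing v with
  | nil => exact h1 v
  | cons a l ih =>
    obtain ⟨q, hq, rfl, h⟩ := QPath.exists_cons (p := ⟨v, a :: l, hl'⟩) rfl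
    have h3 : (QPath.single (P.inc.onE a)).last = (P.inc.mapPath q).first := hq
    have h4 : P.inc.mapPath ((QPath.single a).comp q hq) =
        (QPath.single (P.inc.onE a)).comp (P.inc.mapPath q) h3 := rfl
    rw [h, h4, ofPath_comp, map_mul, ih _ q.isWalk, ofPath_single, h2, path_comp,
      TrivSqZeroExt.inl_mul]
    rfl

/-- The presentation of the trivial extension. -/
def extHom : PathAlgebra K P.extQuiver →ₐ[K] TrivialExtension K A := P.exists_extHom.choose

theorem extHom_mapPath (p : P.quiver.QPath) :
    P.extHom (ofPath K (P.inc.mapPath p)) = TrivSqZeroExt.inl (P.path p) :=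
  P.exists_extHom.choose_spec.1 p

theorem extHom_newArrow (m : P.MaxPath) : P.extHom (ofArrow K (P.newArrow m)) = P.beta m :=
  P.exists_extHom.choose_spec.2 m

/-! ### The dual basis inside the trivial extension -/

-- The factors `u` and `w` can be cancelled: `u q w = u p w` only for `q = p`.
open Classical in
theorem coef_path_mul_path_mul_path {u p w : P.quiver.QPath} (h' : p.last = w.first)
    (h : u.last = (p.comp w h').first) (hm : P.path (u.comp (p.comp w h') h) ≠ 0)
    (q : P.quiver.QPath) :
    P.coef (u.comp (p.comp w h') h) (P.path u * (P.path q * P.path w)) =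
      if q = p then 1 else 0 := by
  by_cases h1 : q.last = w.first
  · by_cases h2 : u.last = (q.comp w h1).first
    · rw [← path_comp _ _ _ h1, ← path_comp _ _ _ h2, P.coef_path hm]
      congr 1
      refine propext ⟨fun e => ?_, fun e => by subst e; rfl⟩
      have := congrArg QPath.arrows e
      simp only [QPath.arrows_comp] at this
      exact QPath.ext (h2.symm.trans h) (List.append_cancel_right (List.append_cancel_left this))
    · rw [← path_comp _ _ _ h1, P.path_mul_path_of_ne h2, map_zero, if_neg]
      rintro rfl
      exact h2 h
  · rw [P.path_mul_path_of_ne h1, mul_zero, map_zero, if_neg]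
    rintro rfl
    exact h1 h'

/-- Choose a maximal path `m = u p w`. The form `w β_m u` sends `x` to `m^∨(u x w)`, which picks out
`p` among the paths. Hence the `β_m` generate `D(A)` as a bimodule. -/
theorem exists_inr_coef_eq {p : P.quiver.QPath} (hp : P.path p ≠ 0) :
    ∃ (m : P.MaxPath) (u w : P.quiver.QPath),
      (TrivSqZeroExt.inr (DualBimodule.of K (P.coef p)) : TrivialExtension K A) =
        TrivSqZeroExt.inl (P.path w) * P.beta m * TrivSqZeroExt.inl (P.path u) := by
  obtain ⟨u, w, h', h, hm⟩ := P.exists_isMaximalPath hp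
  refine ⟨⟨_, hm⟩, u, w, ?_⟩
  rw [inl_mul_beta_mul_inl]
  refine congrArg (fun f => TrivSqZeroExt.inr (DualBimodule.of K f)) (P.linearMap_ext fun q hq => ?_)
  rw [P.coef_path hp]
  exact (P.coef_path_mul_path_mul_path h' h hm.1 q).symm

theorem eq_sum_coef (f : A →ₗ[K] K) :
    f = ∑ p ∈ P.finite_nonzero_paths.toFinset, f (P.path p) • P.coef p := by
  classical
  apply P.linearMap_ext
  intro q hq
  rw [LinearMap.sum_apply, Finset.sum_eq_single q]
  · rw [LinearMap.smul_apply, P.coef_path hq, if_pos rfl, smul_eq_mul, mul_one]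
  · intro p hp hpq
    have hp' : P.path p ≠ 0 := by simpa using hp
    rw [LinearMap.smul_apply, P.coef_path hp', if_neg (Ne.symm hpq), smul_zero]
  · intro h
    exact absurd (P.finite_nonzero_paths.mem_toFinset.2 hq) h

theorem inr_eq_sum (f : A →ₗ[K] K) :
    (TrivSqZeroExt.inr (DualBimodule.of K f) : TrivialExtension K A) =
      ∑ p ∈ P.finite_nonzero_paths.toFinset,
        f (P.path p) • TrivSqZeroExt.inr (DualBimodule.of K (P.coef p)) := by
  have h := congrArg (TrivSqZeroExt.inrHom A (DualBimodule K A)).toAddMonoidHom (P.eq_sum_coef f)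
  refine h.trans ((map_sum (TrivSqZeroExt.inrHom A (DualBimodule K A)).toAddMonoidHom
    (fun p => (f (P.path p) • P.coef p : DualBimodule K A)) _).trans ?_)
  exact Finset.sum_congr rfl fun p _ => TrivSqZeroExt.inr_smul A (f (P.path p)) _

theorem exists_extHom_eq_inl (a : A) : ∃ x, P.extHom x = TrivSqZeroExt.inl a := by
  obtain ⟨G, hG⟩ := exists_map (K := K) P.inc Function.bijective_id
  have : P.extHom.comp G = (TrivSqZeroExt.inlAlgHom K A (DualBimodule K A)).comp P.π := by
    apply algHom_ext
    intro p
    rw [AlgHom.comp_apply, hG, extHom_mapPath]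
    rfl
  obtain ⟨y, rfl⟩ := P.surjective a
  exact ⟨G y, AlgHom.congr_fun this y⟩

theorem extHom_surjective : Function.Surjective P.extHom := by
  have h1 : ∀ p, P.path p ≠ 0 →
      (TrivSqZeroExt.inr (DualBimodule.of K (P.coef p)) : TrivialExtension K A) ∈
        P.extHom.range := by
    intro p hp
    obtain ⟨m, u, w, e⟩ := P.exists_inr_coef_eq hp
    rw [e]
    exact mul_mem (mul_mem ⟨_, P.extHom_mapPath w⟩ ⟨_, P.extHom_newArrow m⟩)
      ⟨_, P.extHom_mapPath u⟩
  intro x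
  have h2 : x ∈ P.extHom.range := by
    rw [← TrivSqZeroExt.inl_fst_add_inr_snd_eq x]
    refine add_mem (P.exists_extHom_eq_inl x.fst) ?_
    have := P.inr_eq_sum x.snd.form
    change TrivSqZeroExt.inr (DualBimodule.of K x.snd.form) ∈ _
    rw [this]
    exact sum_mem fun p hp => Subalgebra.smul_mem _ (h1 p (by simpa using hp)) _
  exact h2

/-- The trivial extension modulo the new arrows is the algebra one started with. -/
theorem mem_span_newArrows_iff (x : TrivialExtension K A) :
    x ∈ TwoSidedIdeal.span P.newArrows ↔ x.fst = 0 := by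
  constructor
  · intro hx
    induction hx using TwoSidedIdeal.span_induction with
    | zero => rfl
    | add x y _ _ hx hy => rw [TrivSqZeroExt.fst_add, hx, hy, add_zero]
    | neg x _ hx => rw [TrivSqZeroExt.fst_neg, hx, neg_zero]
    | left_absorb a x _ hx => rw [TrivSqZeroExt.fst_mul, hx, mul_zero]
    | right_absorb a x _ hx => rw [TrivSqZeroExt.fst_mul, hx, zero_mul]
    | mem x hx =>
      obtain ⟨m, f, -, -, rfl⟩ := hx
      exact TrivSqZeroExt.fst_inr _ _
  · intro hx
    have hx' : x = TrivSqZeroExt.inr (DualBimodule.of K x.snd.form) :=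
      TrivSqZeroExt.ext hx rfl
    rw [hx', P.inr_eq_sum]
    refine sum_mem fun p hp => ?_
    obtain ⟨m, u, w, e⟩ := P.exists_inr_coef_eq (p := p) (by simpa using hp)
    rw [e, Algebra.smul_def]
    refine TwoSidedIdeal.mul_mem_left _ _ _ (TwoSidedIdeal.mul_mem_right _ _ _
      (TwoSidedIdeal.mul_mem_left _ _ _ (TwoSidedIdeal.subset_span ?_)))
    exact (P.mem_newArrows_iff _).2 ⟨m.1, m.2, rfl⟩

theorem nonempty_cutAlgebra_equiv :
    Nonempty (CutAlgebra (TrivialExtension K A) P.newArrows ≃ₐ[K] A) := by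
  obtain ⟨e, -⟩ := exists_algEquiv_of_ker_iff
    (RingCon.mkₐ (α := K) (TwoSidedIdeal.span P.newArrows).ringCon)
    (RingCon.mkₐ_surjective _) (TrivSqZeroExt.fstHom K A (DualBimodule K A))
    TrivSqZeroExt.fst_surjective fun x => by
      rw [ker_mkₐ, mem_span_newArrows_iff]
      rfl
  exact ⟨e⟩

end AlmostGentlePresentation

end AlmostGentle

/-! ### The cycles of the trivial extension -/

namespace AlmostGentle

open FinQuiver PathAlgebra

variable {K : Type u} [Field K]

/-- A property of lists that is stable under moving the first entry to the end is stable under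
rotation. -/
theorem of_isRotated {α : Type*} {p : List α → Prop} (h : ∀ a l, p (a :: l) → p (l ++ [a]))
    {l l' : List α} (hl : p l) (hr : l.IsRotated l') : p l' := by
  obtain ⟨n, rfl⟩ := hr
  induction n with
  | zero => rwa [List.rotate_zero]
  | succ n ih =>
    rw [← List.rotate_rotate]
    match e : l.rotate n with
    | [] => rwa [List.rotate_nil, ← e]
    | a :: t =>
      rw [List.rotate_cons_succ, List.rotate_zero]
      exact h _ _ (e ▸ ih)

/-- The first entry from the right summand determines the decomposition of a list. -/
theorem map_inl_append_inr_inj {α β : Type*} {W W' : List α} {m m' : β} {Z Z' : List (α ⊕ β)}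
    (h : W.map Sum.inl ++ Sum.inr m :: Z = W'.map Sum.inl ++ Sum.inr m' :: Z') :
    W = W' ∧ m = m' ∧ Z = Z' := by
  induction W generalizing W' with
  | nil =>
    cases W' with
    | nil => simpa using h
    | cons a W' => simp at h
  | cons a W ih =>
    cases W' with
    | nil => simp at h
    | cons b W' =>
      simp only [List.map_cons, List.cons_append, List.cons.injEq, Sum.inl.injEq] at h
      obtain ⟨rfl, h⟩ := h
      obtain ⟨rfl, h'⟩ := ih h
      exact ⟨rfl, h'⟩

theorem eq_map_inl_or_exists {α β : Type*} (l : List (α ⊕ β)) :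
    (∃ W : List α, l = W.map Sum.inl) ∨ ∃ (W : List α) (m : β) (Z : List (α ⊕ β)),
      l = W.map Sum.inl ++ Sum.inr m :: Z := by
  induction l with
  | nil => exact Or.inl ⟨[], rfl⟩
  | cons x l ih =>
    rcases x with a | m
    · rcases ih with ⟨W, rfl⟩ | ⟨W, m, Z, rfl⟩
      · exact Or.inl ⟨a :: W, rfl⟩
      · exact Or.inr ⟨a :: W, m, Z, rfl⟩
    · exact Or.inr ⟨[], m, l, rfl⟩

namespace AlmostGentlePresentation

variable {A : Type u} [Ring A] [Algebra K A] (P : AlmostGentlePresentation K A)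

/-- The words of the cycles of the trivial extension: rotations of `m β_m`, where `m` is a maximal
path. -/
def IsExtWord (l : List P.extQuiver.E) : Prop :=
  ∃ (m : P.MaxPath) (W U : List P.quiver.E),
    l = W.map Sum.inl ++ Sum.inr m :: U.map Sum.inl ∧ U ++ W = m.1.arrows

/-- The cycles of the trivial extension. -/
def extCycles : Set P.extQuiver.QPath := {C | P.IsExtWord C.arrows}

variable {P}

theorem IsExtWord.of_isRotated {l l' : List P.extQuiver.E} (h : P.IsExtWord l)
    (h' : l.IsRotated l') : P.IsExtWord l' := by
  refine AlmostGentle.of_isRotated ?_ h h'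
  rintro a l ⟨m, W, U, e, hm⟩
  rcases W with _ | ⟨b, W⟩
  · simp only [List.map_nil, List.nil_append, List.cons.injEq] at e
    obtain ⟨rfl, rfl⟩ := e
    exact ⟨m, U, [], rfl, by simpa using hm⟩
  · simp only [List.map_cons, List.cons_append, List.cons.injEq] at e
    obtain ⟨rfl, rfl⟩ := e
    exact ⟨m, W, U ++ [b], by simp, by simpa using hm⟩

theorem isRotated_extWord {m : P.MaxPath} {W U : List P.quiver.E} (h : U ++ W = m.1.arrows) :
    (W.map Sum.inl ++ Sum.inr m :: U.map Sum.inl : List P.extQuiver.E).IsRotated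
      (Sum.inr m :: m.1.arrows.map Sum.inl) := by
  have : (Sum.inr m :: m.1.arrows.map Sum.inl : List (P.quiver.E ⊕ P.MaxPath)) =
      (Sum.inr m :: U.map Sum.inl) ++ W.map Sum.inl := by
    rw [← h]
    simp
  rw [this]
  exact List.isRotated_append

theorem IsExtWord.nodup {l : List P.extQuiver.E} (h : P.IsExtWord l) : l.Nodup := by
  obtain ⟨m, W, U, rfl, hm⟩ := h
  rw [(isRotated_extWord hm).nodup_iff]
  refine List.nodup_cons.2 ⟨by simp, m.2.nodup.map Sum.inl_injective⟩

/-- A list of arrows does not remember the vertex of a trivial path, so the endpoints of `m` have to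
be used when `w` is trivial. -/
theorem last_eq_first_of_append {m u w : P.quiver.QPath} (hu : u.first = m.first)
    (hw : w.last = m.last) (h : u.arrows ++ w.arrows = m.arrows) : u.last = w.first := by
  obtain ⟨u', w', h', h1, h2, rfl⟩ := QPath.exists_comp_of_arrows_eq m h.symm
  obtain rfl : u' = u := QPath.ext hu.symm h1
  by_cases hn : w.arrows = []
  · rw [← QPath.last_of_nil hn, hw, QPath.last_comp, QPath.last_of_nil (h2.trans hn), h']
  · rw [h', QPath.eq_of_arrows_eq h2 (h2 ▸ hn)]

variable (P)

/-- A path with a new arrow, cut at its first new arrow. -/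
theorem exists_split {p : P.extQuiver.QPath} {W : List P.quiver.E} {m : P.MaxPath}
    {Z : List P.extQuiver.E} (h : p.arrows = W.map Sum.inl ++ Sum.inr m :: Z) :
    ∃ (w : P.quiver.QPath) (z : P.extQuiver.QPath), w.arrows = W ∧ z.arrows = Z ∧
      w.last = m.1.last ∧ z.first = m.1.first ∧ p.first = w.first ∧ p.last = z.last ∧
      ofPath K p = ofPath K (P.inc.mapPath w) * ofArrow K (P.newArrow m) * ofPath K z := by
  obtain ⟨w', q, h1, h2, h3, rfl⟩ := QPath.exists_comp_of_arrows_eq p h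
  obtain ⟨w, hw, rfl⟩ := P.inc.exists_mapPath_eq Function.bijective_id w' W h2
  obtain ⟨z, h4, h5, rfl⟩ := QPath.exists_cons h3
  refine ⟨w, z, hw, h5, ?_, h4.symm, rfl, ?_, ?_⟩
  · have := h1
    rw [Hom.last_mapPath] at this
    exact this
  · rw [QPath.last_comp, QPath.last_comp]
  · rw [ofPath_comp, ofPath_comp, mul_assoc]
    rfl

/-- Cutting a maximal path into `u` and `w` gives the cycle `w β_m u`, based at the cutting point.
The choice of the cut produces cycles at every vertex and through every old or new arrow. -/
theorem exists_extCycle (u w : P.quiver.QPath) (h : u.last = w.first)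
    (hm : P.IsMaximalPath (u.comp w h)) :
    ∃ C ∈ P.extCycles, C.first = w.first ∧
      C.arrows = w.arrows.map Sum.inl ++ Sum.inr ⟨_, hm⟩ :: u.arrows.map Sum.inl := by
  let m : P.MaxPath := ⟨_, hm⟩
  have h1 : (QPath.single (P.newArrow m)).last = (P.inc.mapPath u).first := rfl
  have h2 : (P.inc.mapPath w).last = ((QPath.single (P.newArrow m)).comp _ h1).first := by
    rw [Hom.last_mapPath]
    exact (QPath.last_comp u w h).symm
  exact ⟨(P.inc.mapPath w).comp _ h2, ⟨m, w.arrows, u.arrows, rfl, rfl⟩, rfl, rfl⟩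

theorem exists_extCycle_at (v : P.extQuiver.V) : ∃ C ∈ P.extCycles, C.first = v := by
  obtain ⟨u, w, h', h, hm⟩ := P.exists_isMaximalPath (P.path_triv_ne_zero v)
  obtain ⟨C, hC, hv, -⟩ := P.exists_extCycle _ _ h hm
  exact ⟨C, hC, hv⟩

theorem exists_extCycle_inl (a : P.quiver.E) :
    ∃ C ∈ P.extCycles, (Sum.inl a : P.quiver.E ⊕ P.MaxPath) ∈ C.arrows := by
  obtain ⟨u, w, h', h, hm⟩ := P.exists_isMaximalPath (p := QPath.single a) (P.arrow_ne_zero a)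
  obtain ⟨C, hC, -, e⟩ := P.exists_extCycle _ _ h hm
  refine ⟨C, hC, ?_⟩
  rw [e]
  exact List.mem_append_left _ (List.mem_map_of_mem (List.mem_append_left _ List.mem_cons_self))

theorem exists_extCycle_inr (m : P.MaxPath) :
    ∃ C ∈ P.extCycles, (Sum.inr m : P.quiver.E ⊕ P.MaxPath) ∈ C.arrows := by
  have h : m.1.last = (QPath.triv (Q := P.quiver) m.1.last).first := rfl
  have e : m.1.comp _ h = m.1 := QPath.comp_triv _ _
  obtain ⟨C, hC, -, e'⟩ := P.exists_extCycle _ _ h (by rw [e]; exact m.2)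
  refine ⟨C, hC, ?_⟩
  rw [e']
  refine List.mem_append_right _ (List.mem_cons.2 (Or.inl ?_))
  exact congrArg Sum.inr (Subtype.ext e.symm)

/-- The only new arrow that can be a loop special cycle belongs to the quiver without arrows. -/
theorem subsingleton_of_loop (hA : IsIndecomposable A) {m : P.MaxPath} (hm : m.1.arrows = []) :
    Subsingleton P.extQuiver.E := by
  have h := (P.isMaximalPath_iff m.1).1 m.2
  rw [hm] at h
  have hsrc : ∀ a, P.quiver.src a ≠ m.1.first := fun a ha =>
    h.2.2 a ((QPath.last_of_nil hm).trans ha.symm) (List.isChain_singleton a)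
  have htgt : ∀ a, P.quiver.tgt a ≠ m.1.first := fun a ha =>
    h.2.1 a ha (List.isChain_singleton a)
  have hV := eq_of_isolated hA P.π P.surjective P.admissible hsrc htgt
  have hE : ∀ a : P.quiver.E, False := fun a => hsrc a (hV _)
  refine ⟨?_⟩
  rintro (a | m₁) (b | m₂)
  · exact (hE a).elim
  · exact (hE a).elim
  · exact (hE b).elim
  · have key : ∀ p : P.quiver.QPath, p = QPath.triv m.1.first := by
      intro p
      match e : p.arrows with
      | [] => rw [QPath.eq_triv e, hV p.first]
      | a :: _ => exact (hE a).elim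
    exact congrArg Sum.inr (Subtype.ext ((key _).trans (key _).symm))

theorem isDefiningPair_extCycles (hA : IsIndecomposable A) :
    IsDefiningPair P.extCycles (fun _ => 1) where
  simple C hC := by
    refine ⟨?_, ?_, hC.nodup⟩
    · obtain ⟨m, W, U, e, -⟩ := hC
      simp [e]
    · obtain ⟨m, W, U, e, hm⟩ := hC
      obtain ⟨w, z, rfl, hz, h1, h2, h3, h4, -⟩ := P.exists_split (p := C) e
      obtain ⟨u, rfl, rfl⟩ := P.inc.exists_mapPath_eq Function.bijective_id z U hz
      rw [h4, h3, Hom.last_mapPath]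
      exact last_eq_first_of_append h2 h1 hm
  pos _ _ := one_pos
  loop C hC h hE := by
    obtain ⟨m, W, U, e, hm⟩ := hC
    rw [QPath.length, e] at h
    simp only [List.length_append, List.length_map, List.length_cons] at h
    have hW : W = [] := List.eq_nil_of_length_eq_zero (by omega)
    have hU : U = [] := List.eq_nil_of_length_eq_zero (by omega)
    have := P.subsingleton_of_loop hA (m := m) (by rw [← hm, hW, hU]; rfl)
    exact absurd hE (not_nontrivial_iff_subsingleton.2 this)
  rotate C hC C' h := hC.of_isRotated h.symm
  mult_rotate _ _ _ _ := rfl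
  cover a := by
    rcases a with a | m
    · exact P.exists_extCycle_inl a
    · exact P.exists_extCycle_inr m
  unique a C hC C' hC' ha ha' := by
    obtain ⟨m, W, U, e, hm⟩ := hC
    obtain ⟨m', W', U', e', hm'⟩ := hC'
    have h1 := isRotated_extWord hm
    have h2 := isRotated_extWord hm'
    rw [← e] at h1
    rw [← e'] at h2
    rw [h1.mem_iff] at ha
    rw [h2.mem_iff] at ha'
    have : m = m' := by
      rcases a with a | n
      · simp only [List.mem_cons, reduceCtorEq, List.mem_map, Sum.inl.injEq, exists_eq_right,
          false_or] at ha ha'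
        exact Subtype.ext (m.2.eq_of_mem m'.2 ha ha')
      · simp only [List.mem_cons, List.mem_map, reduceCtorEq, and_false, exists_false,
          or_false, Sum.inr.injEq] at ha ha'
        exact ha.symm.trans ha'
    subst this
    exact h2.trans h1.symm

/-! ### The symmetrizing form on paths and the relations of the trivial extension -/

/-- Paths through a new arrow are mapped to the dual bimodule. -/
theorem fst_extHom_eq_zero {z : P.extQuiver.QPath} {W : List P.quiver.E} {m : P.MaxPath}
    {Z : List P.extQuiver.E} (h : z.arrows = W.map Sum.inl ++ Sum.inr m :: Z) :
    (P.extHom (ofPath K z)).fst = 0 := by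
  obtain ⟨w, z', -, -, -, -, -, -, e⟩ := P.exists_split h
  rw [e, map_mul, map_mul, extHom_newArrow, TrivSqZeroExt.fst_mul, TrivSqZeroExt.fst_mul, beta,
    TrivSqZeroExt.fst_inr, mul_zero, zero_mul]

/-- The symmetrizing form of the trivial extension is one on the cycles, and zero on all other
paths. -/
theorem trace_extHom (x : PathAlgebra K P.extQuiver) :
    TrivialExtension.trace K A (P.extHom x) = cycleTrace K P.extCycles x := by
  classical
  have : TrivialExtension.trace K A ∘ₗ P.extHom.toLinearMap = cycleTrace K P.extCycles := by
    apply PathAlgebra.linearMap_ext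
    intro p
    change TrivialExtension.trace K A (P.extHom (ofPath K p)) = _
    rw [cycleTrace_ofPath]
    rcases eq_map_inl_or_exists (α := P.quiver.E) (β := P.MaxPath) p.arrows with
      ⟨W, e⟩ | ⟨W, m, Z, e⟩
    · obtain ⟨w, hw, rfl⟩ := P.inc.exists_mapPath_eq Function.bijective_id p W e
      rw [extHom_mapPath, if_neg]
      · rfl
      · rintro ⟨m, W', U, e', -⟩
        have h1 : (Sum.inr m : P.quiver.E ⊕ P.MaxPath) ∈ W.map Sum.inl := by
          rw [← e, e']
          exact List.mem_append_right _ List.mem_cons_self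
        simp at h1
    · obtain ⟨w, z, hw, hz, h1, h2, -, h4, h5⟩ := P.exists_split e
      rw [h5, map_mul P.extHom, map_mul P.extHom, extHom_mapPath, extHom_newArrow]
      rcases eq_map_inl_or_exists (α := P.quiver.E) (β := P.MaxPath) Z with
        ⟨U, rfl⟩ | ⟨W', m', Z', rfl⟩
      · obtain ⟨u, hu, rfl⟩ := P.inc.exists_mapPath_eq Function.bijective_id z U hz
        rw [extHom_mapPath, inl_mul_beta_mul_inl]
        change P.coef m.1 (P.path u * (1 * P.path w)) = _
        -- For a path `w β_m u` with one new arrow the trace is `m^∨(u w)`, which is one exactly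
        -- when `u w = m`.
        rw [one_mul]
        have key : p ∈ P.extCycles ↔ U ++ W = m.1.arrows := by
          constructor
          · rintro ⟨m', W', U', e', hm'⟩
            obtain ⟨rfl, rfl, e''⟩ := map_inl_append_inr_inj (e.symm.trans e')
            rwa [List.map_injective_iff.2 Sum.inl_injective e'']
          · exact fun h => ⟨m, W, U, e, h⟩
        simp only [key]
        by_cases hc : u.last = w.first
        · rw [← path_comp _ _ _ hc, P.coef_path m.2.1]
          congr 1
          refine propext ⟨fun h => ?_, fun h => QPath.ext h2 ?_⟩
          · rw [← h, QPath.arrows_comp, hu, hw]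
          · rw [← h, QPath.arrows_comp, hu, hw]
        · rw [P.path_mul_path_of_ne hc, map_zero, if_neg]
          intro h
          exact hc (last_eq_first_of_append h2 h1 (by rw [hu, hw, h]))
      -- With two new arrows both factors lie in `D(A)`, and their product is zero.
      · rw [TrivialExtension.trace_mul, P.fst_extHom_eq_zero hz, map_zero, add_zero, if_neg]
        · rw [TrivSqZeroExt.fst_mul, beta, TrivSqZeroExt.fst_inr, mul_zero, map_zero]
        · rintro ⟨m₂, W₂, U₂, e₂, -⟩
          obtain ⟨-, -, e₃⟩ := map_inl_append_inr_inj (e.symm.trans e₂)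
          have h1 : (Sum.inr m' : P.quiver.E ⊕ P.MaxPath) ∈ U₂.map Sum.inl := by
            rw [← e₃]
            exact List.mem_append_right _ List.mem_cons_self
          simp at h1
  exact LinearMap.congr_fun this x

/-- Nondegeneracy of the form on `T(A)` makes the kernel the radical of the pulled back form. -/
theorem extHom_eq_zero_iff (x : PathAlgebra K P.extQuiver) :
    P.extHom x = 0 ↔ ∀ q, cycleTrace K P.extCycles (x * ofPath K q) = 0 := by
  constructor
  · intro h q
    rw [← trace_extHom, map_mul, h, zero_mul, map_zero]
  · intro h
    apply TrivialExtension.eq_zero_of_trace_mul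
    intro y
    obtain ⟨y, rfl⟩ := P.extHom_surjective y
    rw [← map_mul, trace_extHom]
    induction y using PathAlgebra.induction with
    | zero => simp
    | add y y' hy hy' => rw [mul_add, map_add, hy, hy', add_zero]
    | path c p => rw [mul_smul_comm, map_smul, h, smul_zero]

theorem ker_extHom (hA : IsIndecomposable A) :
    TwoSidedIdeal.ker P.extHom =
      TwoSidedIdeal.span {x | CycleRelation K P.extCycles (fun _ => 1) x} := by
  apply TwoSidedIdeal.ext
  intro x
  rw [TwoSidedIdeal.mem_ker, extHom_eq_zero_iff,
    (P.isDefiningPair_extCycles hA).mem_span_iff (fun _ _ => rfl) P.exists_extCycle_at]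

theorem newArrows_eq_image :
    P.newArrows = (fun a => P.extHom (ofArrow K a)) '' Set.range P.newArrow := by
  ext x
  rw [mem_newArrows_iff]
  constructor
  · rintro ⟨m, hm, rfl⟩
    exact ⟨_, ⟨⟨m, hm⟩, rfl⟩, P.extHom_newArrow ⟨m, hm⟩⟩
  · rintro ⟨_, ⟨m, rfl⟩, rfl⟩
    exact ⟨m.1, m.2, P.extHom_newArrow m⟩

theorem isAdmissibleCut_extCycles :
    IsAdmissibleCut P.extCycles (Set.range P.newArrow) := by
  rintro C ⟨m, W, U, e, hm⟩
  refine ⟨P.newArrow m, ⟨⟨m, rfl⟩, ?_⟩, ?_⟩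
  · rw [e]
    exact List.mem_append_right _ List.mem_cons_self
  · rintro _ ⟨⟨m', rfl⟩, h⟩
    rw [e] at h
    rcases List.mem_append.1 h with h | h
    · obtain ⟨a, -, h⟩ := List.mem_map.1 h
      exact absurd h Sum.inl_ne_inr
    · rcases List.mem_cons.1 h with h | h
      · exact h
      · obtain ⟨a, -, h⟩ := List.mem_map.1 h
        exact absurd h Sum.inl_ne_inr

/-- The trivial extension of an almost gentle algebra, with the cut given by the new arrows. -/
theorem isCutPair (hA : IsIndecomposable A) :
    IsCutPair K (TrivialExtension K A) P.newArrows := by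
  have hS := P.isDefiningPair_extCycles hA
  refine ⟨TrivialExtension.isIndecomposable hA, TrivialExtension.isSymmetricAlgebra, P.extQuiver,
    P.extHom, P.extCycles, fun _ => 1, Set.range P.newArrow, ?_, P.extHom_surjective, ?_, ?_, hS,
    fun _ _ => rfl, P.ker_extHom hA, P.isAdmissibleCut_extCycles, P.newArrows_eq_image⟩
  · have hV : Nonempty P.quiver.V := by
      by_contra hV
      rw [not_nonempty_iff] at hV
      have h0 : (1 : PathAlgebra K P.quiver) = 0 := by
        rw [one_def]
        exact Finset.sum_of_isEmpty _
      have := hA.1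
      apply zero_ne_one (α := A)
      rw [← map_one P.π, h0, map_zero]
    obtain ⟨v⟩ := hV
    obtain ⟨u, w, h', h, hm⟩ := P.exists_isMaximalPath (P.path_triv_ne_zero v)
    exact ⟨P.newArrow ⟨_, hm⟩⟩
  · rw [P.ker_extHom hA]
    exact hS.isAdmissible (fun _ _ => rfl) P.exists_extCycle_at
  · rw [P.ker_extHom hA]
    exact hS.isSpecialMultiserial (fun _ _ => rfl)

end AlmostGentlePresentation

end AlmostGentle

/-! ### Recovering the quiver with relations from the algebra -/

namespace AlmostGentle

open FinQuiver PathAlgebra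

variable {K : Type u} [Field K]

/-- The determinant is nonzero, so some term of its expansion over permutations is nonzero, and all
entries in that term are. -/
theorem exists_equiv_of_mul_eq_one {m n : Type*} [Fintype m] [Fintype n] [DecidableEq m]
    [DecidableEq n] {G : Matrix m n K} {H : Matrix n m K} (h : G * H = 1) (h' : H * G = 1) :
    ∃ τ : m ≃ n, ∀ a, G a (τ a) ≠ 0 := by
  have hc := Matrix.square_of_invertible G H h h'
  let e : m ≃ n := Fintype.equivOfCardEq hc
  have h1 : G.submatrix id e * H.submatrix e id = 1 := by
    rw [Matrix.submatrix_mul_equiv, h, Matrix.submatrix_id_id]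
  have h2 : (G.submatrix id e).det ≠ 0 := (Matrix.isUnit_det_of_right_inverse h1).ne_zero
  rw [Matrix.det_apply] at h2
  obtain ⟨σ, -, hσ⟩ := Finset.exists_ne_zero_of_sum_ne_zero h2
  have h3 : ∏ i, G.submatrix id e (σ i) i ≠ 0 := by
    intro h0
    rw [h0, smul_zero] at hσ
    exact hσ rfl
  rw [Finset.prod_ne_zero_iff] at h3
  refine ⟨σ.symm.trans e, fun a => ?_⟩
  have := h3 (σ.symm a) (Finset.mem_univ _)
  simpa using this

namespace FinQuiver.QPath

variable {Q : FinQuiver}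

/-- The initial part of a path. -/
def take (r : Q.QPath) (i : ℕ) : Q.QPath :=
  ⟨r.first, r.arrows.take i, by
    have := r.isWalk
    rw [← List.take_append_drop i r.arrows, isWalk_append] at this
    exact this.1⟩

/-- The remaining part of a path. -/
def drop (r : Q.QPath) (i : ℕ) : Q.QPath :=
  ⟨Q.walkEnd r.first (r.arrows.take i), r.arrows.drop i, by
    have := r.isWalk
    rw [← List.take_append_drop i r.arrows, isWalk_append] at this
    exact this.2⟩

theorem last_take (r : Q.QPath) (i : ℕ) : (r.take i).last = (r.drop i).first := rfl

theorem take_comp_drop (r : Q.QPath) (i : ℕ) : (r.take i).comp (r.drop i) (last_take r i) = r :=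
  QPath.ext rfl (List.take_append_drop i r.arrows)

theorem comp_eq_iff {p q r : Q.QPath} (h : p.last = q.first) :
    p.comp q h = r ↔ p = r.take p.length ∧ q = r.drop p.length := by
  constructor
  · rintro rfl
    have h1 : p = (p.comp q h).take p.length :=
      QPath.ext rfl (List.take_left (l₁ := p.arrows) (l₂ := q.arrows)).symm
    refine ⟨h1, QPath.ext ?_ (List.drop_left (l₁ := p.arrows) (l₂ := q.arrows)).symm⟩
    rw [← last_take, ← h1, h]
  · generalize p.length = i
    rintro ⟨rfl, rfl⟩
    exact take_comp_drop r i

end FinQuiver.QPath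

namespace AlmostGentlePresentation

variable {A : Type u} [Ring A] [Algebra K A] (P : AlmostGentlePresentation K A)

theorem induction {motive : A → Prop} (x : A) (zero : motive 0)
    (add : ∀ x y, motive x → motive y → motive (x + y))
    (path : ∀ (c : K) p, motive (c • P.path p)) : motive x := by
  obtain ⟨x, rfl⟩ := P.surjective x
  induction x using PathAlgebra.induction with
  | zero => rwa [map_zero]
  | add x y hx hy => rw [map_add]; exact add _ _ hx hy
  | path c p => rw [map_smul]; exact path c p

/-- The coefficient of a path in a product. -/
theorem coef_mul {r : P.quiver.QPath} (hr : P.path r ≠ 0) (x y : A) :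
    P.coef r (x * y) =
      ∑ i ∈ Finset.range (r.length + 1), P.coef (r.take i) x * P.coef (r.drop i) y := by
  classical
  have hc := (P.path_ne_zero_iff r).1 hr
  have ht : ∀ i, P.path (r.take i) ≠ 0 := fun i =>
    (P.path_ne_zero_iff _).2 (hc.infix (List.take_prefix i r.arrows).isInfix)
  have hd : ∀ i, P.path (r.drop i) ≠ 0 := fun i =>
    (P.path_ne_zero_iff _).2 (hc.infix (List.drop_suffix i r.arrows).isInfix)
  induction x using P.induction with
  | zero => simp
  | add x x' hx hx' => simp only [add_mul, map_add, hx, hx', Finset.sum_add_distrib]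
  | path c p =>
    induction y using P.induction with
    | zero => simp
    | add y y' hy hy' => simp only [mul_add, map_add, hy, hy', Finset.sum_add_distrib]
    | path d q =>
      simp only [smul_mul_assoc, mul_smul_comm, map_smul, ← Finset.smul_sum]
      congr 2
      simp only [P.coef_path (ht _), P.coef_path (hd _), ← ite_and, mul_ite, mul_one, mul_zero]
      by_cases h : p.last = q.first
      · rw [← P.path_comp p q h, P.coef_path hr]
        by_cases hpq : p.comp q h = r
        -- Only the cut after `p.length` arrows contributes. The range ends at `r.length`, since
        -- larger indices would repeat the cut at the end of `r`.
        · rw [if_pos hpq, Finset.sum_eq_single p.length]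
          · rw [if_pos]
            obtain ⟨h1, h2⟩ := (QPath.comp_eq_iff h).1 hpq
            exact ⟨h2, h1⟩
          · intro i hi hne
            rw [if_neg]
            rintro ⟨-, rfl⟩
            apply hne
            simp only [QPath.length, QPath.take, List.length_take]
            have : i < r.arrows.length + 1 := Finset.mem_range.1 hi
            omega
          · intro hn
            rw [Finset.mem_range] at hn
            have : r.length = p.length + q.length := by
              rw [← hpq]
              exact List.length_append
            omega
        · rw [if_neg hpq, Finset.sum_eq_zero]
          intro i _
          rw [if_neg]
          rintro ⟨rfl, rfl⟩
          exact hpq (QPath.take_comp_drop r i)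
      · rw [P.path_mul_path_of_ne h, map_zero, Finset.sum_eq_zero]
        intro i _
        rw [if_neg]
        rintro ⟨rfl, rfl⟩
        exact h (QPath.last_take r i)

/-- The character that belongs to a vertex. -/
def char (v : P.quiver.V) : A →ₗ[K] K := P.coef (QPath.triv v)

/-- The coefficient of an arrow. -/
def arrowCoef (a : P.quiver.E) : A →ₗ[K] K := P.coef (QPath.single a)

theorem char_mul (v : P.quiver.V) (x y : A) : P.char v (x * y) = P.char v x * P.char v y := by
  rw [char, P.coef_mul (P.path_triv_ne_zero v)]
  exact Finset.sum_range_one _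

/-- An arrow can only be cut at its ends, which gives a Leibniz rule relative to the characters of
its source and target. -/
theorem arrowCoef_mul (a : P.quiver.E) (x y : A) :
    P.arrowCoef a (x * y) = P.char (P.quiver.src a) x * P.arrowCoef a y +
      P.arrowCoef a x * P.char (P.quiver.tgt a) y := by
  rw [arrowCoef, P.coef_mul (r := QPath.single a) (P.arrow_ne_zero a)]
  exact (Finset.sum_range_succ _ 1).trans (congrArg (· + _) (Finset.sum_range_one _))

open Classical in
theorem char_path (v : P.quiver.V) (p : P.quiver.QPath) :
    P.char v (P.path p) = if p = QPath.triv v then 1 else 0 :=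
  P.coef_path (P.path_triv_ne_zero v) p

open Classical in
theorem arrowCoef_path (a : P.quiver.E) (p : P.quiver.QPath) :
    P.arrowCoef a (P.path p) = if p = QPath.single a then 1 else 0 :=
  P.coef_path (P.arrow_ne_zero a) p

theorem sum_path_triv : ∑ v, P.path (QPath.triv v) = 1 := by
  rw [← map_one P.π, one_def, map_sum]
  rfl

theorem char_one (v : P.quiver.V) : P.char v 1 = 1 := by
  classical
  rw [← P.sum_path_triv, map_sum, Finset.sum_eq_single v]
  · rw [char_path, if_pos rfl]
  · intro w _ hw
    rw [char_path, if_neg]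
    exact fun h => hw (congrArg QPath.first h)
  · simp

theorem char_injective : Function.Injective P.char := by
  classical
  intro v w h
  have := LinearMap.congr_fun h (P.path (QPath.triv v))
  rw [char_path, char_path, if_pos rfl] at this
  by_contra hne
  rw [if_neg fun e => hne (congrArg QPath.first e)] at this
  exact one_ne_zero this

/-- A nonzero square, even of a loop, would be part of a maximal path with a repeated arrow.
Consequently every character of any algebra of this kind kills the images of arrows under
homomorphisms. -/
theorem arrow_mul_self (a : P.quiver.E) : P.arrow a * P.arrow a = 0 := by
  by_contra h
  have h0 : P.Next a a := h
  have h1 := P.tgt_eq_src_of_next h0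
  let p : P.quiver.QPath := (QPath.single a).comp (QPath.single a) h1
  have hp : P.path p ≠ 0 := (P.path_comp (QPath.single a) (QPath.single a) h1).trans_ne h
  obtain ⟨u, w, h', h2, hm⟩ := P.exists_isMaximalPath hp
  have h3 := hm.nodup
  simp [p, QPath.comp, QPath.single, List.nodup_append] at h3

variable {A' : Type u} [Ring A'] [Algebra K A'] (P' : AlmostGentlePresentation K A')

theorem char_map_arrow (θ : A →ₐ[K] A') (w : P'.quiver.V) (a : P.quiver.E) :
    P'.char w (θ (P.arrow a)) = 0 := by
  have h : P'.char w (θ (P.arrow a)) * P'.char w (θ (P.arrow a)) = 0 := by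
    rw [← char_mul, ← map_mul, arrow_mul_self, map_zero, map_zero]
  exact mul_self_eq_zero.1 h

theorem char_map_path (θ : A →ₐ[K] A') (w : P'.quiver.V) {p : P.quiver.QPath}
    (hp : p.arrows ≠ []) : P'.char w (θ (P.path p)) = 0 := by
  match e : p.arrows with
  | [] => exact absurd e hp
  | a :: l =>
    obtain ⟨q, hq, -, rfl⟩ := QPath.exists_cons e
    rw [path_comp, path_single, map_mul, char_mul, char_map_arrow, zero_mul]

/-- The pulled back form is multiplicative and takes the value one at `1`, so it is nonzero on some
vertex idempotent. Orthogonality makes it zero on the others, and it vanishes on paths of positive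
length. -/
theorem exists_char_comp (θ : A →ₐ[K] A') (w : P'.quiver.V) :
    ∃ v, P'.char w ∘ₗ θ.toLinearMap = P.char v := by
  classical
  have h1 : ∑ v, P'.char w (θ (P.path (QPath.triv v))) ≠ 0 := by
    rw [← map_sum, ← map_sum, sum_path_triv, map_one, char_one]
    exact one_ne_zero
  obtain ⟨v, -, hv⟩ := Finset.exists_ne_zero_of_sum_ne_zero h1
  refine ⟨v, P.linearMap_ext fun p hp => ?_⟩
  rw [char_path]
  change P'.char w (θ (P.path p)) = _
  by_cases hn : p.arrows = []
  · rw [QPath.eq_triv hn]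
    by_cases h : p.first = v
    · rw [h, if_pos rfl]
      refine mul_left_cancel₀ hv ?_
      rw [← char_mul, ← map_mul, ← path_comp _ _ _ rfl, mul_one]
      rfl
    · rw [if_neg fun e => h (congrArg QPath.first e)]
      refine mul_left_cancel₀ hv ?_
      rw [← char_mul, ← map_mul, P.path_mul_path_of_ne (p := QPath.triv v), map_zero, map_zero,
        mul_zero]
      exact Ne.symm h
  · rw [char_map_path P P' θ w hn, if_neg]
    rintro rfl
    exact hn rfl

/-- The arrow coefficients of a homomorphism only depend on the images of vertices and arrows. -/
theorem arrowCoef_map (θ : A →ₐ[K] A') (c : P'.quiver.E) (y : A) :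
    P'.arrowCoef c (θ y) =
      ∑ v, P.char v y * P'.arrowCoef c (θ (P.path (QPath.triv v))) +
        ∑ a, P.arrowCoef a y * P'.arrowCoef c (θ (P.arrow a)) := by
  classical
  have : P'.arrowCoef c ∘ₗ θ.toLinearMap =
      ∑ v, P'.arrowCoef c (θ (P.path (QPath.triv v))) • P.char v +
        ∑ a, P'.arrowCoef c (θ (P.arrow a)) • P.arrowCoef a := by
    refine P.linearMap_ext fun p hp => ?_
    simp only [LinearMap.add_apply, LinearMap.sum_apply, LinearMap.smul_apply, char_path,
      arrowCoef_path, smul_eq_mul, mul_ite, mul_one, mul_zero]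
    change P'.arrowCoef c (θ (P.path p)) = _
    match e : p.arrows with
    | [] =>
      rw [QPath.eq_triv e, Finset.sum_eq_single p.first, Finset.sum_eq_zero, if_pos rfl, add_zero]
      · intro a _
        rw [if_neg]
        exact fun h => absurd (congrArg QPath.arrows h) (by simp [QPath.triv, QPath.single])
      · intro v _ hv
        rw [if_neg]
        exact fun h => hv (congrArg QPath.first h).symm
      · simp
    | [a] =>
      rw [QPath.eq_single e, Finset.sum_eq_zero, Finset.sum_eq_single a, if_pos rfl, zero_add]
      · rfl
      · intro b _ hb
        rw [if_neg]
        intro h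
        exact hb (List.singleton_inj.1 (congrArg QPath.arrows h)).symm
      · simp
      · intro v _
        rw [if_neg]
        exact fun h => absurd (congrArg QPath.arrows h) (by simp [QPath.triv, QPath.single])
    -- The Leibniz rule expresses the coefficient through characters of images of nontrivial paths,
    -- which are zero: only the classes of arrows modulo longer paths matter.
    | a :: b :: l =>
      obtain ⟨q, hq, hqa, rfl⟩ := QPath.exists_cons e
      rw [path_comp, path_single, map_mul, arrowCoef_mul, char_map_arrow, zero_mul,
        char_map_path P P' θ _ (by simp [hqa]), mul_zero, Finset.sum_eq_zero, Finset.sum_eq_zero]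
      · intro c _
        rw [if_neg]
        intro h
        have := congrArg QPath.arrows h
        rw [e] at this
        simp [QPath.single] at this
      · intro v _
        rw [if_neg]
        intro h
        have := congrArg QPath.arrows h
        rw [e] at this
        simp [QPath.triv] at this
  have h := LinearMap.congr_fun this y
  simp only [LinearMap.add_apply, LinearMap.sum_apply, LinearMap.smul_apply, smul_eq_mul] at h
  simp only [mul_comm (P.char _ _), mul_comm (P.arrowCoef _ _)]
  exact h

theorem exists_vertexEquiv (θ : A ≃ₐ[K] A') :
    ∃ ρ : P.quiver.V ≃ P'.quiver.V, ∀ v x, P'.char (ρ v) (θ x) = P.char v x := by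
  choose σ hσ using exists_char_comp P P' θ.toAlgHom
  choose ρ hρ using exists_char_comp P' P θ.symm.toAlgHom
  have h1 : ∀ w x, P'.char w (θ x) = P.char (σ w) x := fun w => LinearMap.congr_fun (hσ w)
  have h2 : ∀ v x, P.char v (θ.symm x) = P'.char (ρ v) x := fun v => LinearMap.congr_fun (hρ v)
  refine ⟨⟨ρ, σ, fun v => P.char_injective (LinearMap.ext fun x => ?_),
    fun w => P'.char_injective (LinearMap.ext fun x => ?_)⟩, fun v x => ?_⟩
  · rw [← h1, ← h2, AlgEquiv.symm_apply_apply]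
  · rw [← h2, ← h1, AlgEquiv.apply_symm_apply]
  · change P'.char (ρ v) (θ x) = _
    rw [← h2, AlgEquiv.symm_apply_apply]

/-- The matrices of arrow coefficients of an isomorphism and its inverse are inverse to each other.
A nonzero determinant term matches the arrows, although the image of an arrow may involve several
arrows. -/
theorem exists_arrowEquiv (θ : A ≃ₐ[K] A') :
    ∃ τ : P.quiver.E ≃ P'.quiver.E, ∀ a, P'.arrowCoef (τ a) (θ (P.arrow a)) ≠ 0 := by
  classical
  have key : ∀ {B C : Type u} [Ring B] [Algebra K B] [Ring C] [Algebra K C]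
      (P : AlmostGentlePresentation K B) (P' : AlmostGentlePresentation K C) (θ : B ≃ₐ[K] C),
      (Matrix.of fun a b => P'.arrowCoef b (θ (P.arrow a)) :
        Matrix P.quiver.E P'.quiver.E K) *
        (Matrix.of fun b a => P.arrowCoef a (θ.symm (P'.arrow b)) :
        Matrix P'.quiver.E P.quiver.E K) = 1 := by
    intro B C _ _ _ _ P P' θ
    ext a c
    have h := arrowCoef_map P' P θ.symm.toAlgHom c (θ (P.arrow a))
    have h0 : ∀ v, P'.char v (θ (P.arrow a)) = 0 := fun v =>
      char_map_arrow P P' θ.toAlgHom v a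
    have h1 : θ.symm.toAlgHom (θ (P.arrow a)) = P.arrow a := θ.symm_apply_apply _
    simp only [h0, zero_mul, Finset.sum_const_zero, zero_add] at h
    rw [h1, ← path_single, arrowCoef_path] at h
    rw [Matrix.mul_apply, Matrix.one_apply]
    refine h.symm.trans ?_
    congr 1
    exact propext ⟨fun e => List.singleton_inj.1 (congrArg QPath.arrows e), fun e => by rw [e]⟩
  have h1 := key P P' θ
  have h2 := key P' P θ.symm
  rw [AlgEquiv.symm_symm] at h2
  exact exists_equiv_of_mul_eq_one h1 h2

/-- Expand `a = e a`, with `e` the idempotent of its source, by the Leibniz rule. Only the term with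
the character of `src b` at the image of `e` survives. -/
theorem src_of_arrowCoef_ne_zero (θ : A ≃ₐ[K] A') {ρ : P.quiver.V ≃ P'.quiver.V}
    (hρ : ∀ v x, P'.char (ρ v) (θ x) = P.char v x) {a : P.quiver.E} {b : P'.quiver.E}
    (h : P'.arrowCoef b (θ (P.arrow a)) ≠ 0) : P'.quiver.src b = ρ (P.quiver.src a) := by
  classical
  have h1 : P.path (QPath.triv (P.quiver.src a)) * P.arrow a = P.arrow a := by
    rw [← path_single, ← path_comp _ _ _ rfl]
    rfl
  obtain ⟨v, hv⟩ := ρ.surjective (P'.quiver.src b)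
  have h0 : P'.char (P'.quiver.tgt b) (θ (P.arrow a)) = 0 := char_map_arrow P P' θ.toAlgHom _ a
  rw [← h1, map_mul, arrowCoef_mul, h0, mul_zero, add_zero, ← hv, hρ, char_path] at h
  rw [← hv]
  by_contra hne
  rw [if_neg, zero_mul] at h
  · exact h rfl
  · intro e
    exact hne (congrArg ρ (congrArg QPath.first e).symm)

theorem tgt_of_arrowCoef_ne_zero (θ : A ≃ₐ[K] A') {ρ : P.quiver.V ≃ P'.quiver.V}
    (hρ : ∀ v x, P'.char (ρ v) (θ x) = P.char v x) {a : P.quiver.E} {b : P'.quiver.E}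
    (h : P'.arrowCoef b (θ (P.arrow a)) ≠ 0) : P'.quiver.tgt b = ρ (P.quiver.tgt a) := by
  classical
  have h1 : P.arrow a * P.path (QPath.triv (P.quiver.tgt a)) = P.arrow a := by
    rw [← path_single, ← path_comp _ _ _ rfl]
    rfl
  obtain ⟨v, hv⟩ := ρ.surjective (P'.quiver.tgt b)
  have h0 : P'.char (P'.quiver.src b) (θ (P.arrow a)) = 0 := char_map_arrow P P' θ.toAlgHom _ a
  rw [← h1, map_mul, arrowCoef_mul, h0, zero_mul, zero_add, ← hv, hρ, char_path] at h
  rw [← hv]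
  by_contra hne
  rw [if_neg, mul_zero] at h
  · exact h rfl
  · intro e
    exact hne (congrArg ρ (congrArg QPath.first e).symm)

/-- The coefficient of `a' b'` in the product of the images is the product of the two arrow
coefficients, since the outer terms contain characters of images of arrows. It is nonzero, so `a b`
is not zero. -/
theorem next_of_arrowCoef_ne_zero (θ : A ≃ₐ[K] A') {a b : P.quiver.E} {a' b' : P'.quiver.E}
    (ha : P'.arrowCoef a' (θ (P.arrow a)) ≠ 0) (hb : P'.arrowCoef b' (θ (P.arrow b)) ≠ 0)
    (h : P'.Next a' b') : P.Next a b := by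
  intro h0
  have hs := P'.tgt_eq_src_of_next h
  let r : P'.quiver.QPath := (QPath.single a').comp (QPath.single b') hs
  have hr : P'.path r ≠ 0 := (P'.path_comp (QPath.single a') (QPath.single b') hs).trans_ne h
  have h1 := P'.coef_mul hr (θ (P.arrow a)) (θ (P.arrow b))
  have h2 : r.length = 2 := rfl
  have h3 : r.take 0 = QPath.triv (P'.quiver.src a') := rfl
  have h4 : r.drop 2 = QPath.triv (P'.quiver.tgt b') := rfl
  have h5 : r.take 1 = QPath.single a' := rfl
  have h6 : r.drop 1 = QPath.single b' := QPath.ext hs rfl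
  have h7 : P'.coef (QPath.triv (P'.quiver.src a')) (θ (P.arrow a)) = 0 :=
    char_map_arrow P P' θ.toAlgHom _ a
  have h8 : P'.coef (QPath.triv (P'.quiver.tgt b')) (θ (P.arrow b)) = 0 :=
    char_map_arrow P P' θ.toAlgHom _ b
  rw [← map_mul, h0, map_zero, map_zero, h2, Finset.sum_range_succ, Finset.sum_range_succ,
    Finset.sum_range_one, h3, h4, h5, h6, h7, h8, zero_mul, mul_zero, zero_add, add_zero] at h1
  exact mul_ne_zero ha hb h1.symm

/-- Isomorphic almost gentle algebras have isomorphic quivers with relations. -/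
theorem exists_quiverIso (θ : A ≃ₐ[K] A') :
    ∃ f : Hom P.quiver P'.quiver, Function.Bijective f.onV ∧ Function.Bijective f.onE ∧
      ∀ a b, P.Next a b ↔ P'.Next (f.onE a) (f.onE b) := by
  obtain ⟨ρ, hρ⟩ := exists_vertexEquiv P P' θ
  obtain ⟨τ, hτ⟩ := exists_arrowEquiv P P' θ
  obtain ⟨τ', hτ'⟩ := exists_arrowEquiv P' P θ.symm
  refine ⟨⟨ρ, τ, fun a => src_of_arrowCoef_ne_zero P P' θ hρ (hτ a),
    fun a => tgt_of_arrowCoef_ne_zero P P' θ hρ (hτ a)⟩, ρ.bijective, τ.bijective, ?_⟩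
  have h1 : ∀ a b, P'.Next (τ a) (τ b) → P.Next a b := fun a b =>
    next_of_arrowCoef_ne_zero P P' θ (hτ a) (hτ b)
  have h2 : ∀ a b, P.Next (τ' a) (τ' b) → P'.Next a b := fun a b =>
    next_of_arrowCoef_ne_zero P' P θ.symm (hτ' a) (hτ' b)
  let s : Set (P.quiver.E × P.quiver.E) := {x | P.Next x.1 x.2}
  let s' : Set (P'.quiver.E × P'.quiver.E) := {x | P'.Next x.1 x.2}
  -- The matchings `τ` and `τ'` come from separate choices and need not be inverse, so each gives
  -- one implication only. Counting pairs of arrows with nonzero product turns the inclusion given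
  -- by `τ` into an equality.
  have hs : s.ncard ≤ s'.ncard := by
    refine Set.ncard_le_ncard_of_injOn (fun x => (τ'.symm x.1, τ'.symm x.2)) ?_ ?_ s'.toFinite
    · intro x hx
      have hx' : P.Next x.1 x.2 := hx
      exact h2 _ _ (by simpa using hx')
    · intro x _ y _ h
      simpa [Prod.ext_iff] using h
  have hsub : (fun x : P'.quiver.E × P'.quiver.E => (τ.symm x.1, τ.symm x.2)) '' s' ⊆ s := by
    rintro _ ⟨x, hx, rfl⟩
    have hx' : P'.Next x.1 x.2 := hx
    exact h1 _ _ (by simpa using hx')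
  have hinj : Function.Injective
      (fun x : P'.quiver.E × P'.quiver.E => (τ.symm x.1, τ.symm x.2)) := by
    intro x y h
    simpa [Prod.ext_iff] using h
  have heq := Set.eq_of_subset_of_ncard_le hsub
    (by rw [Set.ncard_image_of_injective _ hinj]; exact hs) s.toFinite
  refine fun a b => ⟨fun h => ?_, h1 a b⟩
  have hab : (a, b) ∈ s := h
  rw [← heq] at hab
  obtain ⟨x, hx, e⟩ := hab
  obtain ⟨rfl, rfl⟩ := Prod.ext_iff.1 e
  change P'.Next (τ (τ.symm x.1)) (τ (τ.symm x.2))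
  rw [Equiv.apply_symm_apply, Equiv.apply_symm_apply]
  exact hx

/-! ### From isomorphisms of quivers with relations to isomorphisms of trivial extensions -/

theorem path_mapPath_ne_zero_iff (f : Hom P.quiver P'.quiver)
    (hf : ∀ a b, P.Next a b ↔ P'.Next (f.onE a) (f.onE b)) (p : P.quiver.QPath) :
    P'.path (f.mapPath p) ≠ 0 ↔ P.path p ≠ 0 := by
  rw [path_ne_zero_iff, path_ne_zero_iff]
  change (p.arrows.map f.onE).IsChain _ ↔ _
  rw [List.isChain_map]
  simp only [← hf]

/-- Both kernels are spanned by paths, so a bijection of paths that preserves vanishing identifies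
them. -/
theorem exists_algEquiv_path (f : Hom P.quiver P'.quiver) (hV : Function.Bijective f.onV)
    (hE : Function.Bijective f.onE) (hf : ∀ a b, P.Next a b ↔ P'.Next (f.onE a) (f.onE b)) :
    ∃ e : A ≃ₐ[K] A', ∀ p, e (P.path p) = P'.path (f.mapPath p) := by
  classical
  obtain ⟨F, hF⟩ := exists_map (K := K) f hV
  have hpath : ∀ p, P'.path (f.mapPath p) = 0 ↔ P.path p = 0 := fun p =>
    not_iff_not.1 (path_mapPath_ne_zero_iff P P' f hf p)
  have hinj := f.mapPath_injective hV.1 hE.1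
  have hcoeff : ∀ p x, coeff (f.mapPath p) (F x) = coeff p x := by
    intro p
    have : coeff (f.mapPath p) ∘ₗ F.toLinearMap = coeff (K := K) p := by
      apply PathAlgebra.linearMap_ext
      intro q
      rw [LinearMap.comp_apply, AlgHom.toLinearMap_apply, hF, coeff_ofPath, coeff_ofPath]
      simp only [hinj.eq_iff]
    exact LinearMap.congr_fun this
  have hsum : ∀ x, P'.π (F x) = ∑ p ∈ support x, coeff p x • P'.path (f.mapPath p) := by
    intro x
    refine (map_eq_sum (P'.π.comp F).toLinearMap x).trans (Finset.sum_congr rfl fun p _ => ?_)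
    congr 1
    exact congrArg P'.π (hF p)
  have hsum' : ∀ x, P.π x = ∑ p ∈ support x, coeff p x • P.path p := fun x =>
    map_eq_sum P.π.toLinearMap x
  obtain ⟨e, he⟩ := exists_algEquiv_of_ker_iff P.π P.surjective (P'.π.comp F) (by
      intro y
      induction y using P'.induction with
      | zero => exact ⟨0, map_zero _⟩
      | add y z hy hz =>
        obtain ⟨y, rfl⟩ := hy
        obtain ⟨z, rfl⟩ := hz
        exact ⟨y + z, map_add _ _ _⟩
      | path c p =>
        obtain ⟨q, rfl⟩ := f.mapPath_surjective hV hE.2 p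
        refine ⟨c • ofPath K q, ?_⟩
        rw [map_smul, AlgHom.comp_apply, hF]
        rfl) (by
      intro x
      rw [AlgHom.comp_apply]
      constructor
      · intro h
        rw [hsum]
        refine Finset.sum_eq_zero fun p hp => ?_
        rw [(hpath p).2 (P.path_eq_zero_of_coeff h ((mem_support_iff p x).1 hp)), smul_zero]
      · intro h
        rw [hsum']
        refine Finset.sum_eq_zero fun p hp => ?_
        rw [(hpath p).1 (P'.path_eq_zero_of_coeff h
          (by rw [hcoeff]; exact (mem_support_iff p x).1 hp)), smul_zero])
  refine ⟨e, fun p => (he (ofPath K p)).trans ?_⟩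
  rw [AlgHom.comp_apply, hF]
  rfl

/-- The given `θ` is only used to find an isomorphism of quivers with relations. The isomorphism `e`
built from that permutes paths, hence matches maximal paths and their dual basis elements. -/
theorem exists_equiv_image_newArrows (θ : A ≃ₐ[K] A') :
    ∃ E : TrivialExtension K A ≃ₐ[K] TrivialExtension K A', E '' P.newArrows = P'.newArrows := by
  classical
  obtain ⟨f, hV, hE, hf⟩ := exists_quiverIso P P' θ
  obtain ⟨e, he⟩ := exists_algEquiv_path P P' f hV hE hf
  obtain ⟨E, hE'⟩ := TrivialExtension.exists_algEquiv e
  have harrow : ∀ a, P'.arrow (f.onE a) = e (P.arrow a) := by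
    intro a
    rw [← path_single, ← path_single, he]
    congr 1
    exact QPath.ext (f.src_onE a) rfl
  have hmax : ∀ m, P'.IsMaximalPath (f.mapPath m) ↔ P.IsMaximalPath m := by
    intro m
    rw [IsMaximalPath, IsMaximalPath, path_mapPath_ne_zero_iff P P' f hf, hE.2.forall]
    simp only [harrow, ← he, ← map_mul, EmbeddingLike.map_eq_zero_iff]
  have hbeta : ∀ m, P.path m ≠ 0 →
      E (TrivSqZeroExt.inr (DualBimodule.of K (P.coef m))) =
        TrivSqZeroExt.inr (DualBimodule.of K (P'.coef (f.mapPath m))) := by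
    intro m hm
    have h := hE' 0 (P.coef m)
    rw [map_zero, TrivSqZeroExt.inl_zero, TrivSqZeroExt.inl_zero, zero_add, zero_add] at h
    rw [h]
    refine congrArg (fun g => TrivSqZeroExt.inr (DualBimodule.of K g))
      (P'.linearMap_ext fun p' _ => ?_)
    obtain ⟨p, rfl⟩ := f.mapPath_surjective hV hE.2 p'
    rw [P'.coef_path ((path_mapPath_ne_zero_iff P P' f hf m).2 hm), ← he]
    change P.coef m (e.symm (e (P.path p))) = _
    rw [AlgEquiv.symm_apply_apply, P.coef_path hm]
    simp only [(f.mapPath_injective hV.1 hE.1).eq_iff]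
  refine ⟨E, ?_⟩
  ext x
  rw [mem_newArrows_iff]
  constructor
  · rintro ⟨y, hy, rfl⟩
    obtain ⟨m, hm, rfl⟩ := (P.mem_newArrows_iff _).1 hy
    exact ⟨_, (hmax m).2 hm, hbeta m hm.1⟩
  · rintro ⟨m', hm', rfl⟩
    obtain ⟨m, rfl⟩ := f.mapPath_surjective hV hE.2 m'
    have hm := (hmax m).1 hm'
    exact ⟨_, (P.mem_newArrows_iff _).2 ⟨m, hm, rfl⟩, hbeta m hm.1⟩

end AlmostGentlePresentation

end AlmostGentle

namespace AlmostGentle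

open FinQuiver PathAlgebra

variable {K : Type u} [Field K]

/-! ### Cutting the cycles -/

section Cut

variable {Q : FinQuiver} {S : Set Q.QPath} {μ : Q.QPath → ℕ} {cut : Set Q.E}

namespace IsDefiningPair

variable (hS : IsDefiningPair S μ)
include hS

theorem next_unique {a b c : Q.E} (h : ∃ t, a :: b :: t ∈ cycleWords S)
    (h' : ∃ t, a :: c :: t ∈ cycleWords S) : b = c := by
  obtain ⟨t, ht⟩ := h
  obtain ⟨t', ht'⟩ := h'
  exact (List.cons.inj (hS.tail_unique ht ht')).1

theorem prev_unique {a b c : Q.E} (h : ∃ t, b :: a :: t ∈ cycleWords S)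
    (h' : ∃ t, c :: a :: t ∈ cycleWords S) : b = c := by
  obtain ⟨t, ht⟩ := h
  obtain ⟨t', ht'⟩ := h'
  have h1 := hS.append_comm_mem (l := [b]) (l' := a :: t) ht
  have h2 := hS.append_comm_mem (l := [c]) (l' := a :: t') ht'
  have := hS.tail_unique (a := a) (l := t ++ [b]) (l' := t' ++ [c]) h1 h2
  exact List.singleton_inj.1 (List.append_inj' this rfl).2

theorem exists_next_of_eq_append {l s t : List Q.E} {a b : Q.E} (hl : l ∈ cycleWords S)
    (h : l = s ++ a :: b :: t) : ∃ t, a :: b :: t ∈ cycleWords S :=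
  hS.exists_cons_cons_mem hl ⟨s, t, by simp [h]⟩

theorem exists_next_last_head {s : List Q.E} {a b : Q.E} (hl : b :: (s ++ [a]) ∈ cycleWords S) :
    ∃ t, a :: b :: t ∈ cycleWords S :=
  ⟨s, hS.append_comm_mem (l := b :: s) (l' := [a]) hl⟩

theorem subsingleton_of_singleton_mem (hμ : ∀ C ∈ S, μ C = 1) {a : Q.E}
    (h : [a] ∈ cycleWords S) : Subsingleton Q.E := by
  obtain ⟨C, hC, e⟩ := h
  rw [← not_nontrivial_iff_subsingleton]
  intro hE
  have := hS.loop C hC (by rw [QPath.length, e]; rfl) hE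
  rw [hμ C hC] at this
  exact absurd this (lt_irrefl 1)

omit hS in
theorem tgt_eq_src {a b : Q.E} (h : ∃ t, a :: b :: t ∈ cycleWords S) : Q.tgt a = Q.src b := by
  obtain ⟨t, C, -, e⟩ := h
  have := C.isWalk
  rw [e] at this
  exact this.2.1.symm

end IsDefiningPair

theorem IsAdmissibleCut.exists_mem (hcut : IsAdmissibleCut S cut) {l : List Q.E}
    (hl : l ∈ cycleWords S) : ∃ a ∈ cut, a ∈ l := by
  obtain ⟨C, hC, rfl⟩ := hl
  obtain ⟨a, ha, -⟩ := hcut C hC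
  exact ⟨a, ha.1, ha.2⟩

theorem IsAdmissibleCut.eq_of_mem (hcut : IsAdmissibleCut S cut) {l : List Q.E}
    (hl : l ∈ cycleWords S) {a b : Q.E} (ha : a ∈ cut) (ha' : a ∈ l) (hb : b ∈ cut)
    (hb' : b ∈ l) : a = b := by
  obtain ⟨C, hC, rfl⟩ := hl
  exact (hcut C hC).unique ⟨ha, ha'⟩ ⟨hb, hb'⟩

/-- A walk outside the cut that follows the cycles stays inside one turn of its cycle. -/
theorem IsDefiningPair.prefix_of_isChain (hS : IsDefiningPair S μ) (hcut : IsAdmissibleCut S cut)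
    {a : Q.E} {L l : List Q.E} (hL : ∀ b ∈ a :: L, b ∉ cut)
    (hc : (a :: L).IsChain fun a b => ∃ t, a :: b :: t ∈ cycleWords S)
    (hl : a :: l ∈ cycleWords S) : L <+: l := by
  induction L using List.reverseRecOn with
  | nil => exact List.nil_prefix
  | append_singleton L b ih =>
    obtain ⟨t, rfl⟩ := ih (fun b hb => hL b (by
      rcases List.mem_cons.1 hb with rfl | hb
      · exact List.mem_cons_self
      · exact List.mem_cons_of_mem _ (List.mem_append_left _ hb)))
      (isChain_left_of_append (l := a :: L) (l' := [b]) hc)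
    rcases t with _ | ⟨c, t⟩
    -- Nothing left of the cycle would mean that the walk has used all of it without meeting the
    -- cut.
    · obtain ⟨x, hx, hx'⟩ := hcut.exists_mem hl
      rw [List.append_nil] at hx'
      exact absurd hx (hL x (by
        rcases List.mem_cons.1 hx' with rfl | hb
        · exact List.mem_cons_self
        · exact List.mem_cons_of_mem _ (List.mem_append_left _ hb)))
    -- Both `b` and the next arrow `c` of the cycle follow the last arrow `d`, so they agree.
    · obtain ⟨s, d, e⟩ := List.eq_nil_or_concat' (a :: L) |>.resolve_left (by simp)
      have h1 : ∃ t, d :: b :: t ∈ cycleWords S := by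
        have h2 : (s ++ d :: b :: []).IsChain fun a b => ∃ t, a :: b :: t ∈ cycleWords S := by
          have : s ++ d :: b :: [] = (a :: L) ++ [b] := by rw [e]; simp
          rw [this]
          exact hc
        exact (List.isChain_append_cons_cons.1 h2).2.1
      have h2 : ∃ t, d :: c :: t ∈ cycleWords S := by
        refine hS.exists_next_of_eq_append hl (s := s) (t := t) ?_
        rw [← List.cons_append, e]
        simp
      obtain rfl := hS.next_unique h1 h2
      exact ⟨t, by simp⟩

/-- The quiver without the arrows of the cut. -/
abbrev removeCut (Q : FinQuiver) (cut : Set Q.E) : FinQuiver where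
  V := Q.V
  E := {a : Q.E // a ∉ cut}
  fintypeE := (Set.toFinite {a | a ∉ cut}).fintype
  src a := Q.src a
  tgt a := Q.tgt a

/-- The almost gentle algebra obtained by cutting the cycles of a defining pair. -/
theorem exists_cutPresentation (K : Type u) [Field K] (hS : IsDefiningPair S μ)
    (hcut : IsAdmissibleCut S cut) :
    ∃ (A : Type u) (_ : Ring A) (_ : Algebra K A) (P : AlmostGentlePresentation K A)
      (i : Hom P.quiver Q), Function.Bijective i.onV ∧ Function.Injective i.onE ∧
        (∀ a, a ∉ cut ↔ a ∈ Set.range i.onE) ∧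
        ∀ a b, P.Next a b ↔ ∃ t, i.onE a :: i.onE b :: t ∈ cycleWords S := by
  let Q' : FinQuiver := removeCut Q cut
  let i : Hom Q' Q := ⟨id, Subtype.val, fun _ => rfl, fun _ => rfl⟩
  let R : Set Q'.QPath := {p | ∃ a b, p.arrows = [a, b] ∧ ¬ ∃ t, a.1 :: b.1 :: t ∈ cycleWords S}
  let I : TwoSidedIdeal (PathAlgebra K Q') := TwoSidedIdeal.span (ofPath K '' R)
  let π : PathAlgebra K Q' →ₐ[K] I.ringCon.Quotient := RingCon.mkₐ (α := K) I.ringCon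
  have hker : TwoSidedIdeal.ker π = I := TwoSidedIdeal.ext fun x => by
    rw [TwoSidedIdeal.mem_ker]
    exact ker_mkₐ I x
  have hR2 : ∀ r ∈ R, r.length = 2 := by
    rintro r ⟨a, b, e, -⟩
    rw [QPath.length, e]
    rfl
  have hnext : ∀ a b : Q'.E, ofArrow K a * ofArrow K b ∉ I ↔
      ∃ t, a.1 :: b.1 :: t ∈ cycleWords S := by
    intro a b
    constructor
    · intro h
      by_contra hn
      apply h
      by_cases hc : Q'.tgt a = Q'.src b
      · rw [ofArrow_mul_ofArrow hc]
        exact TwoSidedIdeal.subset_span ⟨_, ⟨a, b, rfl, hn⟩, rfl⟩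
      · rw [ofArrow_mul_ofArrow_of_ne hc]
        exact I.zero_mem
    · intro h hI
      have hc : Q'.tgt a = Q'.src b := IsDefiningPair.tgt_eq_src (Q := Q) h
      rw [ofArrow_mul_ofArrow hc] at hI
      obtain ⟨r, ⟨a', b', e, hn⟩, hr⟩ := exists_infix_of_mem_span hI
        (p := (QPath.single a).comp (QPath.single b) hc)
        (by rw [coeff_ofPath_self]; exact one_ne_zero)
      have h1 := hr.eq_of_length (by rw [e]; rfl)
      rw [e] at h1
      obtain ⟨rfl, h2⟩ := List.cons.inj h1
      obtain ⟨rfl, -⟩ := List.cons.inj h2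
      exact hn h
  have hchain : ∀ p : Q'.QPath, ofPath K p ∉ I →
      (p.arrows.map i.onE).IsChain fun a b => ∃ t, a :: b :: t ∈ cycleWords S := by
    intro p hp
    rw [List.isChain_map, List.isChain_iff_forall_rel_of_append_cons_cons]
    intro a b s t e
    refine (hnext a b).1 fun hI => hp ?_
    have hc : Q'.tgt a = Q'.src b := by
      have := p.isWalk
      rw [e, isWalk_append] at this
      exact this.2.2.1.symm
    rw [ofArrow_mul_ofArrow hc] at hI
    obtain ⟨x, y, hxy⟩ := exists_mul_mul_of_infix (K := K)
      (r := (QPath.single a).comp (QPath.single b) hc) (p := p)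
      ⟨s, t, by rw [e]; simp [QPath.comp, QPath.single]⟩ (by simp [QPath.comp, QPath.single])
    rw [hxy]
    exact I.mul_mem_right _ _ (I.mul_mem_left _ _ hI)
  have hadm : IsAdmissible K I := by
    refine ⟨fun x hx p hp => ?_, Fintype.card Q.E + 1, fun p hp => ?_⟩
    · obtain ⟨r, hr, hrp⟩ := exists_infix_of_mem_span hx ((mem_support_iff p x).1 hp)
      exact (hR2 r hr) ▸ hrp.length_le
    · by_contra hI
      have h1 := hchain p hI
      match e : p.arrows with
      | [] =>
        rw [QPath.length, e] at hp
        simp at hp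
      | a :: L =>
        obtain ⟨l, hl⟩ := hS.exists_cons_mem a.1
        rw [e] at h1
        -- A nonzero path is a piece of one turn of a cycle, whose length is at most the number of
        -- arrows of `Q`.
        have h2 := hS.prefix_of_isChain hcut (L := L.map i.onE) (a := a.1) (by
          intro b hb
          have hb' : b ∈ (a :: L).map i.onE := hb
          obtain ⟨c, -, rfl⟩ := List.mem_map.1 hb'
          exact c.2) h1 hl
        have h3 := h2.length_le
        have h4 := (hS.nodup hl).length_le_card
        rw [QPath.length, e, List.length_cons] at hp
        rw [List.length_map] at h3
        rw [List.length_cons] at h4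
        omega
  have hmul : IsSpecialMultiserial K I := by
    constructor
    · intro a b b' h h'
      exact Subtype.ext (hS.next_unique ((hnext a b).1 h) ((hnext a b').1 h'))
    · intro a c c' h h'
      exact Subtype.ext (hS.prev_unique ((hnext c a).1 h) ((hnext c' a).1 h'))
  let P : AlmostGentlePresentation K I.ringCon.Quotient :=
    { quiver := Q'
      π := π
      surjective := RingCon.mkₐ_surjective _
      admissible := hker.symm ▸ hadm
      quadratic := ⟨R, hR2, hker⟩
      multiserial := hker.symm ▸ hmul }
  refine ⟨_, _, _, P, i, Function.bijective_id, Subtype.val_injective, fun a => ?_, fun a b => ?_⟩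
  · exact ⟨fun h => ⟨⟨a, h⟩, rfl⟩, by rintro ⟨a, rfl⟩; exact a.2⟩
  · rw [P.next_iff]
    change _ ∉ TwoSidedIdeal.ker π ↔ _
    rw [hker]
    exact hnext a b

end Cut

end AlmostGentle

namespace AlmostGentle

open FinQuiver PathAlgebra

variable {K : Type u} [Field K]

/-! ### The trivial extension of a cut algebra -/

section Recover

variable {Q : FinQuiver} {S : Set Q.QPath} {μ : Q.QPath → ℕ} {cut : Set Q.E}

theorem IsDefiningPair.notMem_cut_of_cons_mem (hS : IsDefiningPair S μ)
    (hcut : IsAdmissibleCut S cut) {c : Q.E} {l : List Q.E}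
    (h : c :: l ∈ cycleWords S) (hc : c ∈ cut) : ∀ a ∈ l, a ∉ cut := by
  intro a ha hac
  have := hcut.eq_of_mem h hc List.mem_cons_self hac (List.mem_cons_of_mem _ ha)
  exact (List.nodup_cons.1 (hS.nodup h)).1 (this ▸ ha)

/-- The arrow that completes a path is unique, also for trivial paths. -/
theorem IsDefiningPair.eq_of_completes (hS : IsDefiningPair S μ) (hμ : ∀ C ∈ S, μ C = 1)
    {c c' : Q.E} {q : Q.QPath} (h : Completes S (QPath.single c) q)
    (h' : Completes S (QPath.single c') q) : c = c' := by
  by_cases hq : q.arrows = []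
  · have h1 := h.2
    rw [hq] at h1
    have := hS.subsingleton_of_singleton_mem hμ (a := c) h1
    exact Subsingleton.elim _ _
  · have := hS.completes_unique hq h h'
    exact List.singleton_inj.1 (congrArg QPath.arrows this)

variable {A : Type u} [Ring A] [Algebra K A] {P : AlmostGentlePresentation K A}

/-- The morphism `i` identifies the quiver of `P` with `Q` without the arrows of the cut, such that
two arrows have a nonzero product if and only if they are consecutive in a cycle. -/
structure IsCutPresentation (S : Set Q.QPath) (cut : Set Q.E) (P : AlmostGentlePresentation K A)
    (i : Hom P.quiver Q) : Prop where
  onV : Function.Bijective i.onV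
  onE : Function.Injective i.onE
  notMem_iff : ∀ a, a ∉ cut ↔ a ∈ Set.range i.onE
  next_iff : ∀ a b, P.Next a b ↔ ∃ t, i.onE a :: i.onE b :: t ∈ cycleWords S

namespace IsCutPresentation

variable {i : Hom P.quiver Q} (hi : IsCutPresentation S cut P i)
include hi

theorem onE_notMem (a : P.quiver.E) : i.onE a ∉ cut := (hi.notMem_iff _).2 ⟨a, rfl⟩

theorem isChain_iff (l : List P.quiver.E) : l.IsChain P.Next ↔
    (l.map i.onE).IsChain fun a b => ∃ t, a :: b :: t ∈ cycleWords S := by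
  rw [List.isChain_map]
  have : P.Next = fun a b => ∃ t, i.onE a :: i.onE b :: t ∈ cycleWords S := by
    funext a b
    exact propext (hi.next_iff a b)
  rw [this]

theorem exists_eq_map {l : List Q.E} (h : ∀ a ∈ l, a ∉ cut) : ∃ L : List P.quiver.E,
    L.map i.onE = l := by
  have : l ∈ Set.range (List.map i.onE) := by
    rw [Set.range_list_map]
    exact fun a ha => (hi.notMem_iff a).1 (h a ha)
  exact this

variable (hS : IsDefiningPair S μ) (hcut : IsAdmissibleCut S cut)
include hS hcut

/-- A maximal path follows one cycle and can stop only in front of the cut arrow and start only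
behind it. As the cycle has just one such arrow, this arrow closes the path to the whole cycle. -/
theorem exists_completes_of_isMaximalPath (hv : ∀ v, ∃ C ∈ S, C.first = v) {m : P.quiver.QPath}
    (hm : P.IsMaximalPath m) : ∃ c ∈ cut, Completes S (QPath.single c) (i.mapPath m) := by
  rcases hL : m.arrows with _ | ⟨b, L⟩
  · obtain ⟨C, hC, hCv⟩ := hv (i.onV m.first)
    have hm' := (P.isMaximalPath_iff m).1 hm
    have hlast : m.last = m.first := QPath.last_of_nil hL
    have hCs := hS.simple C hC
    obtain ⟨s, y, hy⟩ := List.eq_nil_or_concat' C.arrows |>.resolve_left hCs.1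
    obtain ⟨x, t, hx⟩ := List.exists_cons_of_ne_nil hCs.1
    have hCw : C.arrows ∈ cycleWords S := ⟨C, hC, rfl⟩
    have hxs : Q.src x = C.first := by
      have := C.isWalk
      rw [hx] at this
      exact this.1
    have hyt : Q.tgt y = C.first := by
      rw [← hCs.2.1, QPath.last, hy, walkEnd_append]
      rfl
    have hxc : x ∈ cut := by
      by_contra hn
      obtain ⟨a, rfl⟩ := (hi.notMem_iff x).1 hn
      refine hm'.2.2 a ?_ (by rw [hL]; exact List.isChain_singleton _)
      rw [hlast]
      exact hi.onV.1 (by rw [← i.src_onE, hxs, hCv])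
    have hyc : y ∈ cut := by
      by_contra hn
      obtain ⟨a, rfl⟩ := (hi.notMem_iff y).1 hn
      refine hm'.2.1 a ?_ (by rw [hL]; exact List.isChain_singleton _)
      exact hi.onV.1 (by rw [← i.tgt_onE, hyt, hCv])
    -- At a trivial maximal path the first and the last arrow of the cycle `C` are both cut, hence
    -- equal. Since `C` repeats no arrow, it is a loop.
    obtain rfl := hcut.eq_of_mem hCw hxc (by simp [hx]) hyc (by simp [hy])
    refine ⟨x, hxc, ?_, ?_⟩
    · change Q.tgt x = i.onV m.first
      rw [hyt, hCv]
    · have h1 : s = [] := by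
        rcases s with _ | ⟨z, s⟩
        · rfl
        · rw [hy] at hx
          obtain ⟨rfl, -⟩ := List.cons.inj hx
          have := hCs.2.2
          rw [hy] at this
          simp at this
      rw [hy, h1] at hCw
      simpa [Hom.mapPath, hL, QPath.single] using hCw
  · have hne : m.arrows ≠ [] := by simp [hL]
    obtain ⟨l, hl⟩ := hS.exists_cons_mem (i.onE b)
    have hch := (hi.isChain_iff _).1 hm.isChain
    rw [hL, List.map_cons] at hch
    have hnc : ∀ x ∈ i.onE b :: L.map i.onE, x ∉ cut := by
      intro x hx
      rw [← List.map_cons] at hx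
      obtain ⟨a, -, rfl⟩ := List.mem_map.1 hx
      exact hi.onE_notMem a
    obtain ⟨t, rfl⟩ := hS.prefix_of_isChain hcut hnc hch hl
    rcases t with _ | ⟨c, t⟩
    · obtain ⟨x, hx, hx'⟩ := hcut.exists_mem hl
      rw [List.append_nil] at hx'
      exact absurd hx (hnc x hx')
    · have hc : c ∈ cut := by
        by_contra hn
        obtain ⟨a, rfl⟩ := (hi.notMem_iff c).1 hn
        refine hm.not_isChain_concat hne a ((hi.isChain_iff _).2 ?_)
        rw [List.isChain_iff_forall_rel_of_append_cons_cons]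
        intro x y s r e
        refine hS.exists_next_of_eq_append hl (s := s) (t := r ++ t) ?_
        have : i.onE b :: (L.map i.onE ++ i.onE a :: t) = (m.arrows ++ [a]).map i.onE ++ t := by
          simp [hL]
        rw [this, e]
        simp
      have hrot : c :: (t ++ m.arrows.map i.onE) ∈ cycleWords S := by
        have := hS.append_comm_mem (l := m.arrows.map i.onE) (l' := c :: t) (by simpa [hL] using hl)
        simpa using this
      -- An arrow `d` left between `c` and `m` on the cycle would be outside the cut and would
      -- prolong `m` to the left.
      have ht : t = [] := by
        rcases List.eq_nil_or_concat' t with rfl | ⟨s, d, rfl⟩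
        · rfl
        · exfalso
          have hd := hS.notMem_cut_of_cons_mem hcut hrot hc d (by simp)
          obtain ⟨a, rfl⟩ := (hi.notMem_iff d).1 hd
          refine hm.not_isChain_cons hne a ((hi.isChain_iff _).2 ?_)
          rw [List.isChain_iff_forall_rel_of_append_cons_cons]
          intro x y s' r e
          refine hS.exists_next_of_eq_append hrot (s := c :: s ++ s') (t := r) ?_
          have : c :: (s ++ [i.onE a] ++ m.arrows.map i.onE) =
              c :: s ++ (a :: m.arrows).map i.onE := by simp
          rw [this, e]
          simp
      subst ht
      refine ⟨c, hc, IsDefiningPair.completes_of_ne_nil (by simp [QPath.single])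
        (by simp [Hom.mapPath, hL]) ?_⟩
      simpa [Hom.mapPath, QPath.single] using hrot

/-- The rest of the cycle of `c` is a path outside the cut. Its only possible prolongation on either
side is `c`. If that rest is trivial, `c` is a loop and by (D0) the only arrow. -/
theorem exists_isMaximalPath_completes (hμ : ∀ C ∈ S, μ C = 1) {c : Q.E} (hc : c ∈ cut) :
    ∃ m, P.IsMaximalPath m ∧ Completes S (QPath.single c) (i.mapPath m) := by
  obtain ⟨l, hl⟩ := hS.exists_cons_mem c
  have hnc := hS.notMem_cut_of_cons_mem hcut hl hc
  obtain ⟨L, rfl⟩ := hi.exists_eq_map hnc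
  obtain ⟨q, hq, hcomp⟩ := IsDefiningPair.exists_completes (p := QPath.single c)
    (by simp [QPath.single]) (l := L.map i.onE) hl
  obtain ⟨m, rfl, rfl⟩ := i.exists_mapPath_eq hi.onV q L hq
  refine ⟨m, (P.isMaximalPath_iff m).2 ⟨(hi.isChain_iff _).2 ?_, fun a _ h => ?_, fun a _ h => ?_⟩,
    hcomp⟩
  · rw [List.isChain_iff_forall_rel_of_append_cons_cons]
    intro x y s r e
    exact hS.exists_next_of_eq_append hl (s := c :: s) (t := r) (by rw [e]; rfl)
  · rcases e : m.arrows with _ | ⟨b, L⟩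
    · rw [e] at hl
      have := hS.subsingleton_of_singleton_mem hμ hl
      exact hi.onE_notMem a (Subsingleton.elim c (i.onE a) ▸ hc)
    · rw [e] at h hl
      have h1 := (hi.next_iff a b).1 (List.isChain_cons_cons.1 h).1
      have h2 := hS.prev_unique h1 ⟨_, hl⟩
      exact hi.onE_notMem a (h2 ▸ hc)
  · rcases List.eq_nil_or_concat' m.arrows with e | ⟨s, b, e⟩
    · rw [e] at hl
      have := hS.subsingleton_of_singleton_mem hμ hl
      exact hi.onE_notMem a (Subsingleton.elim c (i.onE a) ▸ hc)
    · rw [e] at h hl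
      have h1 : ∃ t, i.onE b :: i.onE a :: t ∈ cycleWords S := by
        rw [List.append_assoc] at h
        exact (hi.next_iff b a).1 (List.isChain_append_cons_cons.1 h).2.1
      have h2 : ∃ t, i.onE b :: c :: t ∈ cycleWords S :=
        hS.exists_next_last_head (s := s.map i.onE) (by simpa using hl)
      exact hi.onE_notMem a (hS.next_unique h1 h2 ▸ hc)

/-- The quiver of the trivial extension is the original quiver. -/
theorem exists_hom (hμ : ∀ C ∈ S, μ C = 1) (hv : ∀ v, ∃ C ∈ S, C.first = v) :
    ∃ g : Hom P.extQuiver Q, Function.Bijective g.onV ∧ Function.Bijective g.onE ∧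
      (∀ a, a ∈ cut ↔ ∃ m, g.onE (P.newArrow m) = a) ∧
      ∀ p, p ∈ P.extCycles ↔ g.mapPath p ∈ S := by
  -- The new arrow of `m` is to be sent to the cut arrow `c m` that closes `m` to a cycle.
  choose c hc hcm using fun m : P.MaxPath =>
    hi.exists_completes_of_isMaximalPath hS hcut hv m.2
  have hcinj : Function.Injective c := by
    intro m m' h
    have h1 := hS.completes_symm (hcm m)
    have h2 := hS.completes_symm (hcm m')
    rw [← h] at h2
    have h3 := hS.completes_unique (by simp [QPath.single]) h1 h2
    exact Subtype.ext (i.mapPath_injective hi.onV.1 hi.onE h3)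
  have hcsurj : ∀ a, a ∈ cut ↔ ∃ m, c m = a := by
    intro a
    constructor
    · intro ha
      obtain ⟨m, hm, h⟩ := hi.exists_isMaximalPath_completes hS hcut hμ ha
      exact ⟨⟨m, hm⟩, hS.eq_of_completes hμ (hcm ⟨m, hm⟩) h⟩
    · rintro ⟨m, rfl⟩
      exact hc m
  let g : Hom P.extQuiver Q :=
    { onV := i.onV
      onE := Sum.elim i.onE c
      src_onE := by
        rintro (a | m)
        · exact i.src_onE a
        · have := (hS.completes_symm (hcm m)).1
          rw [Hom.last_mapPath] at this
          exact this.symm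
      tgt_onE := by
        rintro (a | m)
        · exact i.tgt_onE a
        · exact (hcm m).1 }
  have hginj : Function.Injective g.onE := by
    rintro (a | m) (b | m') h
    · exact congrArg Sum.inl (hi.onE h)
    · change i.onE a = c m' at h
      exact absurd (hc m') (h ▸ hi.onE_notMem a)
    · change c m = i.onE b at h
      exact absurd (hc m) (h ▸ hi.onE_notMem b)
    · exact congrArg Sum.inr (hcinj h)
  have hmapinl : ∀ l : List P.quiver.E, (l.map Sum.inl).map g.onE = l.map i.onE := by
    intro l
    rw [List.map_map]
    rfl
  refine ⟨g, hi.onV, ⟨hginj, ?_⟩, hcsurj, fun p => ?_⟩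
  · intro a
    by_cases ha : a ∈ cut
    · obtain ⟨m, rfl⟩ := (hcsurj a).1 ha
      exact ⟨Sum.inr m, rfl⟩
    · obtain ⟨b, rfl⟩ := (hi.notMem_iff a).1 ha
      exact ⟨Sum.inl b, rfl⟩
  · constructor
    · rintro ⟨m, W, U, e, hm⟩
      apply hS.mem_of_arrows_mem
      have h1 : (c m :: U.map i.onE) ++ W.map i.onE ∈ cycleWords S := by
        have := (hcm m).2
        change [c m] ++ m.1.arrows.map i.onE ∈ _ at this
        rw [← hm] at this
        simpa using this
      change p.arrows.map g.onE ∈ _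
      rw [e, List.map_append, List.map_cons, hmapinl, hmapinl]
      exact hS.append_comm_mem h1
    -- Every cycle meets the cut, so `p` contains a new arrow. Cut at the first one; uniqueness of
    -- tails then identifies the remaining arrows with those of its maximal path.
    · intro h
      have hw : p.arrows.map g.onE ∈ cycleWords S := ⟨_, h, rfl⟩
      rcases eq_map_inl_or_exists p.arrows with ⟨W, e⟩ | ⟨W, m, Z, e⟩
      · rw [e, hmapinl] at hw
        obtain ⟨x, hx, hx'⟩ := hcut.exists_mem hw
        obtain ⟨a, -, rfl⟩ := List.mem_map.1 hx'
        exact absurd hx (hi.onE_notMem a)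
      · rw [e, List.map_append, List.map_cons, hmapinl] at hw
        have hw' := hS.append_comm_mem hw
        change c m :: (Z.map g.onE ++ W.map i.onE) ∈ _ at hw'
        have h1 := hS.tail_unique hw' (hcm m).2
        change _ = m.1.arrows.map i.onE at h1
        rw [← hmapinl, ← List.map_append, ← hmapinl] at h1
        have h2 := List.map_injective_iff.2 hginj h1
        obtain ⟨U, V, e1, e2, e3⟩ := List.map_eq_append_iff.1 h2.symm
        refine ⟨m, W, U, by rw [e, e2], ?_⟩
        rw [e1]
        congr 1
        exact (List.map_injective_iff.2 Sum.inl_injective e3).symm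

end IsCutPresentation

/-- Algebras defined by cycles that correspond under a bijection of quivers. -/
theorem exists_algEquiv_extHom {Λ : Type u} [Ring Λ] [Algebra K Λ]
    {π : PathAlgebra K Q →ₐ[K] Λ} (hπ : Function.Surjective π) (hS : IsDefiningPair S μ)
    (hμ : ∀ C ∈ S, μ C = 1) (hv : ∀ v, ∃ C ∈ S, C.first = v)
    (hker : TwoSidedIdeal.ker π = TwoSidedIdeal.span {x | CycleRelation K S μ x})
    {g : Hom P.extQuiver Q} (hV : Function.Bijective g.onV) (hE : Function.Bijective g.onE)
    (hg : ∀ p, p ∈ P.extCycles ↔ g.mapPath p ∈ S) :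
    ∃ e : TrivialExtension K A ≃ₐ[K] Λ,
      ∀ a, e (P.extHom (ofArrow K a)) = π (ofArrow K (g.onE a)) := by
  obtain ⟨G, hG⟩ := exists_map (K := K) g hV
  -- Both algebras are path algebras modulo the radical of a trace form, so it is enough that the
  -- trace forms correspond.
  have htr : ∀ x, cycleTrace K S (G x) = cycleTrace K P.extCycles x := by
    intro x
    have : cycleTrace K S ∘ₗ G.toLinearMap = cycleTrace K P.extCycles := by
      apply PathAlgebra.linearMap_ext
      intro p
      rw [LinearMap.comp_apply, AlgHom.toLinearMap_apply, hG, cycleTrace_ofPath, cycleTrace_ofPath]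
      by_cases h : p ∈ P.extCycles
      · rw [if_pos h, if_pos ((hg p).1 h)]
      · rw [if_neg h, if_neg fun h' => h ((hg p).2 h')]
    exact LinearMap.congr_fun this x
  have hGs : Function.Surjective G := by
    intro x
    induction x using PathAlgebra.induction with
    | zero => exact ⟨0, map_zero _⟩
    | add x y hx hy =>
      obtain ⟨x, rfl⟩ := hx
      obtain ⟨y, rfl⟩ := hy
      exact ⟨x + y, map_add _ _ _⟩
    | path c p =>
      obtain ⟨q, rfl⟩ := g.mapPath_surjective hV hE.2 p
      exact ⟨c • ofPath K q, by rw [map_smul, hG]⟩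
  obtain ⟨e, he⟩ := exists_algEquiv_of_ker_iff P.extHom P.extHom_surjective (π.comp G)
    (hπ.comp hGs) (by
      intro x
      rw [P.extHom_eq_zero_iff, AlgHom.comp_apply, ← TwoSidedIdeal.mem_ker, hker,
        hS.mem_span_iff hμ hv]
      constructor
      · intro h q
        obtain ⟨q, rfl⟩ := g.mapPath_surjective hV hE.2 q
        rw [← hG, ← map_mul, htr, h]
      · intro h q
        rw [← htr, map_mul, hG, h])
  refine ⟨e, fun a => ?_⟩
  rw [he, AlgHom.comp_apply, ofArrow, hG]
  congr 2
  exact QPath.ext (g.src_onE a).symm rfl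

end Recover

/-- Every symmetric special multiserial algebra with an admissible cut is the trivial extension of
an almost gentle algebra. -/
theorem IsCutPair.exists_presentation {Λ : Type u} [Ring Λ] [Algebra K Λ] {D : Set Λ}
    (hD : IsCutPair K Λ D) :
    ∃ (A : Type u) (_ : Ring A) (_ : Algebra K A) (P : AlmostGentlePresentation K A)
      (e : TrivialExtension K A ≃ₐ[K] Λ), e '' P.newArrows = D := by
  obtain ⟨hΛ, -, Q, π, S, μ, cut, hE, hπ, hadm, -, hS, hμ, hker, hcut, rfl⟩ := hD
  have hsrc : ∀ a, ∃ C ∈ S, C.first = Q.src a := by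
    intro a
    obtain ⟨l, C, hC, e⟩ := hS.exists_cons_mem a
    exact ⟨C, hC, QPath.first_eq_src e⟩
  have htgt : ∀ a, ∃ C ∈ S, C.first = Q.tgt a := by
    intro a
    obtain ⟨l, hl⟩ := hS.exists_cons_mem a
    obtain ⟨C, hC, e⟩ := hS.append_comm_mem (l := [a]) hl
    refine ⟨C, hC, ?_⟩
    rw [← (hS.simple C hC).2.1, QPath.last, e, walkEnd_append]
    rfl
  -- A vertex without a cycle has no arrows, so it would be the only vertex by indecomposability,
  -- but the quiver has an arrow.
  have hv : ∀ v, ∃ C ∈ S, C.first = v := by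
    intro v
    by_cases h1 : ∃ a, Q.src a = v
    · obtain ⟨a, rfl⟩ := h1
      exact hsrc a
    by_cases h2 : ∃ a, Q.tgt a = v
    · obtain ⟨a, rfl⟩ := h2
      exact htgt a
    push Not at h1 h2
    obtain ⟨a⟩ := hE
    exact absurd (eq_of_isolated hΛ π hπ hadm h1 h2 _) (h1 a)
  obtain ⟨A, _, _, P, i, hV, hE', hi, hnext⟩ := exists_cutPresentation K hS hcut
  obtain ⟨g, gV, gE, gcut, gS⟩ :=
    (IsCutPresentation.mk hV hE' hi hnext).exists_hom hS hcut hμ hv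
  obtain ⟨e, he⟩ := exists_algEquiv_extHom hπ hS hμ hv hker gV gE gS
  refine ⟨A, _, _, P, e, ?_⟩
  rw [P.newArrows_eq_image, Set.image_image, ← Set.range_comp]
  ext x
  simp only [Set.mem_range, Set.mem_image, Function.comp_apply, he, gcut]
  constructor
  · rintro ⟨m, rfl⟩
    exact ⟨_, ⟨m, rfl⟩, rfl⟩
  · rintro ⟨_, ⟨m, rfl⟩, rfl⟩
    exact ⟨m, rfl⟩

end AlmostGentle

namespace AlmostGentle

open FinQuiver PathAlgebra

variable {K : Type u} [Field K]

/-! ### Isomorphism invariance -/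

theorem image_trans_eq {A B C : Type u} [Ring A] [Algebra K A] [Ring B] [Algebra K B] [Ring C]
    [Algebra K C] {e : A ≃ₐ[K] B} {f : B ≃ₐ[K] C} {D : Set A} {D' : Set B} {D'' : Set C}
    (h : e '' D = D') (h' : f '' D' = D'') : e.trans f '' D = D'' := by
  rw [← h', ← h, Set.image_image]
  rfl

theorem apply_mem_span {Λ Λ' : Type u} [Ring Λ] [Algebra K Λ] [Ring Λ'] [Algebra K Λ'] {D : Set Λ}
    {D' : Set Λ'} (e : Λ ≃ₐ[K] Λ') (he : Set.MapsTo e D D') {x : Λ}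
    (hx : x ∈ TwoSidedIdeal.span D) : e x ∈ TwoSidedIdeal.span D' := by
  induction hx using TwoSidedIdeal.span_induction with
  | mem x h => exact TwoSidedIdeal.subset_span (he h)
  | zero => rw [map_zero]; exact zero_mem _
  | add x y _ _ hx hy => rw [map_add]; exact add_mem hx hy
  | neg x _ hx => rw [map_neg]; exact neg_mem hx
  | left_absorb a x _ hx => rw [map_mul]; exact TwoSidedIdeal.mul_mem_left _ _ _ hx
  | right_absorb b x _ hx => rw [map_mul]; exact TwoSidedIdeal.mul_mem_right _ _ _ hx

theorem nonempty_cutAlgebra_congr {Λ Λ' : Type u} [Ring Λ] [Algebra K Λ] [Ring Λ'] [Algebra K Λ']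
    {D : Set Λ} {D' : Set Λ'} (e : Λ ≃ₐ[K] Λ') (he : e '' D = D') :
    Nonempty (CutAlgebra Λ D ≃ₐ[K] CutAlgebra Λ' D') := by
  obtain ⟨E, -⟩ := exists_algEquiv_of_ker_iff
    (RingCon.mkₐ (α := K) (TwoSidedIdeal.span D).ringCon) (RingCon.mkₐ_surjective _)
    ((RingCon.mkₐ (α := K) (TwoSidedIdeal.span D').ringCon).comp (e : Λ →ₐ[K] Λ'))
    (by simpa using (RingCon.mkₐ_surjective (α := K) (TwoSidedIdeal.span D').ringCon).comp e.surjective)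
    fun x => by
      refine (ker_mkₐ (K := K) _ x).trans (Iff.trans ?_ (ker_mkₐ (K := K) _ (e x)).symm)
      refine ⟨fun h => apply_mem_span e (fun a ha => he ▸ Set.mem_image_of_mem e ha) h, fun h => ?_⟩
      have := apply_mem_span (D := D') (D' := D) e.symm (by
        rw [← he]
        rintro _ ⟨a, ha, rfl⟩
        rwa [e.symm_apply_apply]) h
      rwa [e.symm_apply_apply] at this
  exact ⟨E⟩

/-- Transport of a presentation along an isomorphism. -/
def AlmostGentlePresentation.congr {A B : Type u} [Ring A] [Algebra K A] [Ring B] [Algebra K B]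
    (P : AlmostGentlePresentation K A) (e : A ≃ₐ[K] B) : AlmostGentlePresentation K B :=
  have h : TwoSidedIdeal.ker ((e : A →ₐ[K] B).comp P.π) = TwoSidedIdeal.ker P.π :=
    TwoSidedIdeal.ext fun x => by
      rw [TwoSidedIdeal.mem_ker, TwoSidedIdeal.mem_ker]
      exact map_eq_zero_iff e e.injective
  { quiver := P.quiver
    π := (e : A →ₐ[K] B).comp P.π
    surjective := e.surjective.comp P.surjective
    admissible := h ▸ P.admissible
    quadratic := h ▸ P.quadratic
    multiserial := h ▸ P.multiserial }

theorem IsAlmostGentle.congr {A B : Type u} [Ring A] [Algebra K A] [Ring B] [Algebra K B]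
    (h : IsAlmostGentle K A) (e : A ≃ₐ[K] B) : IsAlmostGentle K B :=
  ⟨isIndecomposable_of_algEquiv e h.1, h.2.map fun P => P.congr e⟩

/-- Every symmetric special multiserial algebra with an admissible cut is the trivial extension of
its cut algebra. -/
theorem IsCutPair.exists_presentation_cutAlgebra {Λ : Type u} [Ring Λ] [Algebra K Λ] {D : Set Λ}
    (hD : IsCutPair K Λ D) :
    ∃ (_ : IsAlmostGentle K (CutAlgebra Λ D)) (P : AlmostGentlePresentation K (CutAlgebra Λ D))
      (e : TrivialExtension K (CutAlgebra Λ D) ≃ₐ[K] Λ), e '' P.newArrows = D := by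
  obtain ⟨A, _, _, P, e, he⟩ := hD.exists_presentation
  have hA : IsAlmostGentle K A :=
    ⟨TrivialExtension.isIndecomposable_of (isIndecomposable_of_algEquiv e.symm hD.1), ⟨P⟩⟩
  obtain ⟨f⟩ := P.nonempty_cutAlgebra_equiv
  obtain ⟨f'⟩ := nonempty_cutAlgebra_congr e he
  -- The algebra `A` with its combinatorial presentation is `T(A)` modulo its new arrows, and `e`
  -- identifies this quotient with `Λ` modulo `D`. The presentation is carried over along this
  -- isomorphism.
  let θ : A ≃ₐ[K] CutAlgebra Λ D := f.symm.trans f'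
  obtain ⟨E, hE⟩ := AlmostGentlePresentation.exists_equiv_image_newArrows (P.congr θ) P θ.symm
  exact ⟨hA.congr θ, P.congr θ, E.trans e, image_trans_eq hE he⟩

/-! ### The bijection -/

theorem AlmostGentleAlgebra.isCutPair_newArrows (A : AlmostGentleAlgebra K) :
    IsCutPair K (TrivialExtension K A.carrier) A.isAlmostGentle.2.some.newArrows :=
  A.isAlmostGentle.2.some.isCutPair A.isAlmostGentle.1

theorem cutPairClass_newArrows_eq {A B : Type u} [Ring A] [Algebra K A] [Ring B] [Algebra K B]
    (P : AlmostGentlePresentation K A) (P' : AlmostGentlePresentation K B) (e : A ≃ₐ[K] B)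
    (h : IsCutPair K (TrivialExtension K A) P.newArrows)
    (h' : IsCutPair K (TrivialExtension K B) P'.newArrows) :
    cutPairClass _ _ h = cutPairClass _ _ h' :=
  Quotient.sound (AlmostGentlePresentation.exists_equiv_image_newArrows P P' e)

variable (K)

/-- The bijection between almost gentle algebras and symmetric special multiserial algebras with an
admissible cut. -/
def trivialExtensionEquiv : AlmostGentleClass K ≃ CutPairClass K where
  toFun := Quotient.lift (fun A => cutPairClass _ _ A.isCutPair_newArrows)
    fun _ _ ⟨e⟩ => cutPairClass_newArrows_eq _ _ e _ _
  invFun := Quotient.lift (fun X => almostGentleClass (CutAlgebra X.carrier X.cut)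
      X.isCutPair.exists_presentation_cutAlgebra.choose)
    fun _ _ ⟨e, he⟩ => Quotient.sound (nonempty_cutAlgebra_congr e he)
  left_inv := by
    rintro ⟨A⟩
    exact Quotient.sound (AlmostGentlePresentation.nonempty_cutAlgebra_equiv _)
  right_inv := by
    rintro ⟨X⟩
    obtain ⟨-, P, e, he⟩ := X.isCutPair.exists_presentation_cutAlgebra
    -- The presentation chosen in the definition of the map need not be `P`; independence of the
    -- presentation, applied to the identity, bridges the two.
    obtain ⟨E, hE⟩ := AlmostGentlePresentation.exists_equiv_image_newArrows
      X.isCutPair.exists_presentation_cutAlgebra.choose.2.some P AlgEquiv.refl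
    exact Quotient.sound ⟨E.trans e, image_trans_eq hE he⟩

end AlmostGentle

end

theorem corollary5p5 (K : Type u) [Field K] :
    ∃ φ : AlmostGentle.AlmostGentleClass K ≃ AlmostGentle.CutPairClass K,
      (∀ (A : Type u) [Ring A] [Algebra K A] (hA : AlmostGentle.IsAlmostGentle K A)
        (P : AlmostGentle.AlmostGentlePresentation K A),
        ∃ hT : AlmostGentle.IsCutPair K (AlmostGentle.TrivialExtension K A) P.newArrows,
          φ (AlmostGentle.almostGentleClass A hA) =
            AlmostGentle.cutPairClass (AlmostGentle.TrivialExtension K A) P.newArrows hT) ∧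
      (∀ (Λ : Type u) [Ring Λ] [Algebra K Λ] (D : Set Λ) (hD : AlmostGentle.IsCutPair K Λ D),
        ∃ hC : AlmostGentle.IsAlmostGentle K (AlmostGentle.CutAlgebra Λ D),
          φ.symm (AlmostGentle.cutPairClass Λ D hD) =
            AlmostGentle.almostGentleClass (AlmostGentle.CutAlgebra Λ D) hC) := by
  refine ⟨AlmostGentle.trivialExtensionEquiv K, fun A _ _ hA P => ?_, fun Λ _ _ D hD => ?_⟩
  · exact ⟨P.isCutPair hA.1,
      AlmostGentle.cutPairClass_newArrows_eq _ P AlgEquiv.refl _ (P.isCutPair hA.1)⟩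
  · exact ⟨hD.exists_presentation_cutAlgebra.choose, rfl⟩
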